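/- Let $\mathcal A(\mathbb R)$ be one of the spaces $C_c^\infty(\mathbb R)$, $\mathcal S(\mathbb R)$ (rapidly decreasing functions), or $W^{\infty,1}(\mathbb R)=\{f\in C^\infty(\mathbb R): f^{(k)}\in L^1(\mathbb R)\ \text{for all } k\ge 0\}$, and let $\mathcal A_1(\mathbb R)=\{f\in C^\infty(\mathbb R): f'\in\mathcal A(\mathbb R),\ \lim_{x\to-\infty}f(x)=0\}$. For $\mathfrak g=\mathcal A(\mathbb R)$ or $\mathfrak g=\mathcal A_1(\mathbb R)$ consider the group $\{\mathrm{Id}+f: f\in\mathfrak g,\ f'>-1\}$, denoted $\mathrm{Diff}_{\mathcal A}(\mathbb R)$ resp. $\mathrm{Diff}_{\mathcal A_1}(\mathbb R)$, with Lie algebra $\mathfrak g$, $\mathrm{ad}(X)Z=X'Z-XZ'$, and the right-invariant $\dot H^1$-metric $$G_\varphi(X\circ\varphi,Y\circ\varphi)=\int_{\mathbb R}X'(x)Y'(x)\,dx ,\qquad X,Y\in\mathfrak g .$$ Let $\check G:\mathfrak g\to\mathfrak g^*$, $\langle\check G(X),Z\rangle=\int_{\mathbb R} X'Z'\,dx$,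 and $\mathrm{ad}(X)^*\alpha=\alpha\circ\mathrm{ad}(X)$. The geodesic equation $u_t=-\check G^{-1}\mathrm{ad}(u)^*\check G(u)$ is said to exist if $\mathrm{ad}(X)^*\check G(X)\in\check G(\mathfrak g)$ for every $X\in\mathfrak g$. (1) On $\mathrm{Diff}_{\mathcal A_1}(\mathbb R)$ the geodesic equation exists: for every $X\in\mathcal A_1(\mathbb R)$ there is exactly one $Y\in\mathcal A_1(\mathbb R)$ with $\check G(Y)=\mathrm{ad}(X)^*\check G(X)$, namely $Y(x)=X(x)X'(x)-\tfrac12\int_{-\infty}^x X'(z)^2\,dz$. Moreover, let $a<b$ and let $\varphi$ be a smooth curve in $\mathrm{Diff}_{\mathcal A_1}(\mathbb R)$ defined on an open set $J\supseteq[a,b]$. Then $u(t)=\varphi_t(t,\cdot)\circ\varphi(t,\cdot)^{-1}\in\mathcal A_1(\mathbb R)$ for all $t\in J$, and $\varphi$ is a geodesic on $[a,b]$, that is, a critical point of the energy $\tfrac12\int_a^b G_{\varphi}(\varphi_t,\varphi_t)\,dt$ under smooth variations in $\mathrm{Diff}_{\mathcal A_1}(\mathbb R)$ with fixed end points, if and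 only if $u$ satisfies the non-periodic Hunter–Saxton equation $$u_t=-u\,u_x+\frac12\int_{-\infty}^x u_x(z)^2\,dz \qquad\text{for } t\in[a,b],\ x\in\mathbb R .$$ (2) The geodesic distance on $\mathrm{Diff}_{\mathcal A_1}(\mathbb R)$, i.e. the infimum of the lengths $\int_0^1\sqrt{G_\varphi(\varphi_t,\varphi_t)}\,dt$ of smooth curves in $\mathrm{Diff}_{\mathcal A_1}(\mathbb R)$ joining two given elements, is finite, and it is positive whenever the two elements are distinct. (3) On $\mathrm{Diff}_{\mathcal A}(\mathbb R)$ the geodesic equation does not exist: for every $X\in\mathcal A(\mathbb R)$ with $X\neq0$ the functional $\mathrm{ad}(X)^*\check G(X)$ does not lie in $\check G(\mathcal A(\mathbb R))$. -/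

import Mathlib

open MeasureTheory Set Filter Topology
open scoped ContDiff NNReal ENNReal

namespace HunterSaxton

/-! ### The function spaces -/

/-- The three model spaces `𝒜(ℝ)`: compactly supported smooth functions `C_c^∞(ℝ)`, rapidly
decreasing functions `𝒮(ℝ)`, and `W^{∞,1}(ℝ)`. -/
inductive DecayClass
  | compactSupport
  | schwartz
  | sobolev

/-- Membership in `𝒜(ℝ)`. -/
def DecayClass.Mem : DecayClass → (ℝ → ℝ) → Prop
  | .compactSupport, f => ContDiff ℝ ∞ f ∧ HasCompactSupport f
  | .schwartz, f => ∃ g : SchwartzMap ℝ ℝ, ⇑g = f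
  | .sobolev, f => ContDiff ℝ ∞ f ∧ ∀ n : ℕ, Integrable (iteratedDeriv n f)

/-- Membership in `𝒜₁(ℝ)`: smooth functions vanishing at `-∞` with derivative in `𝒜(ℝ)`. -/
def DecayClass.Mem₁ (A : DecayClass) (f : ℝ → ℝ) : Prop :=
  ContDiff ℝ ∞ f ∧ A.Mem (deriv f) ∧ Tendsto f atBot (𝓝 0)

/-- The space `ℬ(ℝ)` of smooth functions with all derivatives bounded (only used to check that
the spaces below are closed under the Lie bracket). -/
def BddSmooth (f : ℝ → ℝ) : Prop :=
  ContDiff ℝ ∞ f ∧ ∀ n : ℕ, ∃ C : ℝ, ∀ x, |iteratedDeriv n f x| ≤ C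

section Closure

theorem contDiff_deriv {f : ℝ → ℝ} (hf : ContDiff ℝ ∞ f) : ContDiff ℝ ∞ (deriv f) :=
  (contDiff_infty_iff_deriv.1 hf).2

theorem DecayClass.Mem.contDiff {A : DecayClass} {f : ℝ → ℝ} (h : A.Mem f) : ContDiff ℝ ∞ f := by
  cases A with
  | compactSupport => exact h.1
  | schwartz => obtain ⟨g, rfl⟩ := h; exact g.smooth'
  | sobolev => exact h.1

theorem DecayClass.Mem.deriv {A : DecayClass} {f : ℝ → ℝ} (h : A.Mem f) : A.Mem (deriv f) := by
  cases A with
  | compactSupport => exact ⟨contDiff_deriv h.1, h.2.deriv⟩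
  | schwartz =>
    obtain ⟨g, rfl⟩ := h
    exact ⟨SchwartzMap.derivCLM ℝ ℝ g, rfl⟩
  | sobolev =>
    refine ⟨contDiff_deriv h.1, fun n => ?_⟩
    rw [← iteratedDeriv_succ']
    exact h.2 (n + 1)

theorem DecayClass.Mem.integrable {A : DecayClass} {f : ℝ → ℝ} (h : A.Mem f) : Integrable f := by
  cases A with
  | compactSupport => exact h.1.continuous.integrable_of_hasCompactSupport h.2
  | schwartz => obtain ⟨g, rfl⟩ := h; exact g.integrable
  | sobolev => simpa using h.2 0

theorem bounded_of_integrable_deriv {f : ℝ → ℝ} (hf : ContDiff ℝ ∞ f)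
    (h : Integrable (deriv f)) : ∃ C : ℝ, ∀ x, |f x| ≤ C := by
  refine ⟨|f 0| + ∫ x, ‖deriv f x‖, fun x => ?_⟩
  have h1 : ∫ y in (0 : ℝ)..x, deriv f y = f x - f 0 := by
    apply intervalIntegral.integral_deriv_eq_sub
    · intro y _
      exact (hf.differentiable (by simp)).differentiableAt
    · exact h.intervalIntegrable
  have h2 : ‖∫ y in (0 : ℝ)..x, deriv f y‖ ≤ ∫ x, ‖deriv f x‖ := by
    refine intervalIntegral.norm_integral_le_integral_norm_uIoc.trans ?_
    exact setIntegral_le_integral h.norm (Eventually.of_forall fun _ => norm_nonneg _)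
  rw [h1, Real.norm_eq_abs] at h2
  have h3 : |f x| ≤ |f 0| + |f x - f 0| := by
    have := abs_add_le (f 0) (f x - f 0)
    simpa using this
  linarith

theorem DecayClass.Mem.iter {A : DecayClass} {f : ℝ → ℝ} (h : A.Mem f) (n : ℕ) :
    A.Mem (iteratedDeriv n f) := by
  induction n with
  | zero => simpa using h
  | succ n ih => rw [iteratedDeriv_succ]; exact ih.deriv

theorem DecayClass.Mem.bddSmooth {A : DecayClass} {f : ℝ → ℝ} (h : A.Mem f) : BddSmooth f :=
  ⟨h.contDiff, fun n => bounded_of_integrable_deriv (h.iter n).contDiff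
    (h.iter n).deriv.integrable⟩

theorem DecayClass.Mem₁.bddSmooth {A : DecayClass} {f : ℝ → ℝ} (h : A.Mem₁ f) : BddSmooth f := by
  refine ⟨h.1, fun n => ?_⟩
  cases n with
  | zero => simpa using bounded_of_integrable_deriv h.1 h.2.1.integrable
  | succ n => rw [iteratedDeriv_succ']; exact h.2.1.bddSmooth.2 n

theorem DecayClass.Mem.zero (A : DecayClass) : A.Mem 0 := by
  cases A with
  | compactSupport => exact ⟨contDiff_const, HasCompactSupport.zero⟩
  | schwartz => exact ⟨0, rfl⟩
  | sobolev =>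
    refine ⟨contDiff_const, fun n => ?_⟩
    have : iteratedDeriv n (0 : ℝ → ℝ) = 0 := by
      funext x
      simp
    rw [this]
    exact integrable_zero _ _ _

theorem DecayClass.Mem.add {A : DecayClass} {f g : ℝ → ℝ} (hf : A.Mem f) (hg : A.Mem g) :
    A.Mem (f + g) := by
  cases A with
  | compactSupport => exact ⟨hf.1.add hg.1, hf.2.add hg.2⟩
  | schwartz => obtain ⟨f, rfl⟩ := hf; obtain ⟨g, rfl⟩ := hg; exact ⟨f + g, rfl⟩
  | sobolev =>
    refine ⟨hf.1.add hg.1, fun n => ?_⟩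
    have : iteratedDeriv n (f + g) = iteratedDeriv n f + iteratedDeriv n g := by
      funext x
      exact iteratedDeriv_add ((hf.1.of_le (by exact_mod_cast le_top)).contDiffAt)
        ((hg.1.of_le (by exact_mod_cast le_top)).contDiffAt)
    rw [this]
    exact (hf.2 n).add (hg.2 n)

theorem BddSmooth.hasTemperateGrowth {g : ℝ → ℝ} (hg : BddSmooth g) :
    g.HasTemperateGrowth := by
  refine ⟨hg.1, fun n => ?_⟩
  obtain ⟨C, hC⟩ := hg.2 n
  refine ⟨0, C, fun x => ?_⟩
  rw [norm_iteratedFDeriv_eq_norm_iteratedDeriv]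
  simpa using hC x

theorem DecayClass.Mem.mul {A : DecayClass} {f g : ℝ → ℝ} (hf : A.Mem f) (hg : BddSmooth g) :
    A.Mem (f * g) := by
  cases A with
  | compactSupport => exact ⟨hf.1.mul hg.1, hf.2.mul_right⟩
  | schwartz =>
    obtain ⟨f, rfl⟩ := hf
    refine ⟨SchwartzMap.smulLeftCLM ℝ g f, ?_⟩
    rw [SchwartzMap.smulLeftCLM_apply hg.hasTemperateGrowth]
    funext x
    simp [mul_comm]
  | sobolev =>
    refine ⟨hf.1.mul hg.1, fun n => ?_⟩
    have : iteratedDeriv n (f * g) = fun x => ∑ i ∈ Finset.range (n + 1),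
        n.choose i * iteratedDeriv i f x * iteratedDeriv (n - i) g x := by
      funext x
      exact iteratedDeriv_mul ((hf.1.of_le (by exact_mod_cast le_top)).contDiffAt)
        ((hg.1.of_le (by exact_mod_cast le_top)).contDiffAt)
    rw [this]
    refine integrable_finsetSum _ fun i _ => ?_
    obtain ⟨C, hC⟩ := hg.2 (n - i)
    refine Integrable.mul_bdd (c := C) ((hf.2 i).const_mul _) ?_ (Eventually.of_forall hC)
    exact ((contDiff_infty.1 hg.1 (n - i)).continuous_iteratedDeriv (n - i)
      le_rfl).aestronglyMeasurable

theorem bddSmooth_const (c : ℝ) : BddSmooth (fun _ => c) := by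
  refine ⟨contDiff_const, fun n => ⟨|c|, fun x => ?_⟩⟩
  rw [iteratedDeriv_const]
  split_ifs <;> simp

theorem DecayClass.Mem.smul {A : DecayClass} {f : ℝ → ℝ} (c : ℝ) (hf : A.Mem f) :
    A.Mem (c • f) := by
  have : c • f = f * fun _ => c := by funext x; simp [mul_comm]
  rw [this]
  exact hf.mul (bddSmooth_const c)

theorem DecayClass.Mem.sub {A : DecayClass} {f g : ℝ → ℝ} (hf : A.Mem f) (hg : A.Mem g) :
    A.Mem (f - g) := by
  have : f - g = f + (-1 : ℝ) • g := by funext x; simp [sub_eq_add_neg]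
  rw [this]
  exact hf.add (hg.smul _)

theorem differentiable_of {f : ℝ → ℝ} (hf : ContDiff ℝ ∞ f) : Differentiable ℝ f :=
  hf.differentiable (by simp)

theorem BddSmooth.tendsto_mul {f g : ℝ → ℝ} (hg : BddSmooth g) {l : Filter ℝ}
    (hf : Tendsto f l (𝓝 0)) : Tendsto (fun x => g x * f x) l (𝓝 0) := by
  obtain ⟨C, hC⟩ := hg.2 0
  have h1 : Tendsto (fun x => C * |f x|) l (𝓝 0) := by
    simpa using (hf.abs.const_mul C)
  refine squeeze_zero_norm (fun x => ?_) h1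
  rw [norm_mul, Real.norm_eq_abs, Real.norm_eq_abs]
  exact mul_le_mul_of_nonneg_right (by simpa using hC x) (abs_nonneg _)

theorem BddSmooth.deriv {g : ℝ → ℝ} (hg : BddSmooth g) : BddSmooth (deriv g) :=
  ⟨contDiff_deriv hg.1, fun n => by rw [← iteratedDeriv_succ']; exact hg.2 (n + 1)⟩

theorem deriv_ad {f g : ℝ → ℝ} (hf : ContDiff ℝ ∞ f) (hg : ContDiff ℝ ∞ g) :
    deriv (deriv f * g - f * deriv g) = deriv (deriv f) * g - deriv (deriv g) * f := by
  funext x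
  have h1 := (differentiable_of hf x).hasDerivAt
  have h2 := (differentiable_of hg x).hasDerivAt
  have h3 := (differentiable_of (contDiff_deriv hf) x).hasDerivAt
  have h4 := (differentiable_of (contDiff_deriv hg) x).hasDerivAt
  rw [((h3.mul h2).sub (h1.mul h4)).deriv]
  simp only [Pi.sub_apply, Pi.mul_apply]
  ring

end Closure

/-! ### Lie algebras of vector fields, the `Ḣ¹`-inner product and the coadjoint action -/

/-- A Lie algebra of smooth vector fields `X ∂ₓ` on `ℝ` on which the `Ḣ¹`-inner product is
defined; below the only instances are `𝒜(ℝ)` and `𝒜₁(ℝ)`. -/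
structure VFAlgebra where
  carrier : Submodule ℝ (ℝ → ℝ)
  smooth : ∀ f ∈ carrier, ContDiff ℝ ∞ f
  integrable : ∀ f ∈ carrier, ∀ g ∈ carrier, Integrable (fun x => deriv f x * deriv g x)
  ad_mem : ∀ f ∈ carrier, ∀ g ∈ carrier, deriv f * g - f * deriv g ∈ carrier

/-- The Lie algebra `𝒜(ℝ)` of `Diff_𝒜(ℝ)`. -/
def DecayClass.alg (A : DecayClass) : VFAlgebra where
  carrier :=
    { carrier := {f | A.Mem f}
      add_mem' := fun hf hg => DecayClass.Mem.add hf hg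
      zero_mem' := DecayClass.Mem.zero A
      smul_mem' := fun c _ hf => DecayClass.Mem.smul c hf }
  smooth := fun _ hf => DecayClass.Mem.contDiff hf
  integrable := fun _ hf _ hg =>
    ((DecayClass.Mem.deriv hf).mul (DecayClass.Mem.bddSmooth hg).deriv).integrable
  ad_mem := fun f hf g hg => by
    have hf' : A.Mem f := hf
    have hg' : A.Mem g := hg
    exact (hf'.deriv.mul hg'.bddSmooth).sub (hf'.mul hg'.bddSmooth.deriv)

/-- The Lie algebra `𝒜₁(ℝ)` of `Diff_{𝒜₁}(ℝ)`. -/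
def DecayClass.alg₁ (A : DecayClass) : VFAlgebra where
  carrier :=
    { carrier := {f | A.Mem₁ f}
      add_mem' := by
        rintro f g ⟨hf, hf', hf0⟩ ⟨hg, hg', hg0⟩
        refine ⟨hf.add hg, ?_, by simpa using! hf0.add hg0⟩
        have : deriv (f + g) = deriv f + deriv g := by
          funext x
          exact deriv_add (differentiable_of hf x) (differentiable_of hg x)
        rw [this]
        exact hf'.add hg'
      zero_mem' := by
        refine ⟨contDiff_const, ?_, tendsto_const_nhds⟩
        have : deriv (0 : ℝ → ℝ) = 0 := by
          funext x
          exact deriv_const x (0 : ℝ)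
        rw [this]
        exact DecayClass.Mem.zero A
      smul_mem' := by
        rintro c f ⟨hf, hf', hf0⟩
        refine ⟨hf.const_smul c, ?_, by simpa using! hf0.const_smul c⟩
        have : deriv (c • f) = c • deriv f := by
          funext x
          exact deriv_const_smul c (differentiable_of hf x)
        rw [this]
        exact hf'.smul c }
  smooth := fun _ hf => hf.1
  integrable := fun _ hf _ hg => (hf.2.1.mul hg.2.1.bddSmooth).integrable
  ad_mem := fun f hf g hg => by
    have hf' : A.Mem₁ f := hf
    have hg' : A.Mem₁ g := hg
    refine ⟨((contDiff_deriv hf'.1).mul hg'.1).sub (hf'.1.mul (contDiff_deriv hg'.1)), ?_, ?_⟩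
    · rw [deriv_ad hf'.1 hg'.1]
      exact (hf'.2.1.deriv.mul hg'.bddSmooth).sub (hg'.2.1.deriv.mul hf'.bddSmooth)
    · have h1 := hf'.bddSmooth.deriv.tendsto_mul hg'.2.2
      have h2 := hg'.bddSmooth.deriv.tendsto_mul hf'.2.2
      have h3 := h1.sub h2
      rw [sub_zero] at h3
      refine h3.congr fun x => ?_
      simp only [Pi.sub_apply, Pi.mul_apply]
      ring

/-- The `Ḣ¹`-inner product `∫ X' Y' dx`. -/
noncomputable def hdot (X Y : ℝ → ℝ) : ℝ := ∫ x, deriv X x * deriv Y x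

/-- The map `Ǧ : 𝔤 → 𝔤*`, `Ǧ(X) = (Z ↦ ∫ X' Z' dx)`. Only the image of `Ǧ` and equality with
its elements matter below, so the full algebraic dual serves as the target. -/
noncomputable def VFAlgebra.flat (𝔤 : VFAlgebra) :
    𝔤.carrier →ₗ[ℝ] Module.Dual ℝ 𝔤.carrier :=
  LinearMap.mk₂ ℝ (fun X Y => hdot X Y)
    (fun X₁ X₂ Y => by
      have h : ∀ x, deriv ((X₁ + X₂ : 𝔤.carrier) : ℝ → ℝ) x * deriv (Y : ℝ → ℝ) x =
          deriv (X₁ : ℝ → ℝ) x * deriv (Y : ℝ → ℝ) x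
            + deriv (X₂ : ℝ → ℝ) x * deriv (Y : ℝ → ℝ) x := fun x => by
        rw [Submodule.coe_add, deriv_add (differentiable_of (𝔤.smooth _ X₁.2) x)
          (differentiable_of (𝔤.smooth _ X₂.2) x), add_mul]
      simp only [hdot, h]
      exact integral_add (𝔤.integrable _ X₁.2 _ Y.2) (𝔤.integrable _ X₂.2 _ Y.2))
    (fun c X Y => by
      have h : ∀ x, deriv ((c • X : 𝔤.carrier) : ℝ → ℝ) x * deriv (Y : ℝ → ℝ) x =
          c * (deriv (X : ℝ → ℝ) x * deriv (Y : ℝ → ℝ) x) := fun x => by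
        rw [Submodule.coe_smul, deriv_const_smul c (differentiable_of (𝔤.smooth _ X.2) x),
          smul_eq_mul, mul_assoc]
      simp only [hdot, h]
      exact integral_const_mul _ _)
    (fun X Y₁ Y₂ => by
      have h : ∀ x, deriv (X : ℝ → ℝ) x * deriv ((Y₁ + Y₂ : 𝔤.carrier) : ℝ → ℝ) x =
          deriv (X : ℝ → ℝ) x * deriv (Y₁ : ℝ → ℝ) x
            + deriv (X : ℝ → ℝ) x * deriv (Y₂ : ℝ → ℝ) x := fun x => by
        rw [Submodule.coe_add, deriv_add (differentiable_of (𝔤.smooth _ Y₁.2) x)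
          (differentiable_of (𝔤.smooth _ Y₂.2) x), mul_add]
      simp only [hdot, h]
      exact integral_add (𝔤.integrable _ X.2 _ Y₁.2) (𝔤.integrable _ X.2 _ Y₂.2))
    (fun c X Y => by
      have h : ∀ x, deriv (X : ℝ → ℝ) x * deriv ((c • Y : 𝔤.carrier) : ℝ → ℝ) x =
          c * (deriv (X : ℝ → ℝ) x * deriv (Y : ℝ → ℝ) x) := fun x => by
        rw [Submodule.coe_smul, deriv_const_smul c (differentiable_of (𝔤.smooth _ Y.2) x),
          smul_eq_mul]
        ring
      simp only [hdot, h]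
      exact integral_const_mul _ _)

/-- `ad(X) Z = X' Z - X Z'`, the Lie bracket of the diffeomorphism group, which is the negative
of the bracket of the vector fields `X ∂ₓ` and `Z ∂ₓ`. -/
noncomputable def VFAlgebra.ad (𝔤 : VFAlgebra) (X : 𝔤.carrier) :
    𝔤.carrier →ₗ[ℝ] 𝔤.carrier where
  toFun Z := ⟨deriv (X : ℝ → ℝ) * (Z : ℝ → ℝ) - (X : ℝ → ℝ) * deriv (Z : ℝ → ℝ),
    𝔤.ad_mem _ X.2 _ Z.2⟩
  map_add' Y Z := by
    apply Subtype.ext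
    funext x
    simp only [Submodule.coe_add, Pi.add_apply, Pi.sub_apply, Pi.mul_apply]
    rw [deriv_add (differentiable_of (𝔤.smooth _ Y.2) x)
      (differentiable_of (𝔤.smooth _ Z.2) x)]
    ring
  map_smul' c Z := by
    apply Subtype.ext
    funext x
    simp only [Submodule.coe_smul, Pi.smul_apply, Pi.sub_apply, Pi.mul_apply, RingHom.id_apply,
      smul_eq_mul]
    rw [deriv_const_smul c (differentiable_of (𝔤.smooth _ Z.2) x), smul_eq_mul]
    ring

/-- `ad(X)* α = α ∘ ad(X)`. -/
noncomputable def VFAlgebra.adStar (𝔤 : VFAlgebra) (X : 𝔤.carrier) :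
    Module.Dual ℝ 𝔤.carrier →ₗ[ℝ] Module.Dual ℝ 𝔤.carrier :=
  (𝔤.ad X).dualMap

/-- The geodesic equation `u_t = -Ǧ⁻¹ ad(u)* Ǧ(u)` of the right-invariant metric exists:
`ad(X)* Ǧ(X)` lies in the image of `Ǧ` for every `X ∈ 𝔤`. -/
def VFAlgebra.GeodesicEquationExists (𝔤 : VFAlgebra) : Prop :=
  ∀ X : 𝔤.carrier, 𝔤.adStar X (𝔤.flat X) ∈ LinearMap.range 𝔤.flat

/-! ### Smooth families in `𝒜(ℝ)`, `𝒜₁(ℝ)` and `Diff_{𝒜₁}(ℝ)` -/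

section Families

variable {E : Type*} [NormedAddCommGroup E] [NormedSpace ℝ E]

/-- The mixed derivative `∂_t^k ∂_x^n f(t,x)` of a family `f` with parameter `t`. -/
noncomputable def mixedDeriv (f : E → ℝ → ℝ) (k n : ℕ) (t : E) (x : ℝ) :
    ContinuousMultilinearMap ℝ (fun _ : Fin k => E) ℝ :=
  iteratedFDeriv ℝ k (fun τ => iteratedDeriv n (f τ) x) t

/-- The decay that a smooth map from `U` into `𝒜(ℝ)` has, locally uniformly in the parameter. -/
def DecayClass.LocallyUniformDecay (A : DecayClass) (U : Set E) (f : E → ℝ → ℝ) : Prop :=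
  match A with
  | .compactSupport => ∀ K ⊆ U, IsCompact K → ∃ R : ℝ, ∀ t ∈ K, ∀ x, R < |x| → f t x = 0
  | .schwartz => ∀ K ⊆ U, IsCompact K → ∀ k m n : ℕ, ∃ C : ℝ, ∀ t ∈ K, ∀ x,
      (1 + x ^ 2) ^ m * ‖mixedDeriv f k n t x‖ ≤ C
  | .sobolev => ∀ K ⊆ U, IsCompact K → ∀ k n : ℕ, ∃ C : ℝ≥0, ∀ t ∈ K,
      ∫⁻ x, ‖mixedDeriv f k n t x‖ₑ ≤ C

/-- `t ↦ f t` is a smooth map from the open parameter set `U` into `𝒜₁(ℝ)`. -/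
def DecayClass.IsSmoothFamily₁ (A : DecayClass) (U : Set E) (f : E → ℝ → ℝ) : Prop :=
  ContDiffOn ℝ ∞ (fun p : E × ℝ => f p.1 p.2) (U ×ˢ univ) ∧
    A.LocallyUniformDecay U (fun t => deriv (f t)) ∧
    ∀ t ∈ U, Tendsto (f t) atBot (𝓝 0)

/-- The group `Diff_{𝒜₁}(ℝ) = {Id + f : f ∈ 𝒜₁(ℝ), f' > -1}`. -/
def DecayClass.diff₁ (A : DecayClass) : Set (ℝ → ℝ) :=
  {φ | A.Mem₁ (fun x => φ x - x) ∧ ∀ x, -1 < deriv (fun y => φ y - y) x}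

/-- `t ↦ φ t` is a smooth map from the open parameter set `U` into `Diff_{𝒜₁}(ℝ)`. -/
def DecayClass.IsSmoothDiffFamily₁ (A : DecayClass) (U : Set E) (φ : E → ℝ → ℝ) : Prop :=
  A.IsSmoothFamily₁ U (fun t x => φ t x - x) ∧ ∀ t ∈ U, φ t ∈ A.diff₁

end Families

/-! ### The right-invariant metric, energy, geodesics, and geodesic distance -/

/-- The right-invariant metric `G_φ(h, k) = ∫ (h ∘ φ⁻¹)' (k ∘ φ⁻¹)' dx`. -/
noncomputable def metric (φ h k : ℝ → ℝ) : ℝ :=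
  hdot (h ∘ Function.invFun φ) (k ∘ Function.invFun φ)

/-- The velocity `φ_t(t, ·)` of a curve of diffeomorphisms. -/
noncomputable def velocity (φ : ℝ → ℝ → ℝ) (t : ℝ) : ℝ → ℝ := fun x => deriv (fun τ => φ τ x) t

/-- The right logarithmic derivative `u(t) = φ_t(t, ·) ∘ φ(t, ·)⁻¹`. -/
noncomputable def rightLogDeriv (φ : ℝ → ℝ → ℝ) (t : ℝ) : ℝ → ℝ :=
  velocity φ t ∘ Function.invFun (φ t)

/-- The energy `½ ∫_a^b G_φ(φ_t, φ_t) dt` of a curve. -/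
noncomputable def energy (a b : ℝ) (φ : ℝ → ℝ → ℝ) : ℝ :=
  1 / 2 * ∫ t in a..b, metric (φ t) (velocity φ t) (velocity φ t)

/-- The curve `φ`, defined on `J ⊇ [a, b]`, is a geodesic on `[a, b]`: it is critical for the
energy among all smooth variations `g(s, t)` in `Diff_{𝒜₁}(ℝ)` with fixed end points. -/
def DecayClass.IsGeodesic₁ (A : DecayClass) (J : Set ℝ) (a b : ℝ) (φ : ℝ → ℝ → ℝ) : Prop :=
  ∀ (ε : ℝ) (g : ℝ × ℝ → ℝ → ℝ), 0 < ε → A.IsSmoothDiffFamily₁ (Ioo (-ε) ε ×ˢ J) g →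
    (∀ t ∈ J, g (0, t) = φ t) →
    (∀ s ∈ Ioo (-ε) ε, g (s, a) = φ a ∧ g (s, b) = φ b) →
    HasDerivAt (fun s => energy a b (fun t => g (s, t))) 0 0

/-- The Hunter–Saxton equation `u_t = -u u_x + ½ ∫_{-∞}^x u_x(z)² dz` at all times in `I`. -/
def SolvesHunterSaxton (I : Set ℝ) (u : ℝ → ℝ → ℝ) : Prop :=
  ∀ t ∈ I, ∀ x, HasDerivAt (fun τ => u τ x)
    (-(u t x * deriv (u t) x) + 1 / 2 * ∫ z in Iic x, (deriv (u t) z) ^ 2) t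

/-- The length `∫_0^1 √(G_φ(φ_t, φ_t)) dt` of a curve. -/
noncomputable def length (φ : ℝ → ℝ → ℝ) : ℝ≥0∞ :=
  ∫⁻ t in Icc (0 : ℝ) 1, ENNReal.ofReal √(metric (φ t) (velocity φ t) (velocity φ t))

/-- The geodesic distance on `Diff_{𝒜₁}(ℝ)`: the infimum of the lengths of smooth curves
`[0, 1] → Diff_{𝒜₁}(ℝ)` from `φ₀` to `φ₁`. -/
noncomputable def DecayClass.geodesicDist₁ (A : DecayClass) (φ₀ φ₁ : ℝ → ℝ) : ℝ≥0∞ :=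
  ⨅ (φ : ℝ → ℝ → ℝ) (J : Set ℝ) (_ : IsOpen J) (_ : Icc 0 1 ⊆ J)
    (_ : A.IsSmoothDiffFamily₁ J φ) (_ : φ 0 = φ₀) (_ : φ 1 = φ₁), length φ

end HunterSaxton

open HunterSaxton

/-! Geodesics and distance both rest on the root speed `r = ∂_t √φ_x` (`rootSpeed`). Substituting
`φ` turns the metric on velocities into `∫ φ_tx² / φ_x dx = 4 ∫ r² dx` (`metric_velocity_eq`). So `φ
↦ 2 √φ_x` pulls the flat `L²`-metric back to the `Ḣ¹`-metric, and geodesics should be the curves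
along which `√φ_x` is affine in time. The condition `r_t = 0` reads `φ_ttx = φ_tx² / (2 φ_x)`. This
is the Hunter–Saxton equation in Lagrangian form: `u_t + u u_x = φ_tt ∘ φ⁻¹`, and since `φ_tt`
vanishes at `-∞`, nothing is lost by differentiating the equation in `x` (`solvesHunterSaxton_iff`).

A solution is critical because `E(s) - E(0) = 2 ∬ (r_s - r_0)² + 4 ∬ r_0 (r_s - r_0)`. When `r_0` is
constant in time, the cross term is a boundary term and vanishes for fixed end points. The quadratic
term is `O(s²)` by `exists_lintegral_sq_rootSpeed_sub_le`. Conversely, along `φ + s α(t) B(x)` the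
convexity of `v² / w` gives an affine minorant of the energy that touches it at `s = 0`. Criticality
forces its slope to be zero (`integral_variation_eq_zero`), and the fundamental lemma of the
calculus of variations, used in `x` and then in `t`, yields the equation.

For the coadjoint action, two integrations by parts (`hdot_ad`) show that `ad(X)* Ǧ(X)` is `Z ↦ ∫ ρ
Z'` with `ρ = ½ X'² + X X''`. In `𝒜₁` the primitive of `ρ` that vanishes at `-∞` is admissible and
is the preimage. In `𝒜` a preimage `Y` would satisfy `Y' = ρ`, hence `∫ ρ = 0`, whereas `∫ ρ = -½ ∫
X'²` (`adStar_flat_notMem_range`).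

For the distance, the change of `√φ_x` at a point is at most `∫ |r| dt`. On an interval where the
square roots at the two ends differ by a fixed amount, Cauchy–Schwarz bounds the length from below
in terms of the end points alone (`le_length`). Finiteness comes from a convex path.

The three decay classes enter mainly through locally uniform `L¹`- and sup-bounds on parameter
derivatives of `φ_x` (`exists_lintegral_le`, `exists_bound`) and a locally uniform positive lower
bound for `φ_x`. -/

namespace HunterSaxton

/-! ### Calculus of jointly smooth families -/

section JointlySmooth

variable {E V : Type*} [NormedAddCommGroup E] [NormedSpace ℝ E]
  [NormedAddCommGroup V] [NormedSpace ℝ V]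

/-- The family `h` is jointly smooth in the parameter `t ∈ U` and in `x ∈ ℝ`. -/
def JointlySmooth (U : Set E) (h : E → ℝ → V) : Prop :=
  ContDiffOn ℝ ∞ (fun p : E × ℝ => h p.1 p.2) (U ×ˢ univ)

variable {U : Set E} {h : E → ℝ → V}

theorem jointlySmooth_iff (hU : IsOpen U) :
    JointlySmooth U h ↔ ∀ t ∈ U, ∀ x, ContDiffAt ℝ ∞ (fun p : E × ℝ => h p.1 p.2) (t, x) := by
  constructor
  · intro H t ht x
    exact H.contDiffAt ((hU.prod isOpen_univ).mem_nhds ⟨ht, mem_univ x⟩)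
  · rintro H ⟨t, x⟩ ⟨ht, -⟩
    exact (H t ht x).contDiffWithinAt

namespace JointlySmooth

theorem contDiffAt (H : JointlySmooth U h) (hU : IsOpen U) {t : E} (ht : t ∈ U) (x : ℝ) :
    ContDiffAt ℝ ∞ (fun p : E × ℝ => h p.1 p.2) (t, x) :=
  (jointlySmooth_iff hU).1 H t ht x

theorem contDiffAt_param (H : JointlySmooth U h) (hU : IsOpen U) {t : E} (ht : t ∈ U) (x : ℝ) :
    ContDiffAt ℝ ∞ (fun τ => h τ x) t :=
  (H.contDiffAt hU ht x).comp t (contDiffAt_id.prodMk contDiffAt_const)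

theorem contDiff_space (H : JointlySmooth U h) (hU : IsOpen U) {t : E} (ht : t ∈ U) :
    ContDiff ℝ ∞ (h t) :=
  contDiff_iff_contDiffAt.2 fun x =>
    (H.contDiffAt hU ht x).comp x (contDiffAt_const.prodMk contDiffAt_id)

theorem differentiableAt_param (H : JointlySmooth U h) (hU : IsOpen U) {t : E} (ht : t ∈ U)
    (x : ℝ) : DifferentiableAt ℝ (fun τ => h τ x) t :=
  (H.contDiffAt_param hU ht x).differentiableAt (by simp)

theorem differentiable_space (H : JointlySmooth U h) (hU : IsOpen U) {t : E} (ht : t ∈ U) :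
    Differentiable ℝ (h t) :=
  (H.contDiff_space hU ht).differentiable (by simp)

theorem continuousOn (H : JointlySmooth U h) :
    ContinuousOn (fun p : E × ℝ => h p.1 p.2) (U ×ˢ univ) :=
  ContDiffOn.continuousOn H

/-- The function being differentiated is regarded as a family of functions of `τ` indexed by `(t,
x)`, so that smoothness of a parametrised derivative applies. -/
theorem fderiv_param (H : JointlySmooth U h) (hU : IsOpen U) :
    JointlySmooth U (fun t x => fderiv ℝ (fun τ => h τ x) t) := by
  rw [jointlySmooth_iff hU]
  intro t ht x
  refine ContDiffAt.fderiv (f := fun (p : E × ℝ) (τ : E) => h τ p.2) (g := fun p => p.1)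
    (n := ∞) (m := ∞) ?_ contDiffAt_fst (by simp)
  exact ContDiffAt.comp (g := fun p : E × ℝ => h p.1 p.2)
    (f := fun q : (E × ℝ) × E => (q.2, q.1.2)) _ (H.contDiffAt hU ht x)
    (contDiffAt_snd.prodMk contDiffAt_fst.snd)

theorem deriv_space (H : JointlySmooth U h) (hU : IsOpen U) :
    JointlySmooth U (fun t x => deriv (h t) x) := by
  rw [jointlySmooth_iff hU]
  intro t ht x
  have h1 : ContDiffAt ℝ ∞ (fun p : E × ℝ => fderiv ℝ (fun y => h p.1 y) p.2) (t, x) := by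
    refine ContDiffAt.fderiv (f := fun (p : E × ℝ) (y : ℝ) => h p.1 y) (g := fun p => p.2)
      (n := ∞) (m := ∞) ?_ contDiffAt_snd (by simp)
    exact ContDiffAt.comp (g := fun p : E × ℝ => h p.1 p.2)
      (f := fun q : (E × ℝ) × ℝ => (q.1.1, q.2)) _ (H.contDiffAt hU ht x)
      (contDiffAt_fst.fst.prodMk contDiffAt_snd)
  exact h1.clm_apply contDiffAt_const

theorem clm_comp {W : Type*} [NormedAddCommGroup W] [NormedSpace ℝ W] (H : JointlySmooth U h)
    (L : V →L[ℝ] W) : JointlySmooth U (fun t x => L (h t x)) :=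
  L.contDiff.comp_contDiffOn H

theorem iteratedDeriv_space (H : JointlySmooth U h) (hU : IsOpen U) (n : ℕ) :
    JointlySmooth U (fun t x => iteratedDeriv n (h t) x) := by
  induction n with
  | zero => simpa using H
  | succ n ih => simpa only [iteratedDeriv_succ] using ih.deriv_space hU

theorem iteratedFDeriv_param (H : JointlySmooth U h) (hU : IsOpen U) (k : ℕ) :
    JointlySmooth U (fun t x => iteratedFDeriv ℝ k (fun τ => h τ x) t) := by
  induction k with
  | zero =>
    simp only [iteratedFDeriv_zero_eq_comp]
    exact H.clm_comp
      (continuousMultilinearCurryFin0 ℝ E V).symm.toContinuousLinearEquiv.toContinuousLinearMap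
  | succ k ih =>
    simp only [iteratedFDeriv_succ_eq_comp_left]
    exact (ih.fderiv_param hU).clm_comp (continuousMultilinearCurryLeftEquiv ℝ
      (fun _ : Fin (k + 1) => E) V).symm.toContinuousLinearEquiv.toContinuousLinearMap

/-- The derivative in `x` commutes with the derivative in the parameter. -/
theorem hasDerivAt_fderiv_param (H : JointlySmooth U h) (hU : IsOpen U) {t : E} (ht : t ∈ U)
    (x : ℝ) : HasDerivAt (fun y => fderiv ℝ (fun τ => h τ y) t)
      (fderiv ℝ (fun τ => deriv (h τ) x) t) x := by
  set g : E × ℝ → V := fun p => h p.1 p.2 with hg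
  have hc : ∀ τ ∈ U, ∀ y, ContDiffAt ℝ ∞ g (τ, y) := fun τ hτ y => H.contDiffAt hU hτ y
  have hd : ∀ τ ∈ U, ∀ y, HasFDerivAt g (fderiv ℝ g (τ, y)) (τ, y) := fun τ hτ y =>
    ((hc τ hτ y).differentiableAt (by simp)).hasFDerivAt
  have h2 : HasFDerivAt (fderiv ℝ g) (fderiv ℝ (fderiv ℝ g) (t, x)) (t, x) :=
    (((hc t ht x).fderiv_right (m := ∞) (by simp)).differentiableAt (by simp)).hasFDerivAt
  -- Symmetry of the second derivative is the whole content; the remaining steps write both sides as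
  -- entries of the full second derivative of `g`.
  have hs : IsSymmSndFDerivAt ℝ g (t, x) := (hc t ht x).isSymmSndFDerivAt (by
    simpa using (WithTop.coe_le_coe.2 le_top : ((2 : ℕ∞) : WithTop ℕ∞) ≤ ((⊤ : ℕ∞) : WithTop ℕ∞)))
  have e1 : ∀ τ ∈ U, ∀ y, fderiv ℝ (fun σ => h σ y) τ
      = (fderiv ℝ g (τ, y)).comp (ContinuousLinearMap.inl ℝ E ℝ) := fun τ hτ y =>
    (HasFDerivAt.comp (g := g) (f := fun σ => (σ, y)) τ (hd τ hτ y)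
      (hasFDerivAt_prodMk_left τ y)).fderiv
  have e2 : ∀ τ ∈ U, ∀ y, deriv (h τ) y = fderiv ℝ g (τ, y) (0, 1) := fun τ hτ y => by
    have := ((hd τ hτ y).comp y (hasFDerivAt_prodMk_right τ y)).hasDerivAt.deriv
    simpa using! this
  have hx : HasDerivAt (fun y : ℝ => fderiv ℝ g (t, y))
      (fderiv ℝ (fderiv ℝ g) (t, x) (0, 1)) x := by
    simpa using! (h2.comp x (hasFDerivAt_prodMk_right t x)).hasDerivAt
  have hL := (hx.clm_comp (hasDerivAt_const x (ContinuousLinearMap.inl ℝ E ℝ)))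
  have ht' : HasFDerivAt (fun τ => fderiv ℝ g (τ, x) ((0 : E), (1 : ℝ)))
      (((fderiv ℝ (fderiv ℝ g) (t, x)).comp (ContinuousLinearMap.inl ℝ E ℝ)).flip (0, 1)) t := by
    have := (HasFDerivAt.comp (g := fderiv ℝ g) (f := fun σ => (σ, x)) t h2
      (hasFDerivAt_prodMk_left t x)).clm_apply
      (hasFDerivAt_const ((0 : E), (1 : ℝ)) t)
    refine this.congr_fderiv ?_
    ext v
    simp
  have hev : (fun τ => deriv (h τ) x) =ᶠ[𝓝 t] fun τ => fderiv ℝ g (τ, x) ((0 : E), (1 : ℝ)) :=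
    (hU.eventually_mem ht).mono fun τ hτ => e2 τ hτ x
  rw [hev.fderiv_eq, ht'.fderiv]
  have hfun : (fun y => fderiv ℝ (fun τ => h τ y) t)
      = fun y => (fderiv ℝ g (t, y)).comp (ContinuousLinearMap.inl ℝ E ℝ) :=
    funext fun y => e1 t ht y
  rw [hfun]
  convert hL using 1
  ext v
  simpa using hs.eq (v, 0) (0, 1)

/-- Up to currying, each iterated derivative is the first parameter derivative of the previous one.
The induction hypothesis is used at all nearby parameters, which is why `t` is generalized. -/
theorem hasDerivAt_iteratedFDeriv_param (H : JointlySmooth U h) (hU : IsOpen U) (k : ℕ) {t : E}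
    (ht : t ∈ U) (x : ℝ) : HasDerivAt (fun y => iteratedFDeriv ℝ k (fun τ => h τ y) t)
      (iteratedFDeriv ℝ k (fun τ => deriv (h τ) x) t) x := by
  induction k generalizing t with
  | zero =>
    simp only [iteratedFDeriv_zero_eq_comp]
    exact (continuousMultilinearCurryFin0 ℝ E
      V).symm.toContinuousLinearEquiv.toContinuousLinearMap.hasFDerivAt.comp_hasDerivAt x
        (H.differentiable_space hU ht x).hasDerivAt
  | succ k ih =>
    simp only [iteratedFDeriv_succ_eq_comp_left]
    have h1 := (H.iteratedFDeriv_param hU k).hasDerivAt_fderiv_param hU ht x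
    have hev : (fun τ => deriv (fun y => iteratedFDeriv ℝ k (fun σ => h σ y) τ) x)
        =ᶠ[𝓝 t] iteratedFDeriv ℝ k (fun τ => deriv (h τ) x) :=
      (hU.eventually_mem ht).mono fun τ hτ => (ih hτ).deriv
    rw [hev.fderiv_eq] at h1
    exact (continuousMultilinearCurryLeftEquiv ℝ (fun _ : Fin (k + 1) => E)
      V).symm.toContinuousLinearEquiv.toContinuousLinearMap.hasFDerivAt.comp_hasDerivAt x h1

end JointlySmooth

end JointlySmooth

/-! ### The coadjoint action -/

section Coadjoint

variable {A : DecayClass} {f g : ℝ → ℝ}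

theorem hasDerivAt_of (hf : ContDiff ℝ ∞ f) (x : ℝ) : HasDerivAt f (deriv f x) x :=
  (differentiable_of hf x).hasDerivAt

theorem eq_zero_of_integral_sq_eq_zero (hf : Continuous f) (hi : Integrable fun x => f x * f x)
    (h : ∫ x, f x * f x = 0) : f = 0 := by
  have h1 := (integral_eq_zero_iff_of_nonneg (fun x => mul_self_nonneg (f x)) hi).1 h
  have h2 := (Continuous.ae_eq_iff_eq volume (hf.mul hf) continuous_const).1 h1
  funext x
  exact mul_self_eq_zero.1 (congrFun h2 x)

/-- The line has infinite measure, so its only integrable constant is zero. -/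
theorem eq_zero_of_deriv_eq_zero_of_integrable (hf : ContDiff ℝ ∞ f) (hi : Integrable f)
    (h : deriv f = 0) : f = 0 := by
  have hc := is_const_of_deriv_eq_zero (differentiable_of hf) (congrFun h)
  have h1 : f = fun _ => f 0 := funext fun x => hc x 0
  rw [h1] at hi
  rcases integrable_const_iff.1 hi with h0 | h0
  · rw [h1, h0]; rfl
  · exact absurd h0.1 (by simp)

/-- Integration by parts against a function in `𝒜(ℝ)`. -/
theorem DecayClass.Mem.integral_deriv_mul (hf : A.Mem f) (hg : BddSmooth g) :
    ∫ x, _root_.deriv f x * g x = -∫ x, f x * _root_.deriv g x := by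
  have i1 : Integrable fun x => _root_.deriv f x * g x := (hf.deriv.mul hg).integrable
  have i2 : Integrable fun x => f x * _root_.deriv g x := (hf.mul hg.deriv).integrable
  have h1 := integral_eq_zero_of_hasDerivAt_of_integrable (f := f * g)
    (f' := fun x => _root_.deriv f x * g x + f x * _root_.deriv g x)
    (fun x => (hasDerivAt_of hf.contDiff x).mul (hasDerivAt_of hg.1 x))
    (i1.add i2) (hf.mul hg).integrable
  rw [integral_add i1 i2] at h1
  linarith

/-- The derivative of `X X' - ½ ∫_{-∞}^x (X')²`. -/
noncomputable def coadjDensity (X : ℝ → ℝ) (x : ℝ) : ℝ :=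
  1 / 2 * (deriv X x * deriv X x) + deriv (deriv X) x * X x

theorem coadjDensity_eq (X : ℝ → ℝ) : coadjDensity X =
    (1 / 2 : ℝ) • (deriv X * deriv X) + deriv (deriv X) * X := by
  funext x; simp [coadjDensity]

theorem mem_coadjDensity {X : ℝ → ℝ} (hX : A.Mem (deriv X)) (hb : BddSmooth X) :
    A.Mem (coadjDensity X) := by
  rw [coadjDensity_eq]
  exact ((hX.mul hX.bddSmooth).smul _).add (hX.deriv.mul hb)

/-- The integrand is `X' X'' Z - X X' Z''`. Integrating by parts with `X' X'' = ½ (X'²)'` in the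
first term and `(X X')' = X'² + X X''` in the second leaves only `Z'`. Asking just the derivatives
to lie in `𝒜` lets the identity serve both Lie algebras. -/
theorem hdot_ad {X Z : ℝ → ℝ} (hX : A.Mem (deriv X)) (hXb : BddSmooth X)
    (hZ : A.Mem (deriv Z)) (hZb : BddSmooth Z) :
    hdot X (deriv X * Z - X * deriv Z) = ∫ x, coadjDensity X x * deriv Z x := by
  have i1 : Integrable fun x => (deriv X * deriv X) x * deriv Z x :=
    ((hX.mul hX.bddSmooth).mul hZ.bddSmooth).integrable
  have i2 : Integrable fun x => (deriv (deriv X) * X) x * deriv Z x :=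
    ((hX.deriv.mul hXb).mul hZ.bddSmooth).integrable
  have i3 : Integrable fun x => (deriv (deriv X) * deriv X) x * Z x :=
    ((hX.deriv.mul hX.bddSmooth).mul hZb).integrable
  have i4 : Integrable fun x => (deriv X * X) x * deriv (deriv Z) x :=
    ((hX.mul hXb).mul hZ.bddSmooth.deriv).integrable
  have d1 : deriv (deriv X * deriv X) = fun x => 2 * (deriv (deriv X) * deriv X) x := by
    funext x
    have := (hasDerivAt_of hX.contDiff x).mul (hasDerivAt_of hX.contDiff x)
    rw [this.deriv]
    simp only [Pi.mul_apply]
    ring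
  have d2 : deriv (deriv X * X) = fun x => (deriv (deriv X) * X) x + (deriv X * deriv X) x := by
    funext x
    have := (hasDerivAt_of hX.contDiff x).mul (hasDerivAt_of hXb.1 x)
    rw [this.deriv]
    simp only [Pi.mul_apply]
  have p1 := (hX.mul hX.bddSmooth).integral_deriv_mul hZb
  have p2 := (hX.mul hXb).integral_deriv_mul hZ.bddSmooth
  rw [d1] at p1
  rw [d2] at p2
  simp only [mul_assoc, integral_const_mul] at p1
  simp only [add_mul] at p2
  rw [integral_add i2 i1] at p2
  unfold hdot
  rw [deriv_ad hXb.1 hZb.1]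
  have e1 : (fun x => deriv X x * (deriv (deriv X) * Z - deriv (deriv Z) * X) x)
      = fun x => (deriv (deriv X) * deriv X) x * Z x - (deriv X * X) x * deriv (deriv Z) x := by
    funext x; simp only [Pi.mul_apply, Pi.sub_apply]; ring
  have e2 : (fun x => coadjDensity X x * deriv Z x)
      = fun x => 1 / 2 * ((deriv X * deriv X) x * deriv Z x)
        + (deriv (deriv X) * X) x * deriv Z x := by
    funext x; simp only [Pi.mul_apply, coadjDensity]; ring
  rw [e1, e2, integral_sub i3 i4, integral_add (i1.const_mul _) i2, integral_const_mul]
  linarith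

theorem hasDerivAt_integral_Iic (hf : Continuous f) (hi : Integrable f) (x : ℝ) :
    HasDerivAt (fun y => ∫ z in Iic y, f z) (f x) x := by
  have h1 : (fun y => ∫ z in Iic y, f z)
      = fun y => (∫ z in Iic 0, f z) + ∫ z in (0 : ℝ)..y, f z := by
    funext y
    rw [← intervalIntegral.integral_Iic_sub_Iic hi.integrableOn hi.integrableOn]
    ring
  rw [h1]
  exact (hf.integral_hasStrictDerivAt 0 x).hasDerivAt.const_add _

/-- Functions in `𝒜₁(ℝ)` are the primitives of functions in `𝒜(ℝ)`. -/
theorem DecayClass.Mem.mem₁_integral_Iic (hf : A.Mem f) :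
    A.Mem₁ (fun x => ∫ z in Iic x, f z) := by
  have hd := hasDerivAt_integral_Iic hf.contDiff.continuous hf.integrable
  have hd' : _root_.deriv (fun x => ∫ z in Iic x, f z) = f := funext fun x => (hd x).deriv
  refine ⟨contDiff_infty_iff_deriv.2 ⟨fun x => (hd x).differentiableAt, ?_⟩, ?_, ?_⟩
  · rw [hd']; exact hf.contDiff
  · rw [hd']; exact hf
  · exact tendsto_integral_Iic_zero tendsto_id

theorem DecayClass.Mem₁.eq_integral_Iic (hf : A.Mem₁ f) (x : ℝ) :
    f x = ∫ z in Iic x, deriv f z := by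
  rw [integral_Iic_of_hasDerivAt_of_tendsto hf.1.continuous.continuousWithinAt
    (fun y _ => hasDerivAt_of hf.1 y) hf.2.1.integrable.integrableOn hf.2.2, sub_zero]

/-- The candidate preimage is admissible: `X'²` lies in `𝒜`, so its primitive lies in `𝒜₁`, and `X
X'` tends to zero at `-∞` because `X` does and `X'` is bounded. -/
theorem DecayClass.Mem₁.mem_coadj {X : ℝ → ℝ} (hX : A.Mem₁ X) :
    A.Mem₁ (fun x => X x * deriv X x - 1 / 2 * ∫ z in Iic x, (deriv X z) ^ 2) ∧
    deriv (fun x => X x * deriv X x - 1 / 2 * ∫ z in Iic x, (deriv X z) ^ 2)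
      = coadjDensity X := by
  have hsq : A.Mem (fun z => (deriv X z) ^ 2) := by
    have h := hX.2.1.mul hX.2.1.bddSmooth
    have e : (deriv X * deriv X) = fun z => (deriv X z) ^ 2 := by
      funext z; simp only [Pi.mul_apply]; ring
    rwa [e] at h
  have hI := hsq.mem₁_integral_Iic
  have hd : ∀ x, HasDerivAt (fun x => X x * deriv X x - 1 / 2 * ∫ z in Iic x, (deriv X z) ^ 2)
      (coadjDensity X x) x := fun x => by
    have h := ((hasDerivAt_of hX.1 x).mul (hasDerivAt_of hX.2.1.contDiff x)).sub
      ((hasDerivAt_integral_Iic hsq.contDiff.continuous hsq.integrable x).const_mul (1 / 2))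
    refine h.congr_deriv ?_
    simp only [coadjDensity]
    ring
  have hd' := funext fun x => (hd x).deriv
  refine ⟨⟨(hX.1.mul hX.2.1.contDiff).sub (contDiff_const.mul hI.1), ?_, ?_⟩, hd'⟩
  · rw [hd']; exact mem_coadjDensity hX.2.1 hX.bddSmooth
  · have h1 := hX.bddSmooth.deriv.tendsto_mul hX.2.2
    have h2 := h1.sub (hI.2.2.const_mul (1 / 2))
    simp only [mul_zero, sub_zero] at h2
    exact h2.congr fun x => by ring

theorem adStar_flat_apply (𝔤 : VFAlgebra) (X Z : 𝔤.carrier) :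
    𝔤.adStar X (𝔤.flat X) Z
      = hdot X (deriv (X : ℝ → ℝ) * (Z : ℝ → ℝ) - (X : ℝ → ℝ) * deriv (Z : ℝ → ℝ)) := rfl

theorem flat_apply (𝔤 : VFAlgebra) (X Z : 𝔤.carrier) : 𝔤.flat X Z = hdot X Z := rfl

theorem flat_eq_adStar_of_formula (X Y : A.alg₁.carrier)
    (h : ∀ x, (Y : ℝ → ℝ) x = (X : ℝ → ℝ) x * deriv (X : ℝ → ℝ) x
        - 1 / 2 * ∫ z in Iic x, (deriv (X : ℝ → ℝ) z) ^ 2) :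
    A.alg₁.flat Y = A.alg₁.adStar X (A.alg₁.flat X) := by
  have hX : A.Mem₁ X := X.2
  refine LinearMap.ext fun Z => ?_
  have hZ : A.Mem₁ Z := Z.2
  rw [adStar_flat_apply, flat_apply, hdot_ad hX.2.1 hX.bddSmooth hZ.2.1 hZ.bddSmooth, hdot,
    funext h, hX.mem_coadj.2]

/-- Testing `Ǧ(Z) = 0` on `Z` itself gives `Z' = 0`; the normalization at `-∞` then removes the
constant. -/
theorem flat_injective₁ : Function.Injective A.alg₁.flat := by
  intro Y₁ Y₂ h
  rw [← sub_eq_zero, ← map_sub] at h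
  rw [← sub_eq_zero]
  set Z := Y₁ - Y₂
  have hZ : A.Mem₁ Z := Z.2
  have h0 : ∫ x, deriv (Z : ℝ → ℝ) x * deriv (Z : ℝ → ℝ) x = 0 := by
    have := LinearMap.congr_fun h Z
    rwa [flat_apply, hdot] at this
  have h1 := eq_zero_of_integral_sq_eq_zero hZ.2.1.contDiff.continuous
    (A.alg₁.integrable _ Z.2 _ Z.2) h0
  apply Subtype.ext
  funext x
  rw [hZ.eq_integral_Iic x, h1]
  simp

theorem flat_eq_adStar_iff (X Y : A.alg₁.carrier) :
    A.alg₁.flat Y = A.alg₁.adStar X (A.alg₁.flat X) ↔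
      ∀ x, (Y : ℝ → ℝ) x = (X : ℝ → ℝ) x * deriv (X : ℝ → ℝ) x
        - 1 / 2 * ∫ z in Iic x, (deriv (X : ℝ → ℝ) z) ^ 2 := by
  refine ⟨fun h x => ?_, flat_eq_adStar_of_formula X Y⟩
  have hX : A.Mem₁ X := X.2
  have := flat_injective₁ (h.trans (flat_eq_adStar_of_formula X ⟨_, hX.mem_coadj.1⟩
    fun _ => rfl).symm)
  rw [this]

theorem geodesicEquationExists₁ (A : DecayClass) : A.alg₁.GeodesicEquationExists := fun X => by
  have hX : A.Mem₁ X := X.2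
  exact ⟨⟨_, hX.mem_coadj.1⟩, flat_eq_adStar_of_formula X ⟨_, hX.mem_coadj.1⟩ fun _ => rfl⟩

/-- For a preimage `Y`, the function `W = Y' - ρ` is orthogonal to every `Z'` with `Z ∈ 𝒜`, but `W`
itself need not be such a `Z'`. Choosing `Z = W'` gives `0 = ∫ W W'' = -∫ W'²`, so `W` is an
integrable constant and vanishes. Then `ρ = Y'` has integral zero, while integration by parts gives
`∫ ρ = -½ ∫ X'²`, which forces `X = 0`. -/
theorem adStar_flat_notMem_range (X : A.alg.carrier) (hX0 : X ≠ 0) :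
    A.alg.adStar X (A.alg.flat X) ∉ LinearMap.range A.alg.flat := by
  rintro ⟨Y, hY⟩
  have hX : A.Mem X := X.2
  have hYm : A.Mem Y := Y.2
  have hc := mem_coadjDensity hX.deriv hX.bddSmooth
  set W : ℝ → ℝ := deriv (Y : ℝ → ℝ) - coadjDensity X with hW
  have hWm : A.Mem W := hYm.deriv.sub hc
  have horth : ∫ x, W x * deriv (deriv W) x = 0 := by
    have h := LinearMap.congr_fun hY ⟨deriv W, hWm.deriv⟩
    rw [adStar_flat_apply, flat_apply, hdot_ad hX.deriv hX.bddSmooth hWm.deriv.deriv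
      hWm.deriv.bddSmooth, hdot] at h
    have i1 : Integrable fun x => deriv (Y : ℝ → ℝ) x * deriv (deriv W) x :=
      (hYm.deriv.mul hWm.bddSmooth.deriv.deriv).integrable
    have i2 : Integrable fun x => coadjDensity X x * deriv (deriv W) x :=
      (hc.mul hWm.bddSmooth.deriv.deriv).integrable
    have := integral_sub i1 i2
    rw [h, sub_self] at this
    rw [← this]
    congr 1
    funext x
    simp only [hW, Pi.sub_apply]
    ring
  have hW' : deriv W = 0 := by
    refine eq_zero_of_integral_sq_eq_zero hWm.deriv.contDiff.continuous
      (hWm.deriv.mul hWm.deriv.bddSmooth).integrable ?_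
    rw [hWm.integral_deriv_mul hWm.deriv.bddSmooth, horth, neg_zero]
  have hW0 := eq_zero_of_deriv_eq_zero_of_integrable hWm.contDiff hWm.integrable hW'
  have hYc : deriv (Y : ℝ → ℝ) = coadjDensity X := by rw [hW, sub_eq_zero] at hW0; exact hW0
  have hI : ∫ x, coadjDensity X x = 0 := by
    rw [← hYc]
    exact integral_eq_zero_of_hasDerivAt_of_integrable (hasDerivAt_of hYm.contDiff)
      hYm.deriv.integrable hYm.integrable
  have i1 : Integrable fun x => deriv (X : ℝ → ℝ) x * deriv (X : ℝ → ℝ) x :=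
    (hX.deriv.mul hX.deriv.bddSmooth).integrable
  have i2 : Integrable fun x => deriv (deriv (X : ℝ → ℝ)) x * (X : ℝ → ℝ) x :=
    (hX.deriv.deriv.mul hX.bddSmooth).integrable
  simp only [coadjDensity] at hI
  rw [integral_add (i1.const_mul _) i2, integral_const_mul,
    hX.deriv.integral_deriv_mul hX.bddSmooth] at hI
  have hX' := eq_zero_of_integral_sq_eq_zero hX.deriv.contDiff.continuous i1 (by linarith)
  exact hX0 (Subtype.ext
    (eq_zero_of_deriv_eq_zero_of_integrable hX.contDiff hX.integrable hX'))

theorem DecayClass.mem_of_hasCompactSupport (A : DecayClass) (hf : ContDiff ℝ ∞ f)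
    (hs : HasCompactSupport f) : A.Mem f := by
  cases A with
  | compactSupport => exact ⟨hf, hs⟩
  | schwartz => exact ⟨hs.toSchwartzMap hf, rfl⟩
  | sobolev =>
    have h : DecayClass.compactSupport.Mem f := ⟨hf, hs⟩
    exact ⟨hf, fun n => (h.iter n).integrable⟩

theorem not_geodesicEquationExists (A : DecayClass) : ¬ A.alg.GeodesicEquationExists := by
  intro h
  obtain ⟨f, -, hs, hf, -, h1⟩ :=
    exists_contDiff_tsupport_subset (n := ⊤) (univ_mem : (univ : Set ℝ) ∈ 𝓝 (0 : ℝ))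
  refine adStar_flat_notMem_range (A := A) ⟨f, A.mem_of_hasCompactSupport hf hs⟩ ?_ (h _)
  intro h0
  have := congrFun (congrArg Subtype.val h0) 0
  simp [h1] at this

end Coadjoint

/-! ### Locally uniform bounds for smooth families -/

section Bounds

variable {E : Type*} [NormedAddCommGroup E] [NormedSpace ℝ E] {A : DecayClass} {U K : Set E}
  {f F φ : E → ℝ → ℝ}

theorem JointlySmooth.mixedDeriv (hF : JointlySmooth U F) (hU : IsOpen U) (k n : ℕ) :
    JointlySmooth U (mixedDeriv F k n) :=
  (hF.iteratedDeriv_space hU n).iteratedFDeriv_param hU k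

theorem iteratedDeriv_eq_zero_of_support {R : ℝ} {g : ℝ → ℝ} (hg : ∀ x, R < |x| → g x = 0)
    (n : ℕ) {x : ℝ} (hx : R < |x|) : iteratedDeriv n g x = 0 := by
  have hx' : x ∈ {y : ℝ | R < |y|} := hx
  have h1 : g =ᶠ[𝓝 x] fun _ => 0 := by
    filter_upwards [(isOpen_lt continuous_const continuous_abs).mem_nhds hx'] with y hy
    exact hg y hy
  rw [h1.iteratedDeriv_eq n]
  simp

theorem mixedDeriv_eq_zero_of_support {R : ℝ} {t : E}
    (h : ∀ᶠ τ in 𝓝 t, ∀ x, R < |x| → F τ x = 0) (k n : ℕ) {x : ℝ} (hx : R < |x|) :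
    mixedDeriv F k n t x = 0 := by
  have h1 : (fun τ => iteratedDeriv n (F τ) x) =ᶠ[𝓝 t] fun _ => 0 :=
    h.mono fun τ hτ => iteratedDeriv_eq_zero_of_support hτ n hx
  have h2 := (h1.iteratedFDeriv ℝ k).self_of_nhds
  rw [mixedDeriv, h2]
  simp

/-- All three kinds of decay give locally uniform `L¹`-bounds for the mixed derivatives. -/
theorem DecayClass.LocallyUniformDecay.exists_lintegral_le [ProperSpace E]
    (hd : A.LocallyUniformDecay U F) (hF : JointlySmooth U F) (hU : IsOpen U) (hKU : K ⊆ U)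
    (hK : IsCompact K) (k n : ℕ) :
    ∃ C : ℝ≥0, ∀ t ∈ K, ∫⁻ x, ‖mixedDeriv F k n t x‖ₑ ≤ C := by
  cases A with
  | compactSupport =>
    -- Parameter derivatives at a point of `K` see nearby parameters, so the support has to be
    -- controlled on a compact neighbourhood `L` of `K`.
    obtain ⟨L, hL, hKL, hLU⟩ := exists_compact_between hK hU hKU
    obtain ⟨R, hR⟩ := hd L hLU hL
    have hcont := (hF.mixedDeriv hU k n).continuousOn.mono
      (prod_mono hKU (subset_univ (Icc (-R) R)))
    obtain ⟨C, hC⟩ := (hK.prod isCompact_Icc).exists_bound_of_continuousOn hcont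
    refine ⟨(C * (2 * R)).toNNReal, fun t ht => ?_⟩
    have hle : ∀ x, ‖mixedDeriv F k n t x‖ₑ
        ≤ (Icc (-R) R).indicator (fun _ => ENNReal.ofReal C) x := by
      intro x
      by_cases hx : x ∈ Icc (-R) R
      · rw [indicator_of_mem hx, ← ofReal_norm]
        exact ENNReal.ofReal_le_ofReal (hC (t, x) ⟨ht, hx⟩)
      · have hxR : R < |x| := by
          by_contra! h
          exact hx (abs_le.1 h)
        have hev : ∀ᶠ τ in 𝓝 t, ∀ x, R < |x| → F τ x = 0 := by
          filter_upwards [isOpen_interior.mem_nhds (hKL ht)] with τ hτ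
          exact hR τ (interior_subset hτ)
        rw [mixedDeriv_eq_zero_of_support hev k n hxR, ← ofReal_norm, norm_zero]
        simp
    refine (lintegral_mono hle).trans ?_
    rw [lintegral_indicator measurableSet_Icc, setLIntegral_const, Real.volume_Icc,
      show R - -R = 2 * R by ring]
    rcases le_or_gt 0 C with h0 | h0
    · rw [← ENNReal.ofReal_mul h0, ENNReal.ofReal]
    · simp [ENNReal.ofReal_of_nonpos h0.le]
  | schwartz =>
    -- The weight exponent `1` is enough because `(1 + x²)⁻¹` is integrable.
    obtain ⟨C, hC⟩ := hd K hKU hK k 1 n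
    have hi : Integrable fun x : ℝ => C * (1 + x ^ 2)⁻¹ := integrable_inv_one_add_sq.const_mul C
    refine ⟨(∫⁻ x, ‖C * (1 + x ^ 2)⁻¹‖ₑ).toNNReal, fun t ht => ?_⟩
    rw [ENNReal.coe_toNNReal hi.2.ne]
    refine lintegral_mono fun x => ?_
    rw [enorm_le_iff_norm_le]
    have h := hC t ht x
    have hp : (0 : ℝ) < 1 + x ^ 2 := by positivity
    rw [pow_one] at h
    refine le_trans ?_ (le_abs_self _)
    change _ ≤ C * (1 + x ^ 2)⁻¹
    rw [← div_eq_mul_inv, le_div_iff₀ hp, mul_comm]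
    exact h
  | sobolev => exact hd K hKU hK k n

/-- A function on `ℝ` is bounded by the `L¹`-norms of itself and of its derivative. -/
theorem norm_le_of_lintegral_le {V : Type*} [NormedAddCommGroup V] [NormedSpace ℝ V]
    [CompleteSpace V] {g g' : ℝ → V} (hg : ∀ x, HasDerivAt g (g' x) x) (hg' : Continuous g')
    {C₀ C₁ : ℝ≥0} (h₀ : ∫⁻ x, ‖g x‖ₑ ≤ C₀) (h₁ : ∫⁻ x, ‖g' x‖ₑ ≤ C₁) (x : ℝ) :
    ‖g x‖ ≤ C₀ + C₁ := by
  have hgc : Continuous g := continuous_iff_continuousAt.2 fun x => (hg x).continuousAt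
  have h2 : ∀ y, ‖g x‖ₑ ≤ ‖g y‖ₑ + C₁ := by
    intro y
    have h3 : g x - g y = ∫ z in y..x, g' z :=
      (intervalIntegral.integral_eq_sub_of_hasDerivAt (fun z _ => hg z)
        (hg'.intervalIntegrable _ _)).symm
    have h4 : ‖g x - g y‖ₑ ≤ C₁ := by
      rw [h3, ← ofReal_norm, intervalIntegral.norm_integral_eq_norm_integral_uIoc, ofReal_norm]
      exact (enorm_integral_le_lintegral_enorm _).trans ((setLIntegral_le_lintegral _ _).trans h₁)
    calc ‖g x‖ₑ = ‖g y + (g x - g y)‖ₑ := by rw [add_sub_cancel]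
      _ ≤ ‖g y‖ₑ + ‖g x - g y‖ₑ := enorm_add_le _ _
      _ ≤ _ := by gcongr
  -- Averaging the previous bound over `y` in a unit interval replaces the value at `y` by an
  -- `L¹`-norm.
  have h5 : ‖g x‖ₑ ≤ C₀ + C₁ := by
    calc ‖g x‖ₑ = ∫⁻ _ in Icc (0 : ℝ) 1, ‖g x‖ₑ := by simp
      _ ≤ ∫⁻ y in Icc (0 : ℝ) 1, (‖g y‖ₑ + C₁) := lintegral_mono fun y => h2 y
      _ = (∫⁻ y in Icc (0 : ℝ) 1, ‖g y‖ₑ) + C₁ := by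
        rw [lintegral_add_left hgc.enorm.measurable]; simp
      _ ≤ _ := by gcongr; exact (setLIntegral_le_lintegral _ _).trans h₀
  rw [← ENNReal.coe_add, enorm_eq_nnnorm, ENNReal.coe_le_coe] at h5
  exact_mod_cast h5

/-- The `L¹`-bounds with zero and with one `x`-derivative combine into a sup-bound. From here on the
decay classes need no separate treatment in energy estimates. -/
theorem DecayClass.LocallyUniformDecay.exists_bound [ProperSpace E]
    (hd : A.LocallyUniformDecay U F) (hF : JointlySmooth U F) (hU : IsOpen U) (hKU : K ⊆ U)
    (hK : IsCompact K) (k : ℕ) :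
    ∃ C : ℝ, 0 ≤ C ∧ ∀ t ∈ K, (∀ x, ‖iteratedFDeriv ℝ k (fun τ => F τ x) t‖ ≤ C) ∧
      ∫⁻ x, ‖iteratedFDeriv ℝ k (fun τ => F τ x) t‖ₑ ≤ ENNReal.ofReal C := by
  obtain ⟨C₀, h₀⟩ := hd.exists_lintegral_le hF hU hKU hK k 0
  obtain ⟨C₁, h₁⟩ := hd.exists_lintegral_le hF hU hKU hK k 1
  simp only [HunterSaxton.mixedDeriv, iteratedDeriv_zero, iteratedDeriv_one] at h₀ h₁
  refine ⟨C₀ + C₁, by positivity, fun t ht => ⟨fun x => ?_, ?_⟩⟩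
  · exact norm_le_of_lintegral_le
      (fun y => hF.hasDerivAt_iteratedFDeriv_param hU k (hKU ht) y)
      (((hF.deriv_space hU).iteratedFDeriv_param hU k).contDiff_space hU (hKU ht)).continuous
      (h₀ t ht) (h₁ t ht) x
  · refine (h₀ t ht).trans ?_
    rw [← NNReal.coe_add, ENNReal.ofReal_coe_nnreal, ENNReal.coe_add]
    exact le_self_add

theorem DecayClass.IsSmoothFamily₁.jointlySmooth (hf : A.IsSmoothFamily₁ U f) :
    JointlySmooth U f := hf.1

/-- A singleton is an admissible compact set, and `k = 0` leaves only the `x`-derivatives. -/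
theorem DecayClass.LocallyUniformDecay.mem (hd : A.LocallyUniformDecay U F)
    (hF : JointlySmooth U F) (hU : IsOpen U) {t : E} (ht : t ∈ U) : A.Mem (F t) := by
  have hs := hF.contDiff_space hU ht
  have hm : ∀ n x, ‖HunterSaxton.mixedDeriv F 0 n t x‖ = ‖iteratedDeriv n (F t) x‖ := fun n x => by
    simp [HunterSaxton.mixedDeriv]
  have hK : {t} ⊆ U := singleton_subset_iff.2 ht
  cases A with
  | compactSupport =>
    obtain ⟨R, hR⟩ := hd {t} hK isCompact_singleton
    refine ⟨hs, HasCompactSupport.intro (isCompact_Icc (a := -R) (b := R)) fun x hx => ?_⟩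
    refine hR t rfl x ?_
    by_contra! h
    exact hx (abs_le.1 h)
  | schwartz =>
    refine ⟨⟨F t, hs, fun m n => ?_⟩, rfl⟩
    obtain ⟨C, hC⟩ := hd {t} hK isCompact_singleton 0 m n
    refine ⟨C, fun x => ?_⟩
    have h := hC t rfl x
    rw [hm] at h
    rw [norm_iteratedFDeriv_eq_norm_iteratedDeriv]
    refine le_trans (mul_le_mul_of_nonneg_right ?_ (norm_nonneg _)) h
    rw [Real.norm_eq_abs]
    refine pow_le_pow_left₀ (abs_nonneg x) ?_ m
    nlinarith [sq_nonneg (|x| - 1), sq_abs x, sq_nonneg x]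
  | sobolev =>
    refine ⟨hs, fun n => ⟨?_, ?_⟩⟩
    · exact ((contDiff_infty.1 hs n).continuous_iteratedDeriv n le_rfl).aestronglyMeasurable
    · obtain ⟨C, hC⟩ := hd {t} hK isCompact_singleton 0 n
      have h := hC t rfl
      have e : ∀ x, ‖HunterSaxton.mixedDeriv F 0 n t x‖ₑ = ‖iteratedDeriv n (F t) x‖ₑ := fun x => by
        rw [← ofReal_norm, hm, ofReal_norm]
      simp only [e] at h
      exact h.trans_lt ENNReal.coe_lt_top

theorem DecayClass.IsSmoothFamily₁.mem₁ (hf : A.IsSmoothFamily₁ U f) (hU : IsOpen U) {t : E}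
    (ht : t ∈ U) : A.Mem₁ (f t) :=
  ⟨hf.jointlySmooth.contDiff_space hU ht,
    hf.2.1.mem (hf.jointlySmooth.deriv_space hU) hU ht, hf.2.2 t ht⟩

theorem DecayClass.Mem.tendsto_atBot {g : ℝ → ℝ} (hg : A.Mem g) : Tendsto g atBot (𝓝 0) :=
  tendsto_zero_of_hasDerivAt_of_integrableOn_Iic (a := 0)
    (fun x _ => hasDerivAt_of hg.contDiff x) hg.deriv.integrable.integrableOn
    hg.integrable.integrableOn

theorem DecayClass.Mem.tendsto_atTop {g : ℝ → ℝ} (hg : A.Mem g) : Tendsto g atTop (𝓝 0) :=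
  tendsto_zero_of_hasDerivAt_of_integrableOn_Ioi (a := 0)
    (fun x _ => hasDerivAt_of hg.contDiff x) hg.deriv.integrable.integrableOn
    hg.integrable.integrableOn

/-- Since `g` tends to zero at both ends, `1 + g` exceeds `1/2` outside a compact interval, and
inside it attains a positive minimum. -/
theorem DecayClass.Mem.exists_lower_bound {g : ℝ → ℝ} (hg : A.Mem g) (h1 : ∀ x, -1 < g x) :
    ∃ m : ℝ, 0 < m ∧ ∀ x, m ≤ 1 + g x := by
  have hc : Continuous fun x => 1 + g x := continuous_const.add hg.contDiff.continuous
  have e1 : ∀ᶠ x in atBot, -(1 / 2) < g x := hg.tendsto_atBot.eventually_const_lt (by norm_num)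
  have e2 : ∀ᶠ x in atTop, -(1 / 2) < g x := hg.tendsto_atTop.eventually_const_lt (by norm_num)
  obtain ⟨a, ha⟩ := eventually_atBot.1 e1
  obtain ⟨b, hb⟩ := eventually_atTop.1 e2
  obtain ⟨x₀, -, hx₀⟩ := isCompact_Icc.exists_isMinOn
    (nonempty_Icc.2 ((min_le_left a b).trans (le_max_left a b))) hc.continuousOn
  refine ⟨min (1 / 2) (1 + g x₀), lt_min (by norm_num) (by linarith [h1 x₀]), fun x => ?_⟩
  by_cases hxa : x ≤ a
  · exact (min_le_left _ _).trans (by linarith [ha x hxa])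
  by_cases hxb : b ≤ x
  · exact (min_le_left _ _).trans (by linarith [hb x hxb])
  push Not at hxa hxb
  exact (min_le_right _ _).trans
    (hx₀ ⟨(min_le_left _ _).trans hxa.le, hxb.le.trans (le_max_right _ _)⟩)

theorem norm_iteratedFDeriv_two {V : Type*} [NormedAddCommGroup V] [NormedSpace ℝ V] (g : E → V)
    (t : E) : ‖iteratedFDeriv ℝ 2 g t‖ = ‖fderiv ℝ (fderiv ℝ g) t‖ := by
  rw [← norm_iteratedFDeriv_fderiv (n := 1), norm_iteratedFDeriv_one]

end Bounds

/-! ### Uniform bounds along families of diffeomorphisms -/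

section DiffFamily

variable {E : Type*} [NormedAddCommGroup E] [NormedSpace ℝ E] {A : DecayClass} {U K : Set E}
  {φ : E → ℝ → ℝ}

theorem JointlySmooth.deriv_sub_id (hφ : JointlySmooth U φ) (hU : IsOpen U) {t : E} (ht : t ∈ U)
    (x : ℝ) : deriv (fun y => φ t y - y) x = deriv (φ t) x - 1 :=
  ((hφ.differentiable_space hU ht x).hasDerivAt.sub (hasDerivAt_id x)).deriv

namespace DecayClass.IsSmoothDiffFamily₁

theorem jointlySmooth (hφ : A.IsSmoothDiffFamily₁ U φ) : JointlySmooth U φ := by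
  have h := ContDiffOn.add hφ.1.1 (contDiff_snd.contDiffOn (s := U ×ˢ (univ : Set ℝ)))
  exact h.congr fun p _ => by simp

theorem deriv_pos (hφ : A.IsSmoothDiffFamily₁ U φ) (hU : IsOpen U) {t : E} (ht : t ∈ U)
    (x : ℝ) : 0 < deriv (φ t) x := by
  have h := (hφ.2 t ht).2 x
  rw [hφ.jointlySmooth.deriv_sub_id hU ht] at h
  linarith

/-- The derivatives of `φ_x` in the parameter are bounded in `L^∞ ∩ L¹`, locally uniformly. -/
theorem exists_bound [ProperSpace E] (hφ : A.IsSmoothDiffFamily₁ U φ) (hU : IsOpen U)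
    (hKU : K ⊆ U) (hK : IsCompact K) (k : ℕ) (hk : k ≠ 0) :
    ∃ C : ℝ, 0 ≤ C ∧ ∀ t ∈ K,
      (∀ x, ‖iteratedFDeriv ℝ k (fun τ => deriv (φ τ) x) t‖ ≤ C) ∧
      ∫⁻ x, ‖iteratedFDeriv ℝ k (fun τ => deriv (φ τ) x) t‖ₑ ≤ ENNReal.ofReal C := by
  obtain ⟨C, hC0, hC⟩ := hφ.1.2.1.exists_bound
    (JointlySmooth.deriv_space (h := fun t x => φ t x - x) hφ.1.1 hU) hU hKU hK k
  have e : ∀ t ∈ U, ∀ x, iteratedFDeriv ℝ k (fun τ => deriv (fun y => φ τ y - y) x) t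
      = iteratedFDeriv ℝ k (fun τ => deriv (φ τ) x) t := by
    intro t ht x
    -- `φ_x` and `(φ - id)_x` differ by the constant `1`, which a parameter derivative of positive
    -- order does not see; this is the role of `k ≠ 0`.
    have h1 : (fun τ => deriv (fun y => φ τ y - y) x) =ᶠ[𝓝 t]
        (fun τ => deriv (φ τ) x) + fun _ => (-1 : ℝ) := by
      filter_upwards [hU.mem_nhds ht] with τ hτ
      rw [hφ.jointlySmooth.deriv_sub_id hU hτ]
      simp [sub_eq_add_neg]
    rw [(h1.iteratedFDeriv ℝ k).self_of_nhds, iteratedFDeriv_add_apply]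
    · simp [iteratedFDeriv_const_of_ne hk]
    · exact (((hφ.jointlySmooth.deriv_space hU).contDiffAt_param hU ht x).of_le
        (by exact_mod_cast le_top))
    · exact contDiffAt_const
  refine ⟨C, hC0, fun t ht => ?_⟩
  simpa only [e t (hKU ht)] using hC t ht

theorem exists_bound_fderiv [ProperSpace E] (hφ : A.IsSmoothDiffFamily₁ U φ) (hU : IsOpen U)
    (hKU : K ⊆ U) (hK : IsCompact K) :
    ∃ C : ℝ, 0 ≤ C ∧ ∀ t ∈ K,
      (∀ x, ‖fderiv ℝ (fun τ => deriv (φ τ) x) t‖ ≤ C) ∧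
      ∫⁻ x, ‖fderiv ℝ (fun τ => deriv (φ τ) x) t‖ₑ ≤ ENNReal.ofReal C := by
  obtain ⟨C, hC0, hC⟩ := hφ.exists_bound hU hKU hK 1 one_ne_zero
  refine ⟨C, hC0, fun t ht => ?_⟩
  simpa only [← ofReal_norm, norm_iteratedFDeriv_one] using hC t ht

theorem exists_bound_fderiv_fderiv [ProperSpace E] (hφ : A.IsSmoothDiffFamily₁ U φ)
    (hU : IsOpen U) (hKU : K ⊆ U) (hK : IsCompact K) :
    ∃ C : ℝ, 0 ≤ C ∧ ∀ t ∈ K,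
      (∀ x, ‖fderiv ℝ (fderiv ℝ (fun τ => deriv (φ τ) x)) t‖ ≤ C) ∧
      ∫⁻ x, ‖fderiv ℝ (fderiv ℝ (fun τ => deriv (φ τ) x)) t‖ₑ ≤ ENNReal.ofReal C := by
  obtain ⟨C, hC0, hC⟩ := hφ.exists_bound hU hKU hK 2 two_ne_zero
  refine ⟨C, hC0, fun t ht => ?_⟩
  simpa only [← ofReal_norm, norm_iteratedFDeriv_two] using hC t ht

/-- `φ_x` is bounded away from zero, locally uniformly in the parameter. -/
theorem exists_lower_bound [ProperSpace E] (hφ : A.IsSmoothDiffFamily₁ U φ) (hU : IsOpen U)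
    (hKU : K ⊆ U) (hK : IsCompact K) :
    ∃ m : ℝ, 0 < m ∧ ∀ t ∈ K, ∀ x, m ≤ deriv (φ t) x := by
  refine hK.induction_on (p := fun S => ∃ m : ℝ, 0 < m ∧ ∀ t ∈ S, ∀ x, m ≤ deriv (φ t) x)
    ⟨1, one_pos, by simp⟩ ?_ ?_ ?_
  · rintro S T hST ⟨m, hm, h⟩
    exact ⟨m, hm, fun t ht => h t (hST ht)⟩
  · rintro S T ⟨m, hm, h⟩ ⟨m', hm', h'⟩
    refine ⟨min m m', lt_min hm hm', ?_⟩
    rintro t (ht | ht) x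
    · exact (min_le_left _ _).trans (h t ht x)
    · exact (min_le_right _ _).trans (h' t ht x)
  · intro t₀ ht₀
    obtain ⟨m, hm, hmt⟩ := (hφ.2 t₀ (hKU ht₀)).1.2.1.exists_lower_bound (hφ.2 t₀ (hKU ht₀)).2
    simp only [hφ.jointlySmooth.deriv_sub_id hU (hKU ht₀), add_sub_cancel] at hmt
    obtain ⟨r, hr, hball⟩ := Metric.nhds_basis_closedBall.mem_iff.1 (hU.mem_nhds (hKU ht₀))
    obtain ⟨C, hC0, hC⟩ := hφ.exists_bound_fderiv hU hball (isCompact_closedBall t₀ r)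
    -- By the mean value inequality, moving the parameter by at most `ρ` changes `φ_x` by at most `C
    -- ρ ≤ m / 2`, uniformly in `x`. The `+ 1` guards against `C = 0`.
    set ρ := min r (m / (2 * (C + 1)))
    have hρ : 0 < ρ := lt_min hr (by positivity)
    refine ⟨Metric.closedBall t₀ ρ, mem_nhdsWithin_of_mem_nhds (Metric.closedBall_mem_nhds _ hρ),
      m / 2, by positivity, fun t ht x => ?_⟩
    have hsub : Metric.closedBall t₀ ρ ⊆ Metric.closedBall t₀ r :=
      Metric.closedBall_subset_closedBall (min_le_left _ _)
    have h1 := Convex.norm_image_sub_le_of_norm_fderiv_le (𝕜 := ℝ)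
      (f := fun τ => deriv (φ τ) x) (C := C)
      (fun τ hτ => (hφ.jointlySmooth.deriv_space hU).differentiableAt_param hU
        (hball (hsub hτ)) x)
      (fun τ hτ => (hC τ (hsub hτ)).1 x) (convex_closedBall t₀ ρ)
      (Metric.mem_closedBall_self hρ.le) ht
    rw [← dist_eq_norm t] at h1
    have h2 : dist t t₀ ≤ m / (2 * (C + 1)) := (Metric.mem_closedBall.1 ht).trans (min_le_right _ _)
    have h3 : C * dist t t₀ ≤ m / 2 := by
      calc C * dist t t₀ ≤ (C + 1) * (m / (2 * (C + 1))) := by gcongr; linarith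
        _ = m / 2 := by field_simp
    have h4 := abs_le.1 (h1.trans h3)
    linarith [hmt x, h4.1]

end DecayClass.IsSmoothDiffFamily₁

end DiffFamily

/-! ### Constructions of smooth families -/

section Constructions

variable {E E' : Type*} [NormedAddCommGroup E] [NormedSpace ℝ E] [NormedAddCommGroup E']
  [NormedSpace ℝ E'] {A : DecayClass} {U : Set E} {f g F G : E → ℝ → ℝ}

theorem natCast_le_infty (n : ℕ) : ((n : ℕ∞) : WithTop ℕ∞) ≤ ((⊤ : ℕ∞) : WithTop ℕ∞) := by
  exact_mod_cast le_top

theorem mixedDeriv_congr (hU : IsOpen U) (h : ∀ t ∈ U, F t = G t) (k n : ℕ) {t : E} (ht : t ∈ U)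
    (x : ℝ) : mixedDeriv F k n t x = mixedDeriv G k n t x := by
  have h1 : (fun τ => iteratedDeriv n (F τ) x) =ᶠ[𝓝 t] fun τ => iteratedDeriv n (G τ) x :=
    (hU.eventually_mem ht).mono fun τ hτ => by simp only [h τ hτ]
  exact (h1.iteratedFDeriv ℝ k).self_of_nhds

/-- Mixed derivatives depend only on the germ in the parameter, so agreement on the open set `U`
suffices. Identities such as `(φ_t)_x = (φ_x)_t` are available only there. -/
theorem DecayClass.LocallyUniformDecay.congr (hd : A.LocallyUniformDecay U F) (hU : IsOpen U)
    (h : ∀ t ∈ U, F t = G t) : A.LocallyUniformDecay U G := by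
  have hm := fun k n t (ht : t ∈ U) x => mixedDeriv_congr hU h k n ht x
  cases A with
  | compactSupport =>
    intro K hK hKc
    obtain ⟨R, hR⟩ := hd K hK hKc
    exact ⟨R, fun t ht x hx => by rw [← h t (hK ht)]; exact hR t ht x hx⟩
  | schwartz =>
    intro K hK hKc k m n
    obtain ⟨C, hC⟩ := hd K hK hKc k m n
    exact ⟨C, fun t ht x => by rw [← hm k n t (hK ht)]; exact hC t ht x⟩
  | sobolev =>
    intro K hK hKc k n
    obtain ⟨C, hC⟩ := hd K hK hKc k n
    refine ⟨C, fun t ht => ?_⟩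
    simp only [← hm k n t (hK ht)]
    exact hC t ht

theorem mixedDeriv_add (hF : JointlySmooth U F) (hG : JointlySmooth U G) (hU : IsOpen U)
    (k n : ℕ) {t : E} (ht : t ∈ U) (x : ℝ) :
    mixedDeriv (fun t x => F t x + G t x) k n t x
      = mixedDeriv F k n t x + mixedDeriv G k n t x := by
  have h1 : (fun τ => iteratedDeriv n (fun x => F τ x + G τ x) x) =ᶠ[𝓝 t]
      (fun τ => iteratedDeriv n (F τ) x) + fun τ => iteratedDeriv n (G τ) x := by
    filter_upwards [hU.mem_nhds ht] with τ hτ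
    exact iteratedDeriv_add (((hF.contDiff_space hU hτ).of_le (natCast_le_infty n)).contDiffAt)
      (((hG.contDiff_space hU hτ).of_le (natCast_le_infty n)).contDiffAt)
  rw [mixedDeriv, (h1.iteratedFDeriv ℝ k).self_of_nhds]
  exact iteratedFDeriv_add_apply
    (((hF.iteratedDeriv_space hU n).contDiffAt_param hU ht x).of_le (natCast_le_infty k))
    (((hG.iteratedDeriv_space hU n).contDiffAt_param hU ht x).of_le (natCast_le_infty k))

theorem DecayClass.LocallyUniformDecay.add (hd : A.LocallyUniformDecay U F)
    (hd' : A.LocallyUniformDecay U G) (hF : JointlySmooth U F) (hG : JointlySmooth U G)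
    (hU : IsOpen U) : A.LocallyUniformDecay U (fun t x => F t x + G t x) := by
  have hm := fun k n t (ht : t ∈ U) x => mixedDeriv_add hF hG hU k n ht x
  cases A with
  | compactSupport =>
    intro K hK hKc
    obtain ⟨R, hR⟩ := hd K hK hKc
    obtain ⟨R', hR'⟩ := hd' K hK hKc
    refine ⟨max R R', fun t ht x hx => ?_⟩
    simp only [hR t ht x ((le_max_left _ _).trans_lt hx),
      hR' t ht x ((le_max_right _ _).trans_lt hx), add_zero]
  | schwartz =>
    intro K hK hKc k m n
    obtain ⟨C, hC⟩ := hd K hK hKc k m n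
    obtain ⟨C', hC'⟩ := hd' K hK hKc k m n
    refine ⟨C + C', fun t ht x => ?_⟩
    rw [hm k n t (hK ht)]
    calc _ ≤ (1 + x ^ 2) ^ m * (‖mixedDeriv F k n t x‖ + ‖mixedDeriv G k n t x‖) := by
          gcongr; exact norm_add_le _ _
      _ ≤ _ := by rw [mul_add]; exact add_le_add (hC t ht x) (hC' t ht x)
  | sobolev =>
    intro K hK hKc k n
    obtain ⟨C, hC⟩ := hd K hK hKc k n
    obtain ⟨C', hC'⟩ := hd' K hK hKc k n
    refine ⟨C + C', fun t ht => ?_⟩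
    calc _ ≤ ∫⁻ x, (‖mixedDeriv F k n t x‖ₑ + ‖mixedDeriv G k n t x‖ₑ) := by
          refine lintegral_mono fun x => ?_
          rw [hm k n t (hK ht), ← ofReal_norm, ← ofReal_norm, ← ofReal_norm,
            ← ENNReal.ofReal_add (norm_nonneg _) (norm_nonneg _)]
          exact ENNReal.ofReal_le_ofReal (norm_add_le _ _)
      _ = (∫⁻ x, ‖mixedDeriv F k n t x‖ₑ) + ∫⁻ x, ‖mixedDeriv G k n t x‖ₑ := by
          refine lintegral_add_left ?_ _
          exact ((hF.mixedDeriv hU k n).contDiff_space hU (hK ht)).continuous.enorm.measurable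
      _ ≤ _ := by rw [ENNReal.coe_add]; exact add_le_add (hC t ht) (hC' t ht)

theorem DecayClass.IsSmoothFamily₁.add (hf : A.IsSmoothFamily₁ U f) (hg : A.IsSmoothFamily₁ U g)
    (hU : IsOpen U) : A.IsSmoothFamily₁ U (fun t x => f t x + g t x) := by
  refine ⟨ContDiffOn.add hf.1 hg.1, ?_, fun t ht => by
    simpa using! (hf.2.2 t ht).add (hg.2.2 t ht)⟩
  refine (hf.2.1.add hg.2.1 (hf.jointlySmooth.deriv_space hU) (hg.jointlySmooth.deriv_space hU)
    hU).congr hU fun t ht => ?_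
  funext x
  exact (deriv_add (hf.jointlySmooth.differentiable_space hU ht x)
    (hg.jointlySmooth.differentiable_space hU ht x)).symm

/-- With separated variables, the decay in `x` and the local boundedness in `t` can be estimated
independently. -/
theorem mixedDeriv_smul {c : E → ℝ} (hc : ContDiffOn ℝ ∞ c U) (hU : IsOpen U) (h : ℝ → ℝ)
    (k n : ℕ) {t : E} (ht : t ∈ U) (x : ℝ) :
    mixedDeriv (fun t x => c t * h x) k n t x = iteratedDeriv n h x • iteratedFDeriv ℝ k c t := by
  have h1 : (fun τ => iteratedDeriv n (fun x => c τ * h x) x) = iteratedDeriv n h x • c := by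
    funext τ
    rw [iteratedDeriv_const_mul_field, Pi.smul_apply, smul_eq_mul, mul_comm]
  rw [mixedDeriv, h1]
  exact iteratedFDeriv_const_smul_apply
    ((hc.contDiffAt (hU.mem_nhds ht)).of_le (natCast_le_infty k))

theorem ContDiffOn.exists_bound_iteratedFDeriv {c : E → ℝ} (hc : ContDiffOn ℝ ∞ c U)
    (hU : IsOpen U) {K : Set E} (hK : K ⊆ U) (hKc : IsCompact K) (k : ℕ) :
    ∃ C : ℝ≥0, ∀ t ∈ K, ‖iteratedFDeriv ℝ k c t‖ ≤ C := by
  have h1 : ContinuousOn (iteratedFDeriv ℝ k c) K :=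
    ((hc.continuousOn_iteratedFDerivWithin (natCast_le_infty k) hU.uniqueDiffOn).congr
      fun t ht => (iteratedFDerivWithin_of_isOpen k hU ht).symm).mono hK
  obtain ⟨C, hC⟩ := hKc.exists_bound_of_continuousOn h1
  exact ⟨C.toNNReal, fun t ht => (hC t ht).trans (Real.le_coe_toNNReal C)⟩

theorem DecayClass.Mem.locallyUniformDecay_mul {c : E → ℝ} (hc : ContDiffOn ℝ ∞ c U)
    (hU : IsOpen U) {h : ℝ → ℝ} (hh : A.Mem h) :
    A.LocallyUniformDecay U (fun t x => c t * h x) := by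
  have hm := fun k n t (ht : t ∈ U) x => mixedDeriv_smul hc hU h k n ht x
  cases A with
  | compactSupport =>
    intro K hK hKc
    obtain ⟨R, hR⟩ := hh.2.isBounded.subset_closedBall 0
    refine ⟨R, fun t ht x hx => ?_⟩
    have : x ∉ tsupport h := fun h' => by
      have := hR h'
      rw [mem_closedBall_zero_iff, Real.norm_eq_abs] at this
      linarith
    simp [image_eq_zero_of_notMem_tsupport this]
  | schwartz =>
    intro K hK hKc k m n
    obtain ⟨C, hC⟩ := ContDiffOn.exists_bound_iteratedFDeriv hc hU hK hKc k
    obtain ⟨h, rfl⟩ := hh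
    -- The exponent `2 * m` comes from `(1 + x²)^m ≤ (1 + |x|)^(2m)`.
    have hb := SchwartzMap.one_add_le_sup_seminorm_apply (𝕜 := ℝ) (m := (2 * m, n))
      (k := 2 * m) (n := n) le_rfl le_rfl h
    set B := 2 ^ (2 * m, n).1 *
      ((Finset.Iic (2 * m, n)).sup fun m => SchwartzMap.seminorm ℝ m.1 m.2) h
    refine ⟨B * C, fun t ht x => ?_⟩
    rw [hm k n t (hK ht), norm_smul, ← mul_assoc]
    have h1 : (1 + x ^ 2) ^ m * ‖iteratedDeriv n h x‖ ≤ B := by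
      refine le_trans ?_ (hb x)
      rw [norm_iteratedFDeriv_eq_norm_iteratedDeriv, pow_mul]
      gcongr
      rw [Real.norm_eq_abs]
      nlinarith [abs_nonneg x, sq_abs x]
    have hB : 0 ≤ B := le_trans (by positivity) h1
    exact mul_le_mul h1 (hC t ht) (norm_nonneg _) hB
  | sobolev =>
    intro K hK hKc k n
    obtain ⟨C, hC⟩ := ContDiffOn.exists_bound_iteratedFDeriv hc hU hK hKc k
    refine ⟨(∫⁻ x, ‖iteratedDeriv n h x‖ₑ).toNNReal * C, fun t ht => ?_⟩
    rw [ENNReal.coe_mul, ENNReal.coe_toNNReal (hh.2 n).2.ne,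
      ← lintegral_mul_const' _ _ ENNReal.coe_ne_top]
    refine lintegral_mono fun x => ?_
    rw [hm k n t (hK ht), enorm_smul]
    gcongr
    rw [enorm_le_coe]
    exact_mod_cast hC t ht

theorem DecayClass.Mem₁.isSmoothFamily₁_mul {c : E → ℝ} (hc : ContDiffOn ℝ ∞ c U)
    (hU : IsOpen U) {h : ℝ → ℝ} (hh : A.Mem₁ h) :
    A.IsSmoothFamily₁ U (fun t x => c t * h x) := by
  refine ⟨?_, ?_, fun t _ => by simpa using hh.2.2.const_mul (c t)⟩
  · exact (hc.comp contDiffOn_fst fun p hp => hp.1).mul (hh.1.comp contDiff_snd).contDiffOn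
  · refine (hh.2.1.locallyUniformDecay_mul hc hU).congr hU fun t _ => ?_
    funext x
    exact (deriv_const_mul _ (differentiable_of hh.1 x)).symm

theorem DecayClass.Mem₁.isSmoothFamily₁_const (U : Set E) (hU : IsOpen U) {h : ℝ → ℝ}
    (hh : A.Mem₁ h) : A.IsSmoothFamily₁ U (fun _ x => h x) := by
  simpa using hh.isSmoothFamily₁_mul (U := U) (c := fun _ => 1) contDiffOn_const hU

/-- Pulling back the parameter along an affine map. -/
theorem norm_mixedDeriv_comp_le (hF : JointlySmooth U F) (hU : IsOpen U) (L : E' →L[ℝ] E) (a : E)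
    (k n : ℕ) {s : E'} (hs : L s + a ∈ U) (x : ℝ) :
    ‖mixedDeriv (fun s => F (L s + a)) k n s x‖ ≤ ‖mixedDeriv F k n (L s + a) x‖ * ‖L‖ ^ k := by
  set h : E → ℝ := fun τ => iteratedDeriv n (F τ) x with hh
  set V : Set E := (fun y => y + a) ⁻¹' U with hV
  have hVo : IsOpen V := hU.preimage (continuous_add_const a)
  have hLV : IsOpen (L ⁻¹' V) := hVo.preimage L.continuous
  have hc : ContDiffOn ℝ ∞ (fun y => h (y + a)) V := fun y hy =>
    (((hF.iteratedDeriv_space hU n).contDiffAt_param hU hy x).comp y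
      (contDiffAt_id.add contDiffAt_const)).contDiffWithinAt
  have h1 := L.iteratedFDerivWithin_comp_right hc hVo.uniqueDiffOn hLV.uniqueDiffOn (x := s) hs
    (i := k) (natCast_le_infty k)
  rw [iteratedFDerivWithin_of_isOpen k hLV hs, iteratedFDerivWithin_of_isOpen k hVo hs,
    iteratedFDeriv_comp_add_right] at h1
  have h2 : mixedDeriv (fun s => F (L s + a)) k n s x
      = iteratedFDeriv ℝ k ((fun y => h (y + a)) ∘ L) s := rfl
  rw [h2, h1]
  refine (ContinuousMultilinearMap.norm_compContinuousLinearMap_le _ _).trans ?_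
  simp [mixedDeriv, hh]

/-- Affine maps preserve compactness, and a `k`-th parameter derivative picks up at most the factor
`‖L‖ ^ k`. The instances needed are the slices of a two-parameter variation and a curve viewed as a
family independent of `s`. -/
theorem DecayClass.LocallyUniformDecay.comp (hd : A.LocallyUniformDecay U F)
    (hF : JointlySmooth U F) (hU : IsOpen U) (L : E' →L[ℝ] E) (a : E) {U' : Set E'}
    (hU' : ∀ s ∈ U', L s + a ∈ U) : A.LocallyUniformDecay U' (fun s => F (L s + a)) := by
  have hm := fun k n s (hs : s ∈ U') x => norm_mixedDeriv_comp_le hF hU L a k n (hU' s hs) x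
  have hcont : Continuous fun s => L s + a := L.continuous.add continuous_const
  have hKU : ∀ {K : Set E'}, K ⊆ U' → (fun s => L s + a) '' K ⊆ U := by
    rintro K hK _ ⟨s, hs, rfl⟩
    exact hU' s (hK hs)
  cases A with
  | compactSupport =>
    intro K hK hKc
    obtain ⟨R, hR⟩ := hd _ (hKU hK) (hKc.image hcont)
    exact ⟨R, fun t ht => hR _ (mem_image_of_mem _ ht)⟩
  | schwartz =>
    intro K hK hKc k m n
    obtain ⟨C, hC⟩ := hd _ (hKU hK) (hKc.image hcont) k m n
    refine ⟨C * ‖L‖ ^ k, fun t ht x => ?_⟩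
    refine (mul_le_mul_of_nonneg_left (hm k n t (hK ht) x) (by positivity)).trans ?_
    rw [← mul_assoc]
    exact mul_le_mul_of_nonneg_right (hC _ (mem_image_of_mem _ ht) x) (by positivity)
  | sobolev =>
    intro K hK hKc k n
    obtain ⟨C, hC⟩ := hd _ (hKU hK) (hKc.image hcont) k n
    refine ⟨C * ‖L‖₊ ^ k, fun t ht => ?_⟩
    have hle : ∀ x, ‖mixedDeriv (fun s => F (L s + a)) k n t x‖ₑ
        ≤ ‖mixedDeriv F k n (L t + a) x‖ₑ * ((‖L‖₊ ^ k : ℝ≥0) : ℝ≥0∞) := fun x => by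
      have := hm k n t (hK ht) x
      simp only [enorm_eq_nnnorm]
      exact_mod_cast this
    refine (lintegral_mono hle).trans ?_
    rw [lintegral_mul_const' _ _ ENNReal.coe_ne_top, ENNReal.coe_mul]
    gcongr
    exact hC _ (mem_image_of_mem _ ht)

theorem JointlySmooth.comp_affine (hF : JointlySmooth U F) (L : E' →L[ℝ] E) (a : E) {U' : Set E'}
    (hU' : ∀ s ∈ U', L s + a ∈ U) : JointlySmooth U' (fun s => F (L s + a)) := by
  refine ContDiffOn.comp (t := U ×ˢ univ) (g := fun p : E × ℝ => F p.1 p.2)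
    (f := fun p : E' × ℝ => (L p.1 + a, p.2)) hF ?_ fun p hp => ⟨hU' _ hp.1, mem_univ _⟩
  exact (((L.contDiff.comp contDiff_fst).add contDiff_const).prodMk contDiff_snd).contDiffOn

theorem DecayClass.IsSmoothFamily₁.comp (hf : A.IsSmoothFamily₁ U f) (hU : IsOpen U)
    (L : E' →L[ℝ] E) (a : E) {U' : Set E'} (hU' : ∀ s ∈ U', L s + a ∈ U) :
    A.IsSmoothFamily₁ U' (fun s => f (L s + a)) :=
  ⟨hf.jointlySmooth.comp_affine L a hU',
    hf.2.1.comp (hf.jointlySmooth.deriv_space hU) hU L a hU', fun s hs => hf.2.2 _ (hU' s hs)⟩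

theorem DecayClass.IsSmoothDiffFamily₁.comp (hf : A.IsSmoothDiffFamily₁ U f) (hU : IsOpen U)
    (L : E' →L[ℝ] E) (a : E) {U' : Set E'} (hU' : ∀ s ∈ U', L s + a ∈ U) :
    A.IsSmoothDiffFamily₁ U' (fun s => f (L s + a)) :=
  ⟨hf.1.comp hU L a hU', fun s hs => hf.2 _ (hU' s hs)⟩

end Constructions

/-! ### The velocity of a smooth family -/

section Velocity

variable {A : DecayClass} {J : Set ℝ} {f h : ℝ → ℝ → ℝ}

theorem JointlySmooth.velocity (hf : JointlySmooth J f) (hJ : IsOpen J) :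
    JointlySmooth J (velocity f) :=
  (hf.fderiv_param hJ).clm_comp (ContinuousLinearMap.apply ℝ ℝ (1 : ℝ))

theorem JointlySmooth.hasDerivAt_param (hf : JointlySmooth J f) (hJ : IsOpen J) {t : ℝ}
    (ht : t ∈ J) (x : ℝ) : HasDerivAt (fun τ => f τ x) (HunterSaxton.velocity f t x) t :=
  (hf.differentiableAt_param hJ ht x).hasDerivAt

theorem JointlySmooth.hasDerivAt_velocity (hf : JointlySmooth J f) (hJ : IsOpen J) {t : ℝ}
    (ht : t ∈ J) (x : ℝ) :
    HasDerivAt (HunterSaxton.velocity f t)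
      (HunterSaxton.velocity (fun τ => deriv (f τ)) t x) x :=
  (ContinuousLinearMap.apply ℝ ℝ (1 : ℝ)).hasFDerivAt.comp_hasDerivAt x
    (hf.hasDerivAt_fderiv_param hJ ht x)

theorem JointlySmooth.deriv_velocity (hf : JointlySmooth J f) (hJ : IsOpen J) {t : ℝ}
    (ht : t ∈ J) : deriv (HunterSaxton.velocity f t)
      = HunterSaxton.velocity (fun τ => deriv (f τ)) t :=
  funext fun x => (hf.hasDerivAt_velocity hJ ht x).deriv

theorem JointlySmooth.iteratedDeriv_velocity (hf : JointlySmooth J f) (hJ : IsOpen J) {t : ℝ}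
    (ht : t ∈ J) (n : ℕ) : iteratedDeriv n (HunterSaxton.velocity f t)
      = HunterSaxton.velocity (fun τ => iteratedDeriv n (f τ)) t := by
  induction n with
  | zero => simp
  | succ n ih =>
    rw [iteratedDeriv_succ, ih, (hf.iteratedDeriv_space hJ n).deriv_velocity hJ ht]
    simp only [iteratedDeriv_succ]

theorem velocity_congr (hJ : IsOpen J) (hfh : ∀ t ∈ J, f t = h t) {t : ℝ} (ht : t ∈ J) :
    velocity f t = velocity h t := by
  funext x
  refine EventuallyEq.deriv_eq ?_
  filter_upwards [hJ.mem_nhds ht] with τ hτ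
  rw [hfh τ hτ]

/-- Norms are compared because the two sides are multilinear maps of different arity. For a
one-dimensional parameter both norms are those of the same ordinary iterated derivative. -/
theorem norm_mixedDeriv_velocity (hf : JointlySmooth J f) (hJ : IsOpen J) (k n : ℕ) {t : ℝ}
    (ht : t ∈ J) (x : ℝ) :
    ‖mixedDeriv (velocity f) k n t x‖ = ‖mixedDeriv f (k + 1) n t x‖ := by
  have h1 : (fun τ => iteratedDeriv n (velocity f τ) x) =ᶠ[𝓝 t]
      deriv (fun τ => iteratedDeriv n (f τ) x) := by
    filter_upwards [hJ.mem_nhds ht] with τ hτ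
    rw [hf.iteratedDeriv_velocity hJ hτ]
    rfl
  rw [mixedDeriv, (h1.iteratedFDeriv ℝ k).self_of_nhds, mixedDeriv,
    norm_iteratedFDeriv_eq_norm_iteratedDeriv, norm_iteratedFDeriv_eq_norm_iteratedDeriv,
    iteratedDeriv_succ']

theorem DecayClass.LocallyUniformDecay.velocity (hd : A.LocallyUniformDecay J f)
    (hf : JointlySmooth J f) (hJ : IsOpen J) : A.LocallyUniformDecay J (velocity f) := by
  have hm := fun k n t (ht : t ∈ J) x => norm_mixedDeriv_velocity hf hJ k n ht x
  cases A with
  | compactSupport =>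
    intro K hK hKc
    obtain ⟨L, hL, hKL, hLU⟩ := exists_compact_between hKc hJ hK
    obtain ⟨R, hR⟩ := hd L hLU hL
    refine ⟨R, fun t ht x hx => ?_⟩
    have h1 : (fun τ => f τ x) =ᶠ[𝓝 t] fun _ => 0 := by
      filter_upwards [isOpen_interior.mem_nhds (hKL ht)] with τ hτ
      exact hR τ (interior_subset hτ) x hx
    rw [HunterSaxton.velocity, h1.deriv_eq, deriv_const]
  | schwartz =>
    intro K hK hKc k m n
    obtain ⟨C, hC⟩ := hd K hK hKc (k + 1) m n
    exact ⟨C, fun t ht x => by rw [hm k n t (hK ht)]; exact hC t ht x⟩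
  | sobolev =>
    intro K hK hKc k n
    obtain ⟨C, hC⟩ := hd K hK hKc (k + 1) n
    refine ⟨C, fun t ht => ?_⟩
    simp only [← ofReal_norm, hm k n t (hK ht)]
    simpa only [← ofReal_norm] using hC t ht

/-- The second derivative in the parameter of a smooth family in `𝒜₁(ℝ)` is bounded, uniformly
in `x` and locally uniformly in the parameter. -/
theorem DecayClass.IsSmoothFamily₁.exists_bound_velocity_velocity (hf : A.IsSmoothFamily₁ J f)
    (hJ : IsOpen J) {K : Set ℝ} (hK : K ⊆ J) (hKc : IsCompact K) :
    ∃ M : ℝ, 0 ≤ M ∧ ∀ t ∈ K, ∀ x, |HunterSaxton.velocity (HunterSaxton.velocity f) t x| ≤ M := by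
  have hv := hf.jointlySmooth.velocity hJ
  have hvv := hv.velocity hJ
  have hF := hf.jointlySmooth.deriv_space hJ
  obtain ⟨C, hC0, hC⟩ := hf.2.1.exists_bound hF hJ hK hKc 2
  -- The `L¹`-bound on `f_ttx` controls only the oscillation of `f_tt` in `x`; its value at `x = 0`,
  -- bounded on the compact set `K`, serves as the anchor.
  obtain ⟨B, hB⟩ := hKc.exists_bound_of_continuousOn
    (f := fun t => HunterSaxton.velocity (HunterSaxton.velocity f) t 0)
    fun t ht => (hvv.contDiffAt_param hJ (hK ht) 0).continuousAt.continuousWithinAt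
  refine ⟨|B| + C, by positivity, fun t ht x => ?_⟩
  have htJ := hK ht
  have hd : deriv (HunterSaxton.velocity (HunterSaxton.velocity f) t)
      = HunterSaxton.velocity (HunterSaxton.velocity fun τ => deriv (f τ)) t := by
    rw [hv.deriv_velocity hJ htJ]
    exact velocity_congr hJ (fun τ hτ => hf.jointlySmooth.deriv_velocity hJ hτ) htJ
  have hn : ∀ y, ‖iteratedFDeriv ℝ 2 (fun τ => deriv (f τ) y) t‖
      = ‖deriv (HunterSaxton.velocity (HunterSaxton.velocity f) t) y‖ := fun y => by
    rw [norm_iteratedFDeriv_eq_norm_iteratedDeriv, hd, iteratedDeriv_succ, iteratedDeriv_one]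
    rfl
  have hs := hvv.contDiff_space hJ htJ
  have h1 : ∫ z in (0 : ℝ)..x, deriv (HunterSaxton.velocity (HunterSaxton.velocity f) t) z
      = HunterSaxton.velocity (HunterSaxton.velocity f) t x
        - HunterSaxton.velocity (HunterSaxton.velocity f) t 0 :=
    intervalIntegral.integral_eq_sub_of_hasDerivAt (fun z _ => hasDerivAt_of hs z)
      ((contDiff_deriv hs).continuous.intervalIntegrable _ _)
  have h2 : ‖∫ z in (0 : ℝ)..x, deriv (HunterSaxton.velocity (HunterSaxton.velocity f) t) z‖ₑ
      ≤ ENNReal.ofReal C := by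
    rw [← ofReal_norm, intervalIntegral.norm_integral_eq_norm_integral_uIoc, ofReal_norm]
    refine (enorm_integral_le_lintegral_enorm _).trans
      ((setLIntegral_le_lintegral _ _).trans ?_)
    have := (hC t ht).2
    simpa only [← ofReal_norm, hn] using this
  rw [h1, ← ofReal_norm, ENNReal.ofReal_le_ofReal_iff hC0] at h2
  have h3 := (hB t ht).trans (le_abs_self B)
  rw [Real.norm_eq_abs] at h2 h3
  have h4 := abs_add_le (HunterSaxton.velocity (HunterSaxton.velocity f) t x
        - HunterSaxton.velocity (HunterSaxton.velocity f) t 0)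
        (HunterSaxton.velocity (HunterSaxton.velocity f) t 0)
  rw [sub_add_cancel] at h4
  linarith

/-- The decay conditions concern `f_x`, while the limit at `-∞` is assumed only parameter by
parameter. Taylor's formula passes it on to `f_t`: with `M` a bound for `f_tt` uniform in `x`, `ρ
|f_t(t)| ≤ |f(t + ρ) - f(t)| + M ρ²`. For `x → -∞` this leaves `M ρ`, and `ρ` is arbitrarily small.
-/
theorem DecayClass.IsSmoothFamily₁.tendsto_velocity (hf : A.IsSmoothFamily₁ J f)
    (hJ : IsOpen J) {t : ℝ} (ht : t ∈ J) :
    Tendsto (HunterSaxton.velocity f t) atBot (𝓝 0) := by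
  have hj := hf.jointlySmooth
  obtain ⟨r, hr, hball⟩ := Metric.nhds_basis_closedBall.mem_iff.1 (hJ.mem_nhds ht)
  obtain ⟨M, hM0, hM⟩ := hf.exists_bound_velocity_velocity hJ hball (isCompact_closedBall t r)
  have key : ∀ ρ, 0 < ρ → ρ ≤ r → ∀ x,
      ρ * |HunterSaxton.velocity f t x| ≤ |f (t + ρ) x - f t x| + M * ρ * ρ := by
    intro ρ hρ hρr x
    have hsub : Metric.closedBall t ρ ⊆ J :=
      (Metric.closedBall_subset_closedBall hρr).trans hball
    have htm : t ∈ Metric.closedBall t ρ := Metric.mem_closedBall_self hρ.le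
    have h1 : ∀ τ ∈ Metric.closedBall t ρ,
        ‖HunterSaxton.velocity f τ x - HunterSaxton.velocity f t x‖ ≤ M * ρ := by
      intro τ hτ
      have := (convex_closedBall t ρ).norm_image_sub_le_of_norm_hasDerivWithin_le
        (f := fun τ => HunterSaxton.velocity f τ x) (C := M)
        (fun σ hσ => ((hj.velocity hJ).hasDerivAt_param hJ (hsub hσ) x).hasDerivWithinAt)
        (fun σ hσ => hM σ (Metric.closedBall_subset_closedBall hρr hσ) x) htm hτ
      refine this.trans ?_
      gcongr
      exact mem_closedBall_iff_norm.1 hτ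
    have hρm : t + ρ ∈ Metric.closedBall t ρ := by
      simp [Metric.mem_closedBall, abs_of_pos hρ]
    -- After subtraction of the tangent line at `t`, the derivative is at most `M * ρ` on the whole
    -- ball.
    have h2 := (convex_closedBall t ρ).norm_image_sub_le_of_norm_hasDerivWithin_le
        (f := fun τ => f τ x - τ * HunterSaxton.velocity f t x) (C := M * ρ)
        (f' := fun τ => HunterSaxton.velocity f τ x - 1 * HunterSaxton.velocity f t x)
        (fun σ hσ => ((hj.hasDerivAt_param hJ (hsub hσ) x).sub
          ((hasDerivAt_id σ).mul_const _)).hasDerivWithinAt)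
        (fun σ hσ => by rw [one_mul]; exact h1 σ hσ) htm hρm
    have h3 : f (t + ρ) x - (t + ρ) * HunterSaxton.velocity f t x
        - (f t x - t * HunterSaxton.velocity f t x)
        = (f (t + ρ) x - f t x) - ρ * HunterSaxton.velocity f t x := by ring
    rw [h3, add_sub_cancel_left, Real.norm_eq_abs, Real.norm_eq_abs, abs_of_pos hρ] at h2
    have h4 := abs_sub_abs_le_abs_sub (ρ * HunterSaxton.velocity f t x) (f (t + ρ) x - f t x)
    rw [abs_sub_comm (ρ * _), abs_mul, abs_of_pos hρ] at h4
    linarith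
  rw [Metric.tendsto_nhds]
  intro ε hε
  -- Makes `M ρ ≤ ε / 2`; the other `ε / 2` absorbs the difference quotient for `x` near `-∞`.
  set ρ := min r (ε / (2 * (M + 1)))
  have hρ : 0 < ρ := lt_min hr (by positivity)
  have hρr : ρ ≤ r := min_le_left _ _
  have hρm : t + ρ ∈ J := hball (by simpa [Metric.mem_closedBall, abs_of_pos hρ] using hρr)
  have hMρ : M * ρ ≤ ε / 2 := by
    calc M * ρ ≤ (M + 1) * (ε / (2 * (M + 1))) := by
          gcongr
          · linarith
          · exact min_le_right _ _
      _ = ε / 2 := by field_simp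
  have hlim : Tendsto (fun x => |f (t + ρ) x - f t x|) atBot (𝓝 0) := by
    simpa using ((hf.2.2 _ hρm).sub (hf.2.2 t ht)).abs
  filter_upwards [hlim.eventually_lt_const (show 0 < ρ * (ε / 2) by positivity)] with x hx
  rw [dist_zero_right, Real.norm_eq_abs]
  have h1 := key ρ hρ hρr x
  have h2 : M * ρ * ρ ≤ ε / 2 * ρ := by gcongr
  have h3 : ρ * |HunterSaxton.velocity f t x| < ρ * ε := by linarith
  exact lt_of_mul_lt_mul_left h3 hρ.le

theorem DecayClass.IsSmoothFamily₁.velocity (hf : A.IsSmoothFamily₁ J f) (hJ : IsOpen J) :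
    A.IsSmoothFamily₁ J (velocity f) := by
  have hj := hf.jointlySmooth
  refine ⟨hj.velocity hJ, ?_, fun t ht => hf.tendsto_velocity hJ ht⟩
  exact (hf.2.1.velocity (hj.deriv_space hJ) hJ).congr hJ fun t ht => (hj.deriv_velocity hJ ht).symm

theorem velocity_sub_id (φ : ℝ → ℝ → ℝ) : velocity (fun t x => φ t x - x) = velocity φ := by
  funext t x
  simp only [velocity, deriv_sub_const]

theorem DecayClass.IsSmoothDiffFamily₁.velocity {φ : ℝ → ℝ → ℝ}
    (hφ : A.IsSmoothDiffFamily₁ J φ) (hJ : IsOpen J) : A.IsSmoothFamily₁ J (velocity φ) := by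
  rw [← velocity_sub_id]
  exact hφ.1.velocity hJ

end Velocity

/-! ### Bounded smooth functions -/

section BddSmooth

/-- The product rule reduces order `n + 1` for `f g` to order `n` for `f' g` and `f g'`, so both
factors are quantified inside the induction. -/
theorem BddSmooth.exists_bound_mul (n : ℕ) : ∀ {f g : ℝ → ℝ}, BddSmooth f → BddSmooth g →
    ∃ C : ℝ, ∀ x, |iteratedDeriv n (fun x => f x * g x) x| ≤ C := by
  induction n with
  | zero =>
    intro f g hf hg
    obtain ⟨C, hC⟩ := hf.2 0
    obtain ⟨C', hC'⟩ := hg.2 0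
    refine ⟨C * C', fun x => ?_⟩
    simp only [iteratedDeriv_zero] at hC hC' ⊢
    rw [abs_mul]
    exact mul_le_mul (hC x) (hC' x) (abs_nonneg _) ((abs_nonneg _).trans (hC x))
  | succ n ih =>
    intro f g hf hg
    obtain ⟨C, hC⟩ := ih hf.deriv hg
    obtain ⟨C', hC'⟩ := ih hf hg.deriv
    refine ⟨C + C', fun x => ?_⟩
    have h1 : _root_.deriv (fun x => f x * g x) =
        (fun x => _root_.deriv f x * g x) + fun x => f x * _root_.deriv g x :=
      funext fun y => ((hasDerivAt_of hf.1 y).mul (hasDerivAt_of hg.1 y)).deriv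
    rw [iteratedDeriv_succ', h1, iteratedDeriv_add]
    · exact (abs_add_le _ _).trans (add_le_add (hC x) (hC' x))
    · exact ((hf.deriv.1.mul hg.1).of_le (natCast_le_infty n)).contDiffAt
    · exact ((hf.1.mul hg.deriv.1).of_le (natCast_le_infty n)).contDiffAt

theorem BddSmooth.mul {f g : ℝ → ℝ} (hf : BddSmooth f) (hg : BddSmooth g) :
    BddSmooth (fun x => f x * g x) :=
  ⟨hf.1.mul hg.1, fun n => BddSmooth.exists_bound_mul n hf hg⟩

theorem BddSmooth.const_add {f : ℝ → ℝ} (hf : BddSmooth f) (c : ℝ) :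
    BddSmooth (fun x => c + f x) := by
  refine ⟨contDiff_const.add hf.1, fun n => ?_⟩
  obtain ⟨C, hC⟩ := hf.2 n
  obtain ⟨C', hC'⟩ := (bddSmooth_const c).2 n
  refine ⟨C' + C, fun x => ?_⟩
  have := iteratedDeriv_add (n := n) (x := x) (f := fun _ => c) (g := f)
    contDiffAt_const (hf.1.of_le (natCast_le_infty n)).contDiffAt
  rw [show (fun x => c + f x) = (fun _ => c) + f from rfl, this]
  exact (abs_add_le _ _).trans (add_le_add (hC' x) (hC x))

/-- The derivative `P' ψ^(-j) - j P ψ' ψ^(-j-1)` is a sum of two terms of the same shape. Leaving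
`j` and `P` free in the induction thus bounds all derivatives of `ψ⁻¹` without an explicit formula.
-/
theorem BddSmooth.exists_bound_mul_inv_pow {ψ : ℝ → ℝ} (hψ : BddSmooth ψ) {m : ℝ} (hm : 0 < m)
    (hle : ∀ x, m ≤ ψ x) (n : ℕ) : ∀ (j : ℕ) {P : ℝ → ℝ}, BddSmooth P →
    ∃ C : ℝ, ∀ x, |iteratedDeriv n (fun x => P x * (ψ x)⁻¹ ^ j) x| ≤ C := by
  have hpos : ∀ x, 0 < ψ x := fun x => hm.trans_le (hle x)
  have hinv : ∀ j, ContDiff ℝ ∞ (fun x => (ψ x)⁻¹ ^ j) := fun j =>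
    (hψ.1.inv fun x => (hpos x).ne').pow j
  induction n with
  | zero =>
    intro j P hP
    obtain ⟨C, hC⟩ := hP.2 0
    refine ⟨C * m⁻¹ ^ j, fun x => ?_⟩
    simp only [iteratedDeriv_zero] at hC ⊢
    rw [abs_mul, abs_of_nonneg (pow_nonneg (inv_nonneg.2 (hpos x).le) j)]
    have h1 := hC x
    have h2 := hle x
    have := (abs_nonneg _).trans h1
    have := hpos x
    gcongr
  | succ n ih =>
    intro j P hP
    obtain ⟨C, hC⟩ := ih j hP.deriv
    have hQ : BddSmooth (fun x => (-(j : ℝ)) * (P x * _root_.deriv ψ x)) :=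
      (bddSmooth_const (-(j : ℝ))).mul (hP.mul hψ.deriv)
    obtain ⟨C', hC'⟩ := ih (j + 1) hQ
    refine ⟨C + C', fun x => ?_⟩
    have h1 : _root_.deriv (fun x => P x * (ψ x)⁻¹ ^ j) = (fun x => _root_.deriv P x * (ψ x)⁻¹ ^ j)
        + fun x => -(j : ℝ) * (P x * _root_.deriv ψ x) * (ψ x)⁻¹ ^ (j + 1) := by
      funext y
      have h2 := (hasDerivAt_of hP.1 y).mul
        (((hasDerivAt_of hψ.1 y).inv (hpos y).ne').pow j)
      refine h2.deriv.trans ?_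
      have h3 := (hpos y).ne'
      simp only [Pi.add_apply, Pi.pow_apply, Pi.inv_apply]
      rcases j with _ | j
      · simp
      · simp only [Nat.add_sub_cancel]
        rw [div_eq_mul_inv, ← inv_pow]
        ring
    rw [iteratedDeriv_succ', h1, iteratedDeriv_add]
    · exact (abs_add_le _ _).trans (add_le_add (hC x) (hC' x))
    · exact ((hP.deriv.1.mul (hinv j)).of_le (natCast_le_infty n)).contDiffAt
    · exact ((hQ.1.mul (hinv (j + 1))).of_le (natCast_le_infty n)).contDiffAt

theorem BddSmooth.inv {ψ : ℝ → ℝ} (hψ : BddSmooth ψ) {m : ℝ} (hm : 0 < m)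
    (hle : ∀ x, m ≤ ψ x) : BddSmooth (fun x => (ψ x)⁻¹) := by
  refine ⟨hψ.1.inv fun x => (hm.trans_le (hle x)).ne', fun n => ?_⟩
  simpa using hψ.exists_bound_mul_inv_pow hm hle n 1 (bddSmooth_const 1)

end BddSmooth

/-! ### Diffeomorphisms -/

section Diffeo

variable {A : DecayClass} {φ : ℝ → ℝ}

theorem contDiff_of_mem_diff₁ (hφ : φ ∈ A.diff₁) : ContDiff ℝ ∞ φ := by
  have h := hφ.1.1.add contDiff_id
  simpa using! h

theorem hasDerivAt_of_mem_diff₁ (hφ : φ ∈ A.diff₁) (x : ℝ) : HasDerivAt φ (deriv φ x) x :=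
  hasDerivAt_of (contDiff_of_mem_diff₁ hφ) x

theorem deriv_eq_of_mem_diff₁ (hφ : φ ∈ A.diff₁) (x : ℝ) :
    deriv φ x = 1 + deriv (fun y => φ y - y) x := by
  have : HasDerivAt (fun y => φ y - y) (deriv φ x - 1) x :=
    (hasDerivAt_of_mem_diff₁ hφ x).sub (hasDerivAt_id x)
  rw [this.deriv]
  ring

theorem deriv_pos_of_mem_diff₁ (hφ : φ ∈ A.diff₁) (x : ℝ) : 0 < deriv φ x := by
  rw [deriv_eq_of_mem_diff₁ hφ]
  linarith [hφ.2 x]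

theorem exists_deriv_lower_bound (hφ : φ ∈ A.diff₁) : ∃ m : ℝ, 0 < m ∧ ∀ x, m ≤ deriv φ x := by
  simp only [deriv_eq_of_mem_diff₁ hφ]
  exact hφ.1.2.1.exists_lower_bound hφ.2

theorem bddSmooth_deriv (hφ : φ ∈ A.diff₁) : BddSmooth (deriv φ) := by
  rw [funext (deriv_eq_of_mem_diff₁ hφ)]
  exact hφ.1.2.1.bddSmooth.const_add 1

theorem bddSmooth_inv_deriv (hφ : φ ∈ A.diff₁) : BddSmooth (fun x => (deriv φ x)⁻¹) := by
  obtain ⟨m, hm, hle⟩ := exists_deriv_lower_bound hφ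
  exact (bddSmooth_deriv hφ).inv hm hle

theorem exists_abs_sub_le (hφ : φ ∈ A.diff₁) : ∃ C : ℝ, ∀ x, |φ x - x| ≤ C := by
  simpa using hφ.1.bddSmooth.2 0

theorem strictMono_of_mem_diff₁ (hφ : φ ∈ A.diff₁) : StrictMono φ :=
  strictMono_of_deriv_pos (deriv_pos_of_mem_diff₁ hφ)

/-- `φ - id` is bounded, so `φ` is unbounded in both directions. -/
theorem surjective_of_mem_diff₁ (hφ : φ ∈ A.diff₁) : Function.Surjective φ := by
  obtain ⟨C, hC⟩ := exists_abs_sub_le hφ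
  refine (contDiff_of_mem_diff₁ hφ).continuous.surjective ?_ ?_
  · refine tendsto_atTop_mono (fun x => ?_) (tendsto_atTop_add_const_right atTop (-C) tendsto_id)
    have := (abs_le.1 (hC x)).1
    simp only [id]
    linarith
  · refine tendsto_atBot_mono (fun x => ?_) (tendsto_atBot_add_const_right atBot C tendsto_id)
    have := (abs_le.1 (hC x)).2
    simp only [id]
    linarith

theorem invFun_apply (hφ : φ ∈ A.diff₁) (x : ℝ) : Function.invFun φ (φ x) = x :=
  Function.leftInverse_invFun (strictMono_of_mem_diff₁ hφ).injective x

theorem apply_invFun (hφ : φ ∈ A.diff₁) (y : ℝ) : φ (Function.invFun φ y) = y :=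
  Function.rightInverse_invFun (surjective_of_mem_diff₁ hφ) y

/-- An element of `Diff_{𝒜₁}(ℝ)` as an order isomorphism of `ℝ`. -/
noncomputable def diffOrderIso (hφ : φ ∈ A.diff₁) : ℝ ≃o ℝ :=
  (strictMono_of_mem_diff₁ hφ).orderIsoOfSurjective φ (surjective_of_mem_diff₁ hφ)

theorem coe_diffOrderIso (hφ : φ ∈ A.diff₁) : ⇑(diffOrderIso hφ) = φ := rfl

theorem coe_diffOrderIso_symm (hφ : φ ∈ A.diff₁) :
    ⇑(diffOrderIso hφ).symm = Function.invFun φ := by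
  funext y
  rw [OrderIso.symm_apply_eq, coe_diffOrderIso, apply_invFun hφ]

theorem contDiff_invFun (hφ : φ ∈ A.diff₁) : ContDiff ℝ ∞ (Function.invFun φ) := by
  have h := (diffOrderIso hφ).toHomeomorph.contDiff_symm_deriv (n := ∞)
    (fun x => (deriv_pos_of_mem_diff₁ hφ x).ne') (hasDerivAt_of_mem_diff₁ hφ)
    (contDiff_of_mem_diff₁ hφ)
  rw [← coe_diffOrderIso_symm hφ]
  exact h

theorem hasDerivAt_invFun (hφ : φ ∈ A.diff₁) (y : ℝ) :
    HasDerivAt (Function.invFun φ) (deriv φ (Function.invFun φ y))⁻¹ y :=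
  HasDerivAt.of_local_left_inverse (contDiff_invFun hφ).continuous.continuousAt
    (hasDerivAt_of_mem_diff₁ hφ _) (deriv_pos_of_mem_diff₁ hφ _).ne'
    (Eventually.of_forall (apply_invFun hφ))

theorem tendsto_invFun_atBot (hφ : φ ∈ A.diff₁) : Tendsto (Function.invFun φ) atBot atBot := by
  rw [← coe_diffOrderIso_symm hφ]
  exact (diffOrderIso hφ).symm.tendsto_atBot

theorem hasDerivAt_comp_invFun (hφ : φ ∈ A.diff₁) {w : ℝ → ℝ} (hw : Differentiable ℝ w) (y : ℝ) :
    HasDerivAt (w ∘ Function.invFun φ)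
      (((fun x => deriv w x * (deriv φ x)⁻¹) ∘ Function.invFun φ) y) y :=
  (hw _).hasDerivAt.comp y (hasDerivAt_invFun hφ y)

theorem integral_eq_integral_comp (hφ : φ ∈ A.diff₁) (g : ℝ → ℝ) :
    ∫ y, g y = ∫ x, deriv φ x * g (φ x) := by
  have h := integral_image_eq_integral_abs_deriv_smul MeasurableSet.univ
    (fun x _ => (hasDerivAt_of_mem_diff₁ hφ x).hasDerivWithinAt)
    (strictMono_of_mem_diff₁ hφ).injective.injOn g
  rw [image_univ, (surjective_of_mem_diff₁ hφ).range_eq] at h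
  simpa only [Measure.restrict_univ, abs_of_pos (deriv_pos_of_mem_diff₁ hφ _), smul_eq_mul] using h

theorem integral_Iic_eq_integral_comp (hφ : φ ∈ A.diff₁) (g : ℝ → ℝ) (x : ℝ) :
    ∫ y in Iic (φ x), g y = ∫ z in Iic x, deriv φ z * g (φ z) := by
  have h := integral_image_eq_integral_abs_deriv_smul (measurableSet_Iic (a := x))
    (fun x _ => (hasDerivAt_of_mem_diff₁ hφ x).hasDerivWithinAt)
    (strictMono_of_mem_diff₁ hφ).injective.injOn g
  rw [← coe_diffOrderIso hφ, OrderIso.image_Iic, coe_diffOrderIso hφ] at h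
  simpa only [abs_of_pos (deriv_pos_of_mem_diff₁ hφ _), smul_eq_mul] using h

/-- Under `y = φ(x)` each derivative contributes `1 / φ_x` and the volume element contributes `φ_x`.
The inverse of `φ` disappears from the metric. -/
theorem metric_eq_integral (hφ : φ ∈ A.diff₁) {h k : ℝ → ℝ} (hh : Differentiable ℝ h)
    (hk : Differentiable ℝ k) : metric φ h k = ∫ x, deriv h x * deriv k x / deriv φ x := by
  rw [metric, hdot, integral_eq_integral_comp hφ]
  congr 1
  funext x
  rw [(hasDerivAt_comp_invFun hφ hh _).deriv, (hasDerivAt_comp_invFun hφ hk _).deriv]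
  simp only [Function.comp_apply, invFun_apply hφ]
  have := (deriv_pos_of_mem_diff₁ hφ x).ne'
  field_simp

/-- By the chain rule `(w ∘ φ⁻¹)' = (w' / φ_x) ∘ φ⁻¹`, and `w' / φ_x` is again in `𝒜` because `1 /
φ_x` has bounded derivatives. -/
theorem DecayClass.Mem.exists_iteratedDeriv_comp_invFun (hφ : φ ∈ A.diff₁) (n : ℕ) :
    ∀ {w : ℝ → ℝ}, A.Mem w →
      ∃ w₁, A.Mem w₁ ∧ iteratedDeriv n (w ∘ Function.invFun φ) = w₁ ∘ Function.invFun φ := by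
  induction n with
  | zero => exact fun {w} hw => ⟨w, hw, by simp⟩
  | succ n ih =>
    intro w hw
    obtain ⟨w₁, hw₁, he⟩ := ih (hw.deriv.mul (bddSmooth_inv_deriv hφ))
    refine ⟨w₁, hw₁, ?_⟩
    rw [iteratedDeriv_succ', ← he]
    congr 1
    exact funext fun y => (hasDerivAt_comp_invFun hφ (differentiable_of hw.contDiff) y).deriv

/-- The group `Diff_{𝒜₁}(ℝ)` acts on `𝒜(ℝ)` by composition. -/
theorem DecayClass.Mem.comp_invFun (hφ : φ ∈ A.diff₁) {w : ℝ → ℝ} (hw : A.Mem w) :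
    A.Mem (w ∘ Function.invFun φ) := by
  have hs : ContDiff ℝ ∞ (w ∘ Function.invFun φ) := hw.contDiff.comp (contDiff_invFun hφ)
  have hit := fun n => hw.exists_iteratedDeriv_comp_invFun hφ n
  cases A with
  | compactSupport =>
    refine ⟨hs, ?_⟩
    rw [← coe_diffOrderIso_symm hφ]
    exact hw.2.comp_homeomorph (diffOrderIso hφ).symm.toHomeomorph
  | schwartz =>
    refine ⟨⟨_, hs, fun k n => ?_⟩, rfl⟩
    obtain ⟨_, ⟨w₁, rfl⟩, he⟩ := hit n
    obtain ⟨C, hC⟩ := exists_abs_sub_le hφ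
    have hC0 : 0 ≤ C := (abs_nonneg _).trans (hC 0)
    have hb := SchwartzMap.one_add_le_sup_seminorm_apply (𝕜 := ℝ) (m := (k, 0))
      (k := k) (n := 0) le_rfl le_rfl w₁
    set B := 2 ^ (k, 0).1 * ((Finset.Iic (k, 0)).sup fun m => SchwartzMap.seminorm ℝ m.1 m.2) w₁
    refine ⟨(1 + C) ^ k * B, fun y => ?_⟩
    rw [norm_iteratedFDeriv_eq_norm_iteratedDeriv, he]
    obtain ⟨x, rfl⟩ := surjective_of_mem_diff₁ hφ y
    simp only [Function.comp_apply, invFun_apply hφ]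
    -- Since `φ - id` is bounded by `C`, polynomial weights at `φ x` are controlled by those at `x`.
    have h1 : ‖φ x‖ ≤ (1 + C) * (1 + ‖x‖) := by
      have := abs_add_le (φ x - x) x
      rw [sub_add_cancel] at this
      simp only [Real.norm_eq_abs]
      nlinarith [hC x, abs_nonneg x]
    have h2 := hb x
    rw [norm_iteratedFDeriv_zero] at h2
    calc ‖φ x‖ ^ k * ‖w₁ x‖ ≤ ((1 + C) * (1 + ‖x‖)) ^ k * ‖w₁ x‖ := by gcongr
      _ = (1 + C) ^ k * ((1 + ‖x‖) ^ k * ‖w₁ x‖) := by rw [mul_pow, mul_assoc]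
      _ ≤ _ := by gcongr
  | sobolev =>
    refine ⟨hs, fun n => ?_⟩
    obtain ⟨w₁, hw₁, he⟩ := hit n
    rw [he]
    have h := integrableOn_image_iff_integrableOn_abs_deriv_smul MeasurableSet.univ
      (fun x _ => (hasDerivAt_of_mem_diff₁ hφ x).hasDerivWithinAt)
      (strictMono_of_mem_diff₁ hφ).injective.injOn (w₁ ∘ Function.invFun φ)
    rw [image_univ, (surjective_of_mem_diff₁ hφ).range_eq] at h
    rw [← integrableOn_univ, h, integrableOn_univ]
    refine ((hw₁.mul (bddSmooth_deriv hφ)).integrable).congr (Eventually.of_forall fun x => ?_)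
    simp [abs_of_pos (deriv_pos_of_mem_diff₁ hφ x), invFun_apply hφ, mul_comm]

theorem DecayClass.Mem₁.comp_invFun (hφ : φ ∈ A.diff₁) {w : ℝ → ℝ} (hw : A.Mem₁ w) :
    A.Mem₁ (w ∘ Function.invFun φ) := by
  refine ⟨hw.1.comp (contDiff_invFun hφ), ?_, hw.2.2.comp (tendsto_invFun_atBot hφ)⟩
  rw [funext fun y => (hasDerivAt_comp_invFun hφ (differentiable_of hw.1) y).deriv]
  exact (hw.2.1.mul (bddSmooth_inv_deriv hφ)).comp_invFun hφ

theorem rightLogDeriv_mem {J : Set ℝ} {φ : ℝ → ℝ → ℝ} (hJ : IsOpen J)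
    (hφ : A.IsSmoothDiffFamily₁ J φ) {t : ℝ} (ht : t ∈ J) : A.Mem₁ (rightLogDeriv φ t) :=
  ((hφ.velocity hJ).mem₁ hJ ht).comp_invFun (hφ.2 t ht)

end Diffeo

/-! ### The Hunter–Saxton equation in Lagrangian coordinates -/

section Lagrangian

variable {A : DecayClass} {J : Set ℝ} {φ f : ℝ → ℝ → ℝ}

theorem JointlySmooth.hasFDerivAt_prod (hf : JointlySmooth J f) (hJ : IsOpen J) {t : ℝ}
    (ht : t ∈ J) (x : ℝ) : HasFDerivAt (fun p : ℝ × ℝ => f p.1 p.2)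
      ((HunterSaxton.velocity f t x) • ContinuousLinearMap.fst ℝ ℝ ℝ
        + (deriv (f t) x) • ContinuousLinearMap.snd ℝ ℝ ℝ) (t, x) := by
  have h := ((hf.contDiffAt hJ ht x).differentiableAt (by simp)).hasFDerivAt
  refine h.congr_fderiv ?_
  set D := fderiv ℝ (fun p : ℝ × ℝ => f p.1 p.2) (t, x)
  have h1 : HunterSaxton.velocity f t x = D (1, 0) := by
    have := (HasFDerivAt.comp (g := fun p : ℝ × ℝ => f p.1 p.2) (f := fun σ => (σ, x)) t h
      (hasFDerivAt_prodMk_left t x)).hasDerivAt.deriv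
    simpa using! this
  have h2 : deriv (f t) x = D (0, 1) := by
    have := (HasFDerivAt.comp (g := fun p : ℝ × ℝ => f p.1 p.2) (f := fun y => (t, y)) x h
      (hasFDerivAt_prodMk_right t x)).hasDerivAt.deriv
    simpa using! this
  rw [h1, h2]
  ext <;> simp

/-- Monotonicity does the work: a strict inequality between `φ(t, z)` and `φ(t, x)` persists for
nearby times and values, and applying the increasing inverse traps it on the correct side of `z`. -/
theorem continuousAt_invFun (hJ : IsOpen J) (hφ : A.IsSmoothDiffFamily₁ J φ) {t : ℝ}
    (ht : t ∈ J) (x : ℝ) :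
    ContinuousAt (fun p : ℝ × ℝ => Function.invFun (φ p.1) p.2) (t, φ t x) := by
  have hj := hφ.jointlySmooth
  rw [ContinuousAt, invFun_apply (hφ.2 t ht), tendsto_order]
  have hJ' : ∀ᶠ p : ℝ × ℝ in 𝓝 (t, φ t x), p.1 ∈ J :=
    continuousAt_fst.eventually (hJ.eventually_mem ht)
  have hc : ∀ z, ContinuousAt (fun p : ℝ × ℝ => φ p.1 z) (t, φ t x) := fun z =>
    ContinuousAt.comp (g := fun τ => φ τ z) (f := Prod.fst)
      (hj.contDiffAt_param hJ ht z).continuousAt continuousAt_fst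
  constructor
  · intro z hz
    have h1 : φ t z < φ t x := strictMono_of_mem_diff₁ (hφ.2 t ht) hz
    filter_upwards [hJ', (hc z).eventually_lt continuousAt_snd h1] with p hp hlt
    rw [← apply_invFun (hφ.2 _ hp) p.2] at hlt
    exact (strictMono_of_mem_diff₁ (hφ.2 _ hp)).lt_iff_lt.1 hlt
  · intro z hz
    have h1 : φ t x < φ t z := strictMono_of_mem_diff₁ (hφ.2 t ht) hz
    filter_upwards [hJ', continuousAt_snd.eventually_lt (hc z) h1] with p hp hlt
    rw [← apply_invFun (hφ.2 _ hp) p.2] at hlt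
    exact (strictMono_of_mem_diff₁ (hφ.2 _ hp)).lt_iff_lt.1 hlt

/-- The linear automorphism `(a, b) ↦ (a, p a + q b)` of the plane. -/
noncomputable def shearEquiv (p q : ℝ) (hq : q ≠ 0) : (ℝ × ℝ) ≃L[ℝ] ℝ × ℝ :=
  ContinuousLinearEquiv.equivOfInverse
    ((ContinuousLinearMap.fst ℝ ℝ ℝ).prod
      (p • ContinuousLinearMap.fst ℝ ℝ ℝ + q • ContinuousLinearMap.snd ℝ ℝ ℝ))
    ((ContinuousLinearMap.fst ℝ ℝ ℝ).prod
      ((-(p / q)) • ContinuousLinearMap.fst ℝ ℝ ℝ + q⁻¹ • ContinuousLinearMap.snd ℝ ℝ ℝ))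
    (fun v => by ext <;> simp; field_simp; ring)
    (fun v => by ext <;> simp; field_simp; ring)

/-- The map `(t, y) ↦ (t, φ(t)⁻¹ y)` inverts `(t, x) ↦ (t, φ(t, x))`, whose derivative is a shear
that is invertible because `φ_x > 0`. As the inverse is already known to be continuous, it is
differentiable with the inverse shear as derivative. -/
theorem hasDerivAt_invFun_param (hJ : IsOpen J) (hφ : A.IsSmoothDiffFamily₁ J φ) {t : ℝ}
    (ht : t ∈ J) (x : ℝ) :
    HasDerivAt (fun τ => Function.invFun (φ τ) (φ t x))
      (-(velocity φ t x / deriv (φ t) x)) t := by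
  have hj := hφ.jointlySmooth
  have hq : deriv (φ t) x ≠ 0 := (hφ.deriv_pos hJ ht x).ne'
  have hinv : Function.invFun (φ t) (φ t x) = x := invFun_apply (hφ.2 t ht) x
  have h1 : HasFDerivAt (fun p : ℝ × ℝ => (p.1, Function.invFun (φ p.1) p.2))
      ((shearEquiv (velocity φ t x) (deriv (φ t) x) hq).symm : ℝ × ℝ →L[ℝ] ℝ × ℝ)
      (t, φ t x) := by
    refine HasFDerivAt.of_local_left_inverse (f := fun p : ℝ × ℝ => (p.1, φ p.1 p.2))
      (continuousAt_fst.prodMk (continuousAt_invFun hJ hφ ht x)) ?_ ?_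
    · simp only [hinv]
      exact hasFDerivAt_fst.prodMk (hj.hasFDerivAt_prod hJ ht x)
    · have hJ' : ∀ᶠ p : ℝ × ℝ in 𝓝 (t, φ t x), p.1 ∈ J :=
        continuousAt_fst.eventually (hJ.eventually_mem ht)
      filter_upwards [hJ'] with p hp
      rw [apply_invFun (hφ.2 _ hp)]
  have h2 := (HasFDerivAt.comp (f := fun τ => (τ, φ t x)) t h1
    (hasFDerivAt_prodMk_left t (φ t x))).snd.hasDerivAt
  refine h2.congr_deriv ?_
  simp [shearEquiv, ContinuousLinearEquiv.symm_equivOfInverse]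

theorem deriv_rightLogDeriv (hJ : IsOpen J) (hφ : A.IsSmoothDiffFamily₁ J φ) {t : ℝ}
    (ht : t ∈ J) (x : ℝ) : deriv (rightLogDeriv φ t) (φ t x)
      = velocity (fun τ => deriv (φ τ)) t x / deriv (φ t) x := by
  have hj := hφ.jointlySmooth
  rw [rightLogDeriv, (hasDerivAt_comp_invFun (hφ.2 t ht)
    ((hj.velocity hJ).differentiable_space hJ ht) _).deriv, Function.comp_apply,
    invFun_apply (hφ.2 t ht), hj.deriv_velocity hJ ht, div_eq_mul_inv]

theorem rightLogDeriv_apply (hφ : A.IsSmoothDiffFamily₁ J φ) {t : ℝ}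
    (ht : t ∈ J) (x : ℝ) : rightLogDeriv φ t (φ t x) = velocity φ t x := by
  rw [rightLogDeriv, Function.comp_apply, invFun_apply (hφ.2 t ht)]

/-- The chain rule for `φ_t(t, φ(t)⁻¹ y)`: this is the transport identity `u_t + u u_x = φ_tt ∘
φ⁻¹`. -/
theorem hasDerivAt_rightLogDeriv_param (hJ : IsOpen J) (hφ : A.IsSmoothDiffFamily₁ J φ) {t : ℝ}
    (ht : t ∈ J) (x : ℝ) :
    HasDerivAt (fun τ => rightLogDeriv φ τ (φ t x))
      (velocity (velocity φ) t x
        - rightLogDeriv φ t (φ t x) * deriv (rightLogDeriv φ t) (φ t x)) t := by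
  have hj := hφ.jointlySmooth
  have hinv : Function.invFun (φ t) (φ t x) = x := invFun_apply (hφ.2 t ht) x
  have h1 := (hj.velocity hJ).hasFDerivAt_prod hJ ht x
  rw [← hinv] at h1
  have h2 := HasFDerivAt.comp_hasDerivAt (f := fun τ => (τ, Function.invFun (φ τ) (φ t x))) t h1
    ((hasDerivAt_id t).prodMk (hasDerivAt_invFun_param hJ hφ ht x))
  rw [hinv] at h2
  refine h2.congr_deriv ?_
  rw [deriv_rightLogDeriv hJ hφ ht, rightLogDeriv_apply hφ ht, hj.deriv_velocity hJ ht]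
  simp
  ring

theorem integral_sq_deriv_rightLogDeriv (hJ : IsOpen J) (hφ : A.IsSmoothDiffFamily₁ J φ) {t : ℝ}
    (ht : t ∈ J) (x : ℝ) : ∫ z in Iic (φ t x), (deriv (rightLogDeriv φ t) z) ^ 2
      = ∫ z in Iic x, (velocity (fun τ => deriv (φ τ)) t z) ^ 2 / deriv (φ t) z := by
  rw [integral_Iic_eq_integral_comp (hφ.2 t ht)]
  congr 1
  funext z
  rw [deriv_rightLogDeriv hJ hφ ht]
  have := (hφ.deriv_pos hJ ht z).ne'
  field_simp

/-- Used with `f = φ_tt`: its limit at `-∞` is fixed, so differentiation in `x` loses no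
information. -/
theorem forall_eq_integral_Iic_iff {f g : ℝ → ℝ} (hf : A.Mem₁ f) (hg : A.Mem g) :
    (∀ x, f x = ∫ z in Iic x, g z) ↔ ∀ x, deriv f x = g x := by
  constructor
  · intro h x
    rw [funext h]
    exact (hasDerivAt_integral_Iic hg.contDiff.continuous hg.integrable x).deriv
  · intro h x
    rw [hf.eq_integral_Iic x, funext h]

/-- The Hunter–Saxton equation for `u = φ_t ∘ φ⁻¹` says `φ_ttx = φ_tx² / (2 φ_x)`. -/
theorem solvesHunterSaxton_iff (hJ : IsOpen J) (hφ : A.IsSmoothDiffFamily₁ J φ) {I : Set ℝ}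
    (hI : I ⊆ J) : SolvesHunterSaxton I (rightLogDeriv φ) ↔
      ∀ t ∈ I, ∀ x, velocity (velocity fun τ => deriv (φ τ)) t x
        = (velocity (fun τ => deriv (φ τ)) t x) ^ 2 / (2 * deriv (φ t) x) := by
  have hj := hφ.jointlySmooth
  refine forall₂_congr fun t ht => ?_
  have htJ := hI ht
  have hvv := ((hφ.velocity hJ).velocity hJ).mem₁ hJ htJ
  have hdvv : deriv (velocity (velocity φ) t) = velocity (velocity fun τ => deriv (φ τ)) t := by
    rw [(hj.velocity hJ).deriv_velocity hJ htJ]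
    exact velocity_congr hJ (fun τ hτ => hj.deriv_velocity hJ hτ) htJ
  have hv : A.Mem (velocity (fun τ => deriv (φ τ)) t) := by
    rw [← hj.deriv_velocity hJ htJ]
    exact ((hφ.velocity hJ).mem₁ hJ htJ).2.1
  have hg : A.Mem (fun z => 1 / 2 *
      ((velocity (fun τ => deriv (φ τ)) t z) ^ 2 / deriv (φ t) z)) := by
    have h := ((hv.mul hv.bddSmooth).mul (bddSmooth_inv_deriv (hφ.2 t htJ))).smul (1 / 2)
    convert h using 1
    funext z
    simp only [Pi.smul_apply, Pi.mul_apply, smul_eq_mul]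
    ring
  have h1 := forall_eq_integral_Iic_iff hvv hg
  simp only [integral_const_mul, hdvv] at h1
  have h2 : (∀ x, velocity (velocity fun τ => deriv (φ τ)) t x
        = (velocity (fun τ => deriv (φ τ)) t x) ^ 2 / (2 * deriv (φ t) x)) ↔
      ∀ x, velocity (velocity fun τ => deriv (φ τ)) t x
        = 1 / 2 * ((velocity (fun τ => deriv (φ τ)) t x) ^ 2 / deriv (φ t) x) :=
    forall_congr' fun x => by
      rw [show (velocity (fun τ => deriv (φ τ)) t x) ^ 2 / (2 * deriv (φ t) x)
        = 1 / 2 * ((velocity (fun τ => deriv (φ τ)) t x) ^ 2 / deriv (φ t) x) by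
          rw [mul_comm 2, ← div_div]; ring]
  -- Every point of the line is some `φ(t, x)`, so the Eulerian equation may be tested at such
  -- points only.
  rw [h2, ← h1, (surjective_of_mem_diff₁ (hφ.2 t htJ)).forall]
  refine forall_congr' fun x => ?_
  rw [integral_sq_deriv_rightLogDeriv hJ hφ htJ]
  have h3 := hasDerivAt_rightLogDeriv_param hJ hφ htJ x
  constructor
  · intro h
    have := h3.unique h
    linarith
  · intro h
    rw [← h]
    exact h3.congr_deriv (by ring)

end Lagrangian

/-! ### The energy of a curve -/

section Energy

variable {A : DecayClass} {J K : Set ℝ} {φ : ℝ → ℝ → ℝ} {a b : ℝ}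

/-- The time derivative of `√φ_x`. -/
noncomputable def rootSpeed (φ : ℝ → ℝ → ℝ) (t x : ℝ) : ℝ :=
  velocity (fun τ => deriv (φ τ)) t x / (2 * √(deriv (φ t) x))

theorem rootSpeed_sq {φ : ℝ → ℝ → ℝ} {t x : ℝ} (h : 0 < deriv (φ t) x) :
    4 * rootSpeed φ t x ^ 2 = velocity (fun τ => deriv (φ τ)) t x ^ 2 / deriv (φ t) x := by
  rw [rootSpeed, div_pow, mul_pow, Real.sq_sqrt h.le]
  field_simp
  ring

theorem hasDerivAt_sqrt_deriv (hJ : IsOpen J) (hφ : A.IsSmoothDiffFamily₁ J φ) {t : ℝ}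
    (ht : t ∈ J) (x : ℝ) : HasDerivAt (fun τ => √(deriv (φ τ) x)) (rootSpeed φ t x) t :=
  ((hφ.jointlySmooth.deriv_space hJ).hasDerivAt_param hJ ht x).sqrt (hφ.deriv_pos hJ ht x).ne'

theorem jointlySmooth_rootSpeed (hJ : IsOpen J) (hφ : A.IsSmoothDiffFamily₁ J φ) :
    JointlySmooth J (rootSpeed φ) := by
  have hΨ := hφ.jointlySmooth.deriv_space hJ
  rw [jointlySmooth_iff hJ]
  intro t ht x
  have hp := hφ.deriv_pos hJ ht x
  refine ((hΨ.velocity hJ).contDiffAt hJ ht x).div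
    (contDiffAt_const.mul ((hΨ.contDiffAt hJ ht x).sqrt hp.ne')) ?_
  have := Real.sqrt_pos.2 hp
  positivity

theorem exists_bound_velocity_deriv (hJ : IsOpen J) (hφ : A.IsSmoothDiffFamily₁ J φ)
    (hKJ : K ⊆ J) (hK : IsCompact K) :
    ∃ C : ℝ, 0 ≤ C ∧ ∀ t ∈ K, (∀ x, ‖velocity (fun τ => deriv (φ τ)) t x‖ ≤ C) ∧
      ∫⁻ x, ‖velocity (fun τ => deriv (φ τ)) t x‖ₑ ≤ ENNReal.ofReal C := by
  obtain ⟨C, hC0, hC⟩ := hφ.exists_bound_fderiv hJ hKJ hK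
  refine ⟨C, hC0, fun t ht => ?_⟩
  have hn : ∀ x, ‖fderiv ℝ (fun τ => deriv (φ τ) x) t‖
      = ‖velocity (fun τ => deriv (φ τ)) t x‖ := fun x => norm_deriv_eq_norm_fderiv.symm
  simpa only [← ofReal_norm, hn] using hC t ht

theorem exists_bound_rootSpeed (hJ : IsOpen J) (hφ : A.IsSmoothDiffFamily₁ J φ)
    (hKJ : K ⊆ J) (hK : IsCompact K) :
    ∃ C : ℝ, 0 ≤ C ∧ ∀ t ∈ K, (∀ x, ‖rootSpeed φ t x‖ ≤ C) ∧
      ∫⁻ x, ‖rootSpeed φ t x‖ₑ ≤ ENNReal.ofReal C := by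
  obtain ⟨C, hC0, hC⟩ := exists_bound_velocity_deriv hJ hφ hKJ hK
  obtain ⟨m, hm, hle⟩ := hφ.exists_lower_bound hJ hKJ hK
  have hsm := Real.sqrt_pos.2 hm
  have h1 : ∀ t ∈ K, ∀ x, ‖rootSpeed φ t x‖
      ≤ (2 * √m)⁻¹ * ‖velocity (fun τ => deriv (φ τ)) t x‖ := fun t ht x => by
    have h2 := Real.sqrt_le_sqrt (hle t ht x)
    rw [rootSpeed, norm_div, div_eq_inv_mul, Real.norm_eq_abs (2 * _),
      abs_of_nonneg (by positivity)]
    gcongr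
  refine ⟨(2 * √m)⁻¹ * C, by positivity, fun t ht => ⟨fun x => ?_, ?_⟩⟩
  · refine (h1 t ht x).trans ?_
    gcongr
    exact (hC t ht).1 x
  · rw [ENNReal.ofReal_mul (by positivity)]
    refine le_trans ?_ (mul_le_mul_right (hC t ht).2 _)
    rw [← lintegral_const_mul' _ _ ENNReal.ofReal_ne_top]
    refine lintegral_mono fun x => ?_
    rw [← ofReal_norm, ← ofReal_norm, ← ENNReal.ofReal_mul (by positivity)]
    exact ENNReal.ofReal_le_ofReal (h1 t ht x)

theorem lintegral_mul_le_of_bound {u v : ℝ → ℝ} {C C' : ℝ} (hC : 0 ≤ C)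
    (hu : ∀ x, ‖u x‖ ≤ C) (hv : ∫⁻ x, ‖v x‖ₑ ≤ ENNReal.ofReal C') :
    ∫⁻ x, ‖u x * v x‖ₑ ≤ ENNReal.ofReal (C * C') := by
  rw [ENNReal.ofReal_mul hC]
  refine le_trans ?_ (mul_le_mul_right hv _)
  rw [← lintegral_const_mul' _ _ ENNReal.ofReal_ne_top]
  refine lintegral_mono fun x => ?_
  rw [enorm_mul]
  gcongr
  rw [← ofReal_norm]
  exact ENNReal.ofReal_le_ofReal (hu x)

theorem restrict_Icc_prod (a b : ℝ) :
    ((volume.restrict (Icc a b)).prod volume : Measure (ℝ × ℝ))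
      = (volume : Measure (ℝ × ℝ)).restrict (Icc a b ×ˢ univ) := by
  rw [Measure.volume_eq_prod, ← Measure.prod_restrict, Measure.restrict_univ]

theorem integrable_prod_of_bound {g : ℝ → ℝ → ℝ}
    (hc : ContinuousOn (fun p : ℝ × ℝ => g p.1 p.2) (Icc a b ×ˢ univ)) {C : ℝ}
    (h : ∀ t ∈ Icc a b, ∫⁻ x, ‖g t x‖ₑ ≤ ENNReal.ofReal C) :
    Integrable (fun p : ℝ × ℝ => g p.1 p.2) ((volume.restrict (Icc a b)).prod volume) := by
  have hm : AEStronglyMeasurable (fun p : ℝ × ℝ => g p.1 p.2)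
      ((volume.restrict (Icc a b)).prod volume) := by
    rw [restrict_Icc_prod]
    exact hc.aestronglyMeasurable (measurableSet_Icc.prod MeasurableSet.univ)
  refine ⟨hm, ?_⟩
  rw [HasFiniteIntegral, lintegral_prod _ hm.enorm]
  calc ∫⁻ t in Icc a b, ∫⁻ x, ‖g t x‖ₑ ≤ ∫⁻ _ in Icc a b, ENNReal.ofReal C :=
        setLIntegral_mono measurable_const h
    _ < ⊤ := by
      rw [setLIntegral_const, Real.volume_Icc]
      exact ENNReal.mul_lt_top ENNReal.ofReal_lt_top ENNReal.ofReal_lt_top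

/-- Here the metric becomes flat, because `4 (∂_t √φ_x)² = φ_tx² / φ_x`. -/
theorem metric_velocity_eq (hJ : IsOpen J) (hφ : A.IsSmoothDiffFamily₁ J φ) {t : ℝ}
    (ht : t ∈ J) : metric (φ t) (velocity φ t) (velocity φ t)
      = 4 * ∫ x, rootSpeed φ t x * rootSpeed φ t x := by
  have hj := hφ.jointlySmooth
  have hd := (hj.velocity hJ).differentiable_space hJ ht
  rw [metric_eq_integral (hφ.2 t ht) hd hd, ← integral_const_mul]
  congr 1
  funext x
  rw [hj.deriv_velocity hJ ht, ← sq, ← sq, rootSpeed_sq (hφ.deriv_pos hJ ht x)]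

theorem integrable_rootSpeed_mul (hJ : IsOpen J) {φ' : ℝ → ℝ → ℝ}
    (hφ : A.IsSmoothDiffFamily₁ J φ) (hφ' : A.IsSmoothDiffFamily₁ J φ') (hab : Icc a b ⊆ J) :
    Integrable (fun p : ℝ × ℝ => rootSpeed φ p.1 p.2 * rootSpeed φ' p.1 p.2)
      ((volume.restrict (Icc a b)).prod volume) := by
  obtain ⟨C, hC0, hC⟩ := exists_bound_rootSpeed hJ hφ hab isCompact_Icc
  obtain ⟨C', hC'0, hC'⟩ := exists_bound_rootSpeed hJ hφ' hab isCompact_Icc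
  refine integrable_prod_of_bound (g := fun t x => rootSpeed φ t x * rootSpeed φ' t x)
    (C := C * C') ?_ fun t ht => lintegral_mul_le_of_bound hC0 (hC t ht).1 (hC' t ht).2
  exact ((jointlySmooth_rootSpeed hJ hφ).continuousOn.mul
    (jointlySmooth_rootSpeed hJ hφ').continuousOn).mono (prod_mono hab (subset_univ _))

theorem energy_eq (hJ : IsOpen J) (hφ : A.IsSmoothDiffFamily₁ J φ) (hle : a ≤ b)
    (hab : Icc a b ⊆ J) : energy a b φ = 2 * ∫ p : ℝ × ℝ,
      rootSpeed φ p.1 p.2 * rootSpeed φ p.1 p.2 ∂((volume.restrict (Icc a b)).prod volume) := by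
  rw [integral_prod _ (integrable_rootSpeed_mul hJ hφ hφ hab), energy,
    intervalIntegral.integral_of_le hle, ← integral_Icc_eq_integral_Ioc,
    setIntegral_congr_fun measurableSet_Icc
      (fun t ht => metric_velocity_eq hJ hφ (hab ht)), integral_const_mul]
  ring

/-- The metric is bounded along a smooth curve, on compact time intervals. -/
theorem exists_bound_metric (hJ : IsOpen J) (hφ : A.IsSmoothDiffFamily₁ J φ)
    (hKJ : K ⊆ J) (hK : IsCompact K) :
    ∃ C : ℝ, 0 ≤ C ∧ ∀ t ∈ K, Integrable (fun x => rootSpeed φ t x * rootSpeed φ t x) ∧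
      metric (φ t) (velocity φ t) (velocity φ t) ≤ C := by
  obtain ⟨C, hC0, hC⟩ := exists_bound_rootSpeed hJ hφ hKJ hK
  refine ⟨4 * (C * C), by positivity, fun t ht => ?_⟩
  have h1 := lintegral_mul_le_of_bound hC0 (hC t ht).1 (hC t ht).2
  have hc : Continuous (rootSpeed φ t) :=
    ((jointlySmooth_rootSpeed hJ hφ).contDiff_space hJ (hKJ ht)).continuous
  refine ⟨⟨(hc.mul hc).aestronglyMeasurable, h1.trans_lt ENNReal.ofReal_lt_top⟩, ?_⟩
  rw [metric_velocity_eq hJ hφ (hKJ ht)]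
  gcongr
  rw [integral_eq_lintegral_of_nonneg_ae (Eventually.of_forall fun x => mul_self_nonneg _)
    (hc.mul hc).aestronglyMeasurable]
  refine ENNReal.toReal_le_of_le_ofReal (by positivity) (le_trans (lintegral_mono fun x => ?_) h1)
  rw [← ofReal_norm]
  exact ENNReal.ofReal_le_ofReal (le_abs_self _)

end Energy

/-! ### Solutions of the Hunter–Saxton equation are critical points of the energy -/

section Sufficiency

variable {A : DecayClass} {J : Set ℝ} {a b : ℝ}

/-- The increment of a family whose derivative is bounded in `L^∞ ∩ L¹`. -/
theorem lintegral_sq_sub_le {h h' : ℝ → ℝ → ℝ} {s C : ℝ} (hC : 0 ≤ C)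
    (hd : ∀ σ ∈ uIcc 0 s, ∀ x, HasDerivAt (fun σ => h σ x) (h' σ x) σ)
    (hc : ContinuousOn (fun p : ℝ × ℝ => h' p.1 p.2) (uIcc 0 s ×ˢ univ))
    (hb : ∀ σ ∈ uIcc 0 s, ∀ x, ‖h' σ x‖ ≤ C)
    (hi : ∀ σ ∈ uIcc 0 s, ∫⁻ x, ‖h' σ x‖ₑ ≤ ENNReal.ofReal C) :
    ∫⁻ x, ‖(h s x - h 0 x) * (h s x - h 0 x)‖ₑ ≤ ENNReal.ofReal (C ^ 2 * s ^ 2) := by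
  have hcx : ∀ x, ContinuousOn (fun σ => h' σ x) (uIcc 0 s) := fun x =>
    hc.comp (continuousOn_id.prodMk continuousOn_const) fun σ hσ => ⟨hσ, mem_univ _⟩
  have hftc : ∀ x, h s x - h 0 x = ∫ σ in (0 : ℝ)..s, h' σ x := fun x =>
    (intervalIntegral.integral_eq_sub_of_hasDerivAt (fun σ hσ => hd σ hσ x)
      (hcx x).intervalIntegrable).symm
  have hsup : ∀ x, ‖h s x - h 0 x‖ ≤ C * |s| := fun x => by
    rw [hftc]
    have := intervalIntegral.norm_integral_le_of_norm_le_const (a := 0) (b := s) (C := C)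
      (f := fun σ => h' σ x) fun σ hσ => hb σ (uIoc_subset_uIcc hσ) x
    simpa using this
  have hL1 : ∫⁻ x, ‖h s x - h 0 x‖ₑ ≤ ENNReal.ofReal (C * |s|) := by
    have hm : AEMeasurable (fun p : ℝ × ℝ => ‖h' p.2 p.1‖ₑ)
        ((volume : Measure ℝ).prod (volume.restrict (uIoc 0 s))) := by
      have hm1 : AEStronglyMeasurable (fun p : ℝ × ℝ => h' p.1 p.2)
          ((volume.restrict (uIoc 0 s)).prod (volume : Measure ℝ)) := by
        have : ((volume.restrict (uIoc 0 s)).prod volume : Measure (ℝ × ℝ))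
            = (volume : Measure (ℝ × ℝ)).restrict (uIoc 0 s ×ˢ univ) := by
          rw [Measure.volume_eq_prod, ← Measure.prod_restrict, Measure.restrict_univ]
        rw [this]
        exact (hc.mono (prod_mono uIoc_subset_uIcc subset_rfl)).aestronglyMeasurable
          (measurableSet_uIoc.prod MeasurableSet.univ)
      exact hm1.prod_swap.enorm
    calc ∫⁻ x, ‖h s x - h 0 x‖ₑ ≤ ∫⁻ x, ∫⁻ σ in uIoc 0 s, ‖h' σ x‖ₑ := by
          refine lintegral_mono fun x => ?_
          rw [hftc, ← ofReal_norm, intervalIntegral.norm_integral_eq_norm_integral_uIoc,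
            ofReal_norm]
          exact enorm_integral_le_lintegral_enorm _
      _ = ∫⁻ σ in uIoc 0 s, ∫⁻ x, ‖h' σ x‖ₑ := lintegral_lintegral_swap hm
      _ ≤ ∫⁻ _ in uIoc 0 s, ENNReal.ofReal C :=
          setLIntegral_mono measurable_const fun σ hσ => hi σ (uIoc_subset_uIcc hσ)
      _ = ENNReal.ofReal (C * |s|) := by
          rw [setLIntegral_const, Real.volume_uIoc, sub_zero, ENNReal.ofReal_mul hC]
  -- The squared `L²`-norm of the increment is at most its sup-norm times its `L¹`-norm, and each is
  -- bounded by `C |s|`.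
  refine (lintegral_mul_le_of_bound (by positivity) hsup hL1).trans
    (ENNReal.ofReal_le_ofReal (le_of_eq ?_))
  rw [← sq_abs s]
  ring

/-- The curve `t ↦ g(s, t)` of a variation `g`. -/
theorem DecayClass.IsSmoothDiffFamily₁.slice {I : Set ℝ} {g : ℝ × ℝ → ℝ → ℝ}
    (hg : A.IsSmoothDiffFamily₁ (I ×ˢ J) g) (hI : IsOpen I) (hJ : IsOpen J) {s : ℝ}
    (hs : s ∈ I) : A.IsSmoothDiffFamily₁ J (fun t => g (s, t)) := by
  have h := hg.comp (hI.prod hJ) (ContinuousLinearMap.inr ℝ ℝ ℝ) (s, 0) (U' := J)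
    fun t ht => by simpa using ⟨hs, ht⟩
  simpa using h

/-- For a variation `g`, the square root speed depends on the variation parameter in a Lipschitz
way, as a map into `L²`. -/
theorem exists_lintegral_sq_rootSpeed_sub_le {ε δ : ℝ} {g : ℝ × ℝ → ℝ → ℝ} (hJ : IsOpen J)
    (hg : A.IsSmoothDiffFamily₁ (Ioo (-ε) ε ×ˢ J) g) (hab : Icc a b ⊆ J) (hδ : δ < ε) :
    ∃ C : ℝ, 0 ≤ C ∧ ∀ s ∈ Icc (-δ) δ, ∀ t ∈ Icc a b,
      ∫⁻ x, ‖(rootSpeed (fun t => g (s, t)) t x - rootSpeed (fun t => g (0, t)) t x) *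
        (rootSpeed (fun t => g (s, t)) t x - rootSpeed (fun t => g (0, t)) t x)‖ₑ
        ≤ ENNReal.ofReal (C ^ 2 * s ^ 2) := by
  set U : Set (ℝ × ℝ) := Ioo (-ε) ε ×ˢ J with hUdef
  have hU : IsOpen U := isOpen_Ioo.prod hJ
  set K : Set (ℝ × ℝ) := Icc (-δ) δ ×ˢ Icc a b with hKdef
  have hKU : K ⊆ U := prod_mono
    (fun s hs => ⟨by linarith [hs.1], by linarith [hs.2]⟩) hab
  have hK : IsCompact K := isCompact_Icc.prod isCompact_Icc
  obtain ⟨C₁, hC₁0, hC₁⟩ := hg.exists_bound_fderiv hU hKU hK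
  obtain ⟨C₂, hC₂0, hC₂⟩ := hg.exists_bound_fderiv_fderiv hU hKU hK
  obtain ⟨m, hm, hle⟩ := hg.exists_lower_bound hU hKU hK
  have hsm := Real.sqrt_pos.2 hm
  have hΨ : JointlySmooth U (fun p x => deriv (g p) x) := hg.jointlySmooth.deriv_space hU
  have hDΨ := hΨ.fderiv_param hU
  have hDDΨ := hDΨ.fderiv_param hU
  set Ψ : ℝ × ℝ → ℝ → ℝ := fun p x => deriv (g p) x with hΨdef
  set Ψt : ℝ × ℝ → ℝ → ℝ := fun p x => fderiv ℝ (fun q => Ψ q x) p (0, 1) with hΨt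
  set Ψs : ℝ × ℝ → ℝ → ℝ := fun p x => fderiv ℝ (fun q => Ψ q x) p (1, 0) with hΨs
  set Ψts : ℝ × ℝ → ℝ → ℝ :=
    fun p x => fderiv ℝ (fderiv ℝ (fun q => Ψ q x)) p (1, 0) (0, 1) with hΨts
  have jt : JointlySmooth U Ψt := hDΨ.clm_comp (ContinuousLinearMap.apply ℝ ℝ ((0, 1) : ℝ × ℝ))
  have js : JointlySmooth U Ψs := hDΨ.clm_comp (ContinuousLinearMap.apply ℝ ℝ ((1, 0) : ℝ × ℝ))
  have jts : JointlySmooth U Ψts :=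
    (hDDΨ.clm_comp (ContinuousLinearMap.apply ℝ _ ((1, 0) : ℝ × ℝ))).clm_comp
      (ContinuousLinearMap.apply ℝ ℝ ((0, 1) : ℝ × ℝ))
  have hpos : ∀ p ∈ U, ∀ x, 0 < Ψ p x := fun p hp x => hg.deriv_pos hU hp x
  have n01 : ‖((0, 1) : ℝ × ℝ)‖ = 1 := by simp [Prod.norm_def]
  have n10 : ‖((1, 0) : ℝ × ℝ)‖ = 1 := by simp [Prod.norm_def]
  have bt : ∀ p x, ‖Ψt p x‖ ≤ ‖fderiv ℝ (fun q => Ψ q x) p‖ := fun p x => by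
    simpa [n01] using (fderiv ℝ (fun q => Ψ q x) p).le_opNorm (0, 1)
  have bs : ∀ p x, ‖Ψs p x‖ ≤ ‖fderiv ℝ (fun q => Ψ q x) p‖ := fun p x => by
    simpa [n10] using (fderiv ℝ (fun q => Ψ q x) p).le_opNorm (1, 0)
  have bts : ∀ p x, ‖Ψts p x‖ ≤ ‖fderiv ℝ (fderiv ℝ (fun q => Ψ q x)) p‖ := fun p x => by
    simpa [n01, n10] using
      (fderiv ℝ (fderiv ℝ (fun q => Ψ q x)) p).le_opNorm₂ (1, 0) (0, 1)
  -- `h` is the root speed of the slice through `p`, and `h'` is its derivative in the variation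
  -- parameter by the quotient rule.
  set h : ℝ × ℝ → ℝ → ℝ := fun p x => Ψt p x / (2 * √(Ψ p x)) with hh
  set h' : ℝ × ℝ → ℝ → ℝ := fun p x =>
    Ψts p x / (2 * √(Ψ p x)) - Ψt p x * Ψs p x / (4 * (Ψ p x * √(Ψ p x))) with hh'
  have hrs : ∀ p ∈ U, ∀ x, rootSpeed (fun t => g (p.1, t)) p.2 x = h p x := by
    rintro ⟨s, t⟩ hp x
    have h1 : HasFDerivAt (fun q => Ψ q x) (fderiv ℝ (fun q => Ψ q x) (s, t)) (s, t) :=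
      (hΨ.differentiableAt_param hU hp x).hasFDerivAt
    have h2 := (HasFDerivAt.comp (f := fun τ => (s, τ)) t h1
      (hasFDerivAt_prodMk_right s t)).hasDerivAt.deriv
    simp only [rootSpeed, hh, velocity]
    congr 1
  have hds : ∀ p ∈ U, ∀ x, HasDerivAt (fun σ => h (σ, p.2) x) (h' p x) p.1 := by
    rintro ⟨s, t⟩ hp x
    have hl : HasFDerivAt (fun σ : ℝ => (σ, t)) (ContinuousLinearMap.inl ℝ ℝ ℝ) s :=
      hasFDerivAt_prodMk_left s t
    have h1 : HasDerivAt (fun σ => Ψ (σ, t) x) (Ψs (s, t) x) s := by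
      have := (HasFDerivAt.comp (f := fun σ => (σ, t)) s
        (hΨ.differentiableAt_param hU hp x).hasFDerivAt hl).hasDerivAt
      simpa using! this
    have h2 : HasDerivAt (fun σ => Ψt (σ, t) x) (Ψts (s, t) x) s := by
      have h3 := (HasFDerivAt.comp (f := fun σ => (σ, t)) s
        (hDΨ.differentiableAt_param hU hp x).hasFDerivAt hl).hasDerivAt
      have h4 := h3.clm_apply (hasDerivAt_const s ((0, 1) : ℝ × ℝ))
      simpa using! h4
    have hq := hpos _ hp x
    have hq' := Real.sqrt_pos.2 hq
    have h5 := h2.div ((h1.sqrt hq.ne').const_mul 2) (by positivity)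
    refine h5.congr_deriv ?_
    have e : Ψ (s, t) x = √(Ψ (s, t) x) ^ 2 := (Real.sq_sqrt hq.le).symm
    simp only [hh']
    generalize √(Ψ (s, t) x) = r at *
    rw [e]
    field_simp
    ring
  have hcont : ContinuousOn (fun q : (ℝ × ℝ) × ℝ => h' q.1 q.2) (U ×ˢ univ) := by
    have c1 := hΨ.continuousOn
    have c2 := c1.sqrt
    refine (jts.continuousOn.div (continuousOn_const.mul c2) ?_).sub
      ((jt.continuousOn.mul js.continuousOn).div (continuousOn_const.mul (c1.mul c2)) ?_)
    · rintro ⟨p, x⟩ ⟨hp, -⟩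
      exact (mul_pos two_pos (Real.sqrt_pos.2 (hpos p hp x))).ne'
    · rintro ⟨p, x⟩ ⟨hp, -⟩
      have h1 := hpos p hp x
      exact (mul_pos four_pos (mul_pos h1 (Real.sqrt_pos.2 h1))).ne'
  -- Only one factor of the product `Ψt * Ψs` is replaced by its sup-bound `C₁`. The result can then
  -- be estimated both in sup-norm and in `L¹`.
  have hbd : ∀ p ∈ K, ∀ x, ‖h' p x‖ ≤ (2 * √m)⁻¹ * ‖fderiv ℝ (fderiv ℝ (fun q => Ψ q x)) p‖
      + C₁ * (4 * (m * √m))⁻¹ * ‖fderiv ℝ (fun q => Ψ q x) p‖ := by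
    intro p hp x
    have hmp : m ≤ Ψ p x := hle p hp x
    have hsq := Real.sqrt_le_sqrt hmp
    have hq : 0 < Ψ p x := hm.trans_le hmp
    refine (norm_sub_le _ _).trans (add_le_add ?_ ?_)
    · rw [norm_div, div_eq_inv_mul, Real.norm_eq_abs (2 * _), abs_of_nonneg (by positivity)]
      gcongr
      exact bts p x
    · rw [norm_div, norm_mul, div_eq_mul_inv, Real.norm_eq_abs (4 * _),
        abs_of_nonneg (by positivity), mul_right_comm]
      gcongr
      · exact (bt p x).trans ((hC₁ p hp).1 x)
      · exact bs p x
  set C := (2 * √m)⁻¹ * C₂ + C₁ * (4 * (m * √m))⁻¹ * C₁ with hCdef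
  refine ⟨C, by positivity, fun s hs t ht => ?_⟩
  have hsub : uIcc 0 s ⊆ Icc (-δ) δ := by
    refine uIcc_subset_Icc ⟨?_, ?_⟩ hs <;> linarith [hs.1, hs.2]
  have hmem : ∀ σ ∈ uIcc 0 s, (σ, t) ∈ K := fun σ hσ => ⟨hsub hσ, ht⟩
  have e : ∀ σ ∈ uIcc 0 s, ∀ x, rootSpeed (fun t => g (σ, t)) t x = h (σ, t) x :=
    fun σ hσ x => hrs (σ, t) (hKU (hmem σ hσ)) x
  simp only [e s right_mem_uIcc, e 0 left_mem_uIcc]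
  refine lintegral_sq_sub_le (h := fun σ => h (σ, t)) (h' := fun σ => h' (σ, t)) (by positivity)
    (fun σ hσ x => hds (σ, t) (hKU (hmem σ hσ)) x) ?_ ?_ ?_
  · exact hcont.comp (f := fun p : ℝ × ℝ => ((p.1, t), p.2)) (by fun_prop)
      fun p hp => ⟨hKU (hmem _ hp.1), mem_univ _⟩
  · intro σ hσ x
    refine (hbd _ (hmem σ hσ) x).trans ?_
    rw [hCdef]
    gcongr
    · exact (hC₂ _ (hmem σ hσ)).1 x
    · exact (hC₁ _ (hmem σ hσ)).1 x
  · intro σ hσ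
    have hp := hmem σ hσ
    have k₁ : 0 ≤ (2 * √m)⁻¹ := by positivity
    have k₂ : 0 ≤ C₁ * (4 * (m * √m))⁻¹ := by positivity
    calc ∫⁻ x, ‖h' (σ, t) x‖ₑ
        ≤ ∫⁻ x, (ENNReal.ofReal (2 * √m)⁻¹ * ‖fderiv ℝ (fderiv ℝ (fun q => Ψ q x)) (σ, t)‖ₑ
          + ENNReal.ofReal (C₁ * (4 * (m * √m))⁻¹) * ‖fderiv ℝ (fun q => Ψ q x) (σ, t)‖ₑ) := by
          refine lintegral_mono fun x => ?_
          rw [← ofReal_norm, ← ofReal_norm, ← ofReal_norm, ← ENNReal.ofReal_mul k₁,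
            ← ENNReal.ofReal_mul k₂, ← ENNReal.ofReal_add (by positivity) (by positivity)]
          exact ENNReal.ofReal_le_ofReal (hbd _ hp x)
      _ = ENNReal.ofReal (2 * √m)⁻¹ * (∫⁻ x, ‖fderiv ℝ (fderiv ℝ (fun q => Ψ q x)) (σ, t)‖ₑ)
          + ENNReal.ofReal (C₁ * (4 * (m * √m))⁻¹)
            * ∫⁻ x, ‖fderiv ℝ (fun q => Ψ q x) (σ, t)‖ₑ := by
          rw [lintegral_add_left, lintegral_const_mul' _ _ ENNReal.ofReal_ne_top,
            lintegral_const_mul' _ _ ENNReal.ofReal_ne_top]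
          exact ((hDDΨ.contDiff_space hU (hKU hp)).continuous.enorm.measurable).const_mul _
      _ ≤ ENNReal.ofReal (2 * √m)⁻¹ * ENNReal.ofReal C₂
          + ENNReal.ofReal (C₁ * (4 * (m * √m))⁻¹) * ENNReal.ofReal C₁ :=
          add_le_add (mul_le_mul_right (hC₂ _ hp).2 _) (mul_le_mul_right (hC₁ _ hp).2 _)
      _ = ENNReal.ofReal C := by
          rw [← ENNReal.ofReal_mul k₁, ← ENNReal.ofReal_mul k₂,
            ← ENNReal.ofReal_add (by positivity) (by positivity)]

/-- The numerator is the defect in the Lagrangian equation, so that equation says that `√φ_x` moves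
along a straight line. -/
theorem hasDerivAt_rootSpeed (hJ : IsOpen J) {φ : ℝ → ℝ → ℝ} (hφ : A.IsSmoothDiffFamily₁ J φ)
    {t : ℝ} (ht : t ∈ J) (x : ℝ) :
    HasDerivAt (fun τ => rootSpeed φ τ x)
      ((velocity (velocity fun τ => deriv (φ τ)) t x
        - (velocity (fun τ => deriv (φ τ)) t x) ^ 2 / (2 * deriv (φ t) x))
          / (2 * √(deriv (φ t) x))) t := by
  have hq := hφ.deriv_pos hJ ht x
  have hq' := Real.sqrt_pos.2 hq
  have hΨ := hφ.jointlySmooth.deriv_space hJ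
  have h5 := ((hΨ.velocity hJ).hasDerivAt_param hJ ht x).div
    ((hasDerivAt_sqrt_deriv hJ hφ ht x).const_mul 2) (by positivity)
  refine h5.congr_deriv ?_
  have e : deriv (φ t) x = √(deriv (φ t) x) ^ 2 := (Real.sq_sqrt hq.le).symm
  rw [rootSpeed]
  generalize √(deriv (φ t) x) = r at *
  rw [e]
  field_simp

/-- In the flat picture the energy is a squared norm. Expanding it around a straight line with fixed
end points leaves no linear term, only the square of `r_s - r_0`, which is at most a multiple of
`s²`. -/
theorem isGeodesic₁_of_eq {φ : ℝ → ℝ → ℝ} (hJ : IsOpen J) (hab : a < b) (habJ : Icc a b ⊆ J)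
    (heq : ∀ t ∈ Icc a b, ∀ x, velocity (velocity fun τ => deriv (φ τ)) t x
        = (velocity (fun τ => deriv (φ τ)) t x) ^ 2 / (2 * deriv (φ t) x)) :
    A.IsGeodesic₁ J a b φ := by
  intro ε g hε hg hg0 hends
  set μ : Measure (ℝ × ℝ) := (volume.restrict (Icc a b)).prod volume with hμ
  obtain ⟨C, hC0, hC⟩ := exists_lintegral_sq_rootSpeed_sub_le hJ hg habJ
    (show ε / 2 < ε by linarith)
  have hslice : ∀ s ∈ Ioo (-ε) ε, A.IsSmoothDiffFamily₁ J (fun t => g (s, t)) :=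
    fun s hs => hg.slice isOpen_Ioo hJ hs
  have h0 : (0 : ℝ) ∈ Ioo (-ε) ε := ⟨by linarith, hε⟩
  have hφ0 := hslice 0 h0
  have eΨ : ∀ t ∈ J, deriv (g (0, t)) = deriv (φ t) := fun t ht => by rw [hg0 t ht]
  have eP : ∀ t ∈ J, velocity (fun τ => deriv (g (0, τ))) t = velocity (fun τ => deriv (φ τ)) t :=
    fun t ht => velocity_congr hJ eΨ ht
  have ePP : ∀ t ∈ J, velocity (velocity fun τ => deriv (g (0, τ))) t
      = velocity (velocity fun τ => deriv (φ τ)) t :=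
    fun t ht => velocity_congr hJ eP ht
  have key : ∀ s ∈ Icc (-(ε / 2)) (ε / 2),
      ‖energy a b (fun t => g (s, t)) - energy a b (fun t => g (0, t))‖
        ≤ 2 * (C ^ 2 * (b - a)) * ‖‖s - 0‖ ^ 2‖ := by
    intro s hs
    have hsε : s ∈ Ioo (-ε) ε := ⟨by linarith [hs.1], by linarith [hs.2]⟩
    have hφs := hslice s hsε
    set r₀ := rootSpeed (fun t => g (0, t)) with hr₀
    set r := rootSpeed (fun t => g (s, t)) with hr
    have i1 : Integrable (fun p : ℝ × ℝ => r p.1 p.2 * r p.1 p.2) μ :=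
      integrable_rootSpeed_mul hJ hφs hφs habJ
    have i2 : Integrable (fun p : ℝ × ℝ => r₀ p.1 p.2 * r₀ p.1 p.2) μ :=
      integrable_rootSpeed_mul hJ hφ0 hφ0 habJ
    have i3 : Integrable (fun p : ℝ × ℝ => r₀ p.1 p.2 * r p.1 p.2) μ :=
      integrable_rootSpeed_mul hJ hφ0 hφs habJ
    have i4 : Integrable (fun p : ℝ × ℝ => r₀ p.1 p.2 * (r p.1 p.2 - r₀ p.1 p.2)) μ := by
      simpa only [mul_sub] using! i3.sub i2
    have i5 : Integrable
        (fun p : ℝ × ℝ => (r p.1 p.2 - r₀ p.1 p.2) * (r p.1 p.2 - r₀ p.1 p.2)) μ := by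
      refine ((i1.sub i2).sub (i4.const_mul 2)).congr (Eventually.of_forall fun p => ?_)
      simp only [Pi.sub_apply]
      ring
    -- Integrate in time first: for fixed `x`, `r₀` is constant in `t`, so the integrand is the
    -- derivative of `r₀` times the difference of the square roots, and that difference vanishes at
    -- `a` and `b`.
    have hcross : ∫ p : ℝ × ℝ, r₀ p.1 p.2 * (r p.1 p.2 - r₀ p.1 p.2) ∂μ = 0 := by
      rw [hμ, integral_prod_symm _ i4]
      refine integral_eq_zero_of_ae (Eventually.of_forall fun x => ?_)
      simp only [Pi.zero_apply]
      rw [integral_Icc_eq_integral_Ioc, ← intervalIntegral.integral_of_le hab.le]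
      have hd : ∀ t ∈ uIcc a b, HasDerivAt
          (fun t => r₀ t x * (√(deriv (g (s, t)) x) - √(deriv (g (0, t)) x)))
          (r₀ t x * (r t x - r₀ t x)) t := by
        intro t ht
        rw [uIcc_of_le hab.le] at ht
        have htJ := habJ ht
        have h1 := hasDerivAt_rootSpeed hJ hφ0 htJ x
        rw [ePP t htJ, eP t htJ, eΨ t htJ, heq t ht x, sub_self, zero_div] at h1
        have h2 := h1.mul ((hasDerivAt_sqrt_deriv hJ hφs htJ x).sub
          (hasDerivAt_sqrt_deriv hJ hφ0 htJ x))
        refine h2.congr_deriv ?_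
        rw [zero_mul, zero_add]
      have hcr : ∀ {ρ : ℝ → ℝ → ℝ}, JointlySmooth J ρ → ContinuousOn (fun t => ρ t x) (uIcc a b) :=
        fun {ρ} hρ t ht => by
          rw [uIcc_of_le hab.le] at ht
          exact (hρ.contDiffAt_param hJ (habJ ht) x).continuousAt.continuousWithinAt
      have j0 := hcr (jointlySmooth_rootSpeed hJ hφ0)
      have js := hcr (jointlySmooth_rootSpeed hJ hφs)
      rw [intervalIntegral.integral_eq_sub_of_hasDerivAt hd
        (j0.mul (js.sub j0)).intervalIntegrable]
      have e0 := hends 0 h0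
      have es := hends s hsε
      simp only [e0.1, e0.2, es.1, es.2, sub_self, mul_zero]
    have hquad : ∫ p : ℝ × ℝ, (r p.1 p.2 - r₀ p.1 p.2) * (r p.1 p.2 - r₀ p.1 p.2) ∂μ
        ≤ C ^ 2 * s ^ 2 * (b - a) := by
      rw [integral_eq_lintegral_of_nonneg_ae (Eventually.of_forall fun p => mul_self_nonneg _)
        i5.aestronglyMeasurable]
      have hba : 0 ≤ b - a := by linarith
      refine ENNReal.toReal_le_of_le_ofReal (by positivity) ?_
      rw [hμ, lintegral_prod _ i5.aestronglyMeasurable.aemeasurable.ennreal_ofReal,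
        ENNReal.ofReal_mul (by positivity)]
      calc _ ≤ ∫⁻ _ in Icc a b, ENNReal.ofReal (C ^ 2 * s ^ 2) := by
            refine setLIntegral_mono measurable_const fun t ht => ?_
            refine le_trans (lintegral_mono fun x => ?_) (hC s hs t ht)
            rw [← ofReal_norm]
            exact ENNReal.ofReal_le_ofReal (le_abs_self _)
        _ = _ := by rw [setLIntegral_const, Real.volume_Icc]
    have hdiff : energy a b (fun t => g (s, t)) - energy a b (fun t => g (0, t))
        = 2 * ∫ p : ℝ × ℝ, (r p.1 p.2 - r₀ p.1 p.2) * (r p.1 p.2 - r₀ p.1 p.2) ∂μ := by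
      rw [energy_eq hJ hφs hab.le habJ, energy_eq hJ hφ0 hab.le habJ, ← mul_sub,
        ← integral_sub i1 i2]
      have e : ∀ p : ℝ × ℝ, r p.1 p.2 * r p.1 p.2 - r₀ p.1 p.2 * r₀ p.1 p.2
          = (r p.1 p.2 - r₀ p.1 p.2) * (r p.1 p.2 - r₀ p.1 p.2)
            + 2 * (r₀ p.1 p.2 * (r p.1 p.2 - r₀ p.1 p.2)) := fun p => by ring
      simp only [e]
      rw [integral_add i5 (i4.const_mul 2), integral_const_mul, hcross, mul_zero, add_zero]
    rw [hdiff, Real.norm_of_nonneg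
      (mul_nonneg two_pos.le (integral_nonneg fun p => mul_self_nonneg _)), sub_zero,
      Real.norm_eq_abs s, sq_abs, Real.norm_of_nonneg (sq_nonneg s)]
    linarith
  have hO : (fun s => energy a b (fun t => g (s, t)) - energy a b (fun t => g (0, t)))
      =O[𝓝 0] fun s => ‖s - 0‖ ^ 2 :=
    Asymptotics.IsBigO.of_bound _ (by
      filter_upwards [Icc_mem_nhds (show -(ε / 2) < 0 by linarith) (show 0 < ε / 2 by linarith)]
        with s hs using key s hs)
  -- An increment of order `s²` has zero derivative at `0`; the energy is never differentiated under
  -- the integral sign.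
  have hF := Asymptotics.IsBigO.hasFDerivAt (𝕜 := ℝ) hO one_lt_two
  have hD := hF.hasDerivAt.add_const (energy a b (fun t => g (0, t)))
  simpa using! hD

end Sufficiency

/-! ### Geodesics solve the Hunter–Saxton equation -/

section Necessity

variable {A : DecayClass} {J : Set ℝ} {a b : ℝ} {φ : ℝ → ℝ → ℝ}

/-- The logarithmic derivative `φ_tx / φ_x`. -/
noncomputable def logSpeed (φ : ℝ → ℝ → ℝ) (t x : ℝ) : ℝ :=
  velocity (fun τ => deriv (φ τ)) t x / deriv (φ t) x

theorem jointlySmooth_logSpeed (hJ : IsOpen J) (hφ : A.IsSmoothDiffFamily₁ J φ) :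
    JointlySmooth J (logSpeed φ) := by
  have hΨ := hφ.jointlySmooth.deriv_space hJ
  rw [jointlySmooth_iff hJ]
  intro t ht x
  exact ((hΨ.velocity hJ).contDiffAt hJ ht x).div (hΨ.contDiffAt hJ ht x)
    (hφ.deriv_pos hJ ht x).ne'

theorem exists_bound_logSpeed (hJ : IsOpen J) (hφ : A.IsSmoothDiffFamily₁ J φ)
    {K : Set ℝ} (hKJ : K ⊆ J) (hK : IsCompact K) :
    ∃ C : ℝ, 0 ≤ C ∧ ∀ t ∈ K, ∀ x, |logSpeed φ t x| ≤ C := by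
  obtain ⟨C, hC0, hC⟩ := exists_bound_velocity_deriv hJ hφ hKJ hK
  obtain ⟨m, hm, hle⟩ := hφ.exists_lower_bound hJ hKJ hK
  refine ⟨C / m, by positivity, fun t ht x => ?_⟩
  rw [logSpeed, abs_div, abs_of_pos (hm.trans_le (hle t ht x))]
  exact div_le_div₀ hC0 ((hC t ht).1 x) hm (hle t ht x)

/-- This links the Euler–Lagrange density to the defect in the Lagrangian equation. The factor `2 /
φ_x` is positive, so the two vanish together. -/
theorem velocity_logSpeed (hJ : IsOpen J) (hφ : A.IsSmoothDiffFamily₁ J φ) {t : ℝ}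
    (ht : t ∈ J) (x : ℝ) : 2 * velocity (logSpeed φ) t x + logSpeed φ t x ^ 2
      = 2 / deriv (φ t) x * (velocity (velocity fun τ => deriv (φ τ)) t x
        - (velocity (fun τ => deriv (φ τ)) t x) ^ 2 / (2 * deriv (φ t) x)) := by
  have hΨ := hφ.jointlySmooth.deriv_space hJ
  have hp := (hφ.deriv_pos hJ ht x).ne'
  have h : velocity (logSpeed φ) t x = _ :=
    (((hΨ.velocity hJ).hasDerivAt_param hJ ht x).div (hΨ.hasDerivAt_param hJ ht x) hp).deriv
  rw [h, logSpeed]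
  field_simp
  ring

/-- Convexity of `(v, w) ↦ v² / w`. -/
theorem sq_div_ge {v w c : ℝ} (hw : 0 < w) : 2 * c * v - c ^ 2 * w ≤ v ^ 2 / w := by
  rw [le_div_iff₀ hw]
  nlinarith [sq_nonneg (v - c * w)]

/-- A linear variation of `φ`, in the direction `α(t) B(x)`. -/
noncomputable def linearVariation (φ : ℝ → ℝ → ℝ) (α β : ℝ → ℝ) (p : ℝ × ℝ) (x : ℝ) : ℝ :=
  φ p.2 x + p.1 * α p.2 * ∫ z in Iic x, β z

theorem deriv_linearVariation (hJ : IsOpen J) (hφ : A.IsSmoothDiffFamily₁ J φ) {α β : ℝ → ℝ}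
    (hβ : A.Mem β) {s t : ℝ} (ht : t ∈ J) (x : ℝ) :
    deriv (linearVariation φ α β (s, t)) x = deriv (φ t) x + s * α t * β x :=
  ((hφ.jointlySmooth.differentiable_space hJ ht x).hasDerivAt.add
    ((hasDerivAt_integral_Iic hβ.contDiff.continuous hβ.integrable x).const_mul _)).deriv

theorem velocity_deriv_linearVariation (hJ : IsOpen J) (hφ : A.IsSmoothDiffFamily₁ J φ)
    {α β : ℝ → ℝ} (hα : ContDiff ℝ ∞ α) (hβ : A.Mem β) {s t : ℝ} (ht : t ∈ J) (x : ℝ) :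
    velocity (fun τ => deriv (linearVariation φ α β (s, τ))) t x
      = velocity (fun τ => deriv (φ τ)) t x + s * deriv α t * β x := by
  have e : velocity (fun τ => deriv (linearVariation φ α β (s, τ))) t
      = velocity (fun τ x => deriv (φ τ) x + s * α τ * β x) t :=
    velocity_congr hJ (fun τ hτ => funext fun y => deriv_linearVariation hJ hφ hβ hτ y) ht
  rw [e]
  exact (((hφ.jointlySmooth.deriv_space hJ).hasDerivAt_param hJ ht x).add
    (((hasDerivAt_of hα t).const_mul s).mul_const (β x))).deriv

/-- On the compact interval `[a, b]` the derivative `φ_x` has a positive lower bound that small `s`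
cannot destroy. Elsewhere `α = 0` and nothing changes, so a single `ε` works on all of `J`. -/
theorem exists_isSmoothDiffFamily₁_linearVariation (hJ : IsOpen J) (habJ : Icc a b ⊆ J)
    (hφ : A.IsSmoothDiffFamily₁ J φ) {α β : ℝ → ℝ} (hα : ContDiff ℝ ∞ α)
    (hαs : tsupport α ⊆ Ioo a b) (hαc : HasCompactSupport α) (hβ : A.Mem β) :
    ∃ ε : ℝ, 0 < ε ∧ A.IsSmoothDiffFamily₁ (Ioo (-ε) ε ×ˢ J) (linearVariation φ α β) := by
  obtain ⟨m, hm, hle⟩ := hφ.exists_lower_bound hJ habJ isCompact_Icc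
  obtain ⟨Ma, hMa⟩ := hαc.exists_bound_of_continuous hα.continuous
  obtain ⟨Mb, hMb⟩ := hβ.bddSmooth.2 0
  simp only [iteratedDeriv_zero] at hMb
  have hMa0 : 0 ≤ Ma := (norm_nonneg _).trans (hMa 0)
  have hMb0 : 0 ≤ Mb := (abs_nonneg _).trans (hMb 0)
  -- Ensures `|s α β| < m` for `|s| < ε`; the `+ 1` makes this strict and the denominator positive.
  set ε := m / (Ma * Mb + 1) with hεdef
  have hε : 0 < ε := by positivity
  have hU : IsOpen (Ioo (-ε) ε ×ˢ J) := isOpen_Ioo.prod hJ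
  have hfam : A.IsSmoothFamily₁ (Ioo (-ε) ε ×ˢ J)
      (fun p x => linearVariation φ α β p x - x) := by
    have h1 := hφ.1.comp hJ (ContinuousLinearMap.snd ℝ ℝ ℝ) 0
      (U' := Ioo (-ε) ε ×ˢ J) fun p hp => by simpa using hp.2
    have h2 := hβ.mem₁_integral_Iic.isSmoothFamily₁_mul (U := Ioo (-ε) ε ×ˢ J)
      (c := fun p : ℝ × ℝ => p.1 * α p.2)
      (contDiff_fst.mul (hα.comp contDiff_snd)).contDiffOn hU
    have h3 := h1.add h2 hU
    have e : (fun (p : ℝ × ℝ) x => linearVariation φ α β p x - x)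
        = fun p x => (φ (ContinuousLinearMap.snd ℝ ℝ ℝ p + 0) x - x)
          + p.1 * α p.2 * ∫ z in Iic x, β z := by
      funext p x
      simp only [linearVariation, ContinuousLinearMap.coe_snd', add_zero]
      ring
    rw [e]
    exact h3
  have hj : JointlySmooth (Ioo (-ε) ε ×ˢ J) (linearVariation φ α β) := by
    have h := ContDiffOn.add hfam.1
      (contDiff_snd.contDiffOn (s := (Ioo (-ε) ε ×ˢ J) ×ˢ (univ : Set ℝ)))
    exact h.congr fun p _ => by simp
  refine ⟨ε, hε, hfam, ?_⟩
  rintro ⟨s, t⟩ hp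
  refine ⟨hfam.mem₁ hU hp, fun x => ?_⟩
  rw [hj.deriv_sub_id hU hp, deriv_linearVariation hJ hφ hβ hp.2]
  suffices 0 < deriv (φ t) x + s * α t * β x by linarith
  by_cases ht : t ∈ Icc a b
  · have h1 : |s * α t * β x| < m := by
      have hs : |s| < ε := abs_lt.2 hp.1
      rw [abs_mul, abs_mul, mul_assoc]
      calc |s| * (|α t| * |β x|) ≤ ε * (Ma * Mb) := by
            gcongr
            · exact hMa t
            · exact hMb x
        _ < ε * (Ma * Mb + 1) := by gcongr; linarith
        _ = m := by rw [hεdef]; field_simp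
    linarith [(abs_lt.1 h1).1, hle t ht x]
  · have h0 : α t = 0 := image_eq_zero_of_notMem_tsupport fun h => ht (Ioo_subset_Icc_self (hαs h))
    rw [h0]
    simpa using hφ.deriv_pos hJ hp.2 x

theorem tsupport_endpoints {α : ℝ → ℝ} (hαs : tsupport α ⊆ Ioo a b) : α a = 0 ∧ α b = 0 :=
  ⟨image_eq_zero_of_notMem_tsupport fun h => (hαs h).1.false,
    image_eq_zero_of_notMem_tsupport fun h => (hαs h).2.false⟩

/-- The first variation of the energy in the direction `α(t) B(x)` vanishes along a geodesic. -/
theorem DecayClass.IsGeodesic₁.integral_variation_eq_zero (hgeo : A.IsGeodesic₁ J a b φ)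
    (hJ : IsOpen J) (hab : a < b) (habJ : Icc a b ⊆ J) (hφ : A.IsSmoothDiffFamily₁ J φ)
    {α β : ℝ → ℝ} (hα : ContDiff ℝ ∞ α) (hαs : tsupport α ⊆ Ioo a b)
    (hαc : HasCompactSupport α) (hβ : A.Mem β) :
    Integrable (fun p : ℝ × ℝ => (2 * logSpeed φ p.1 p.2 * deriv α p.1
      - logSpeed φ p.1 p.2 ^ 2 * α p.1) * β p.2) ((volume.restrict (Icc a b)).prod volume) ∧
    ∫ p : ℝ × ℝ, (2 * logSpeed φ p.1 p.2 * deriv α p.1 - logSpeed φ p.1 p.2 ^ 2 * α p.1) * β p.2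
      ∂((volume.restrict (Icc a b)).prod volume) = 0 := by
  set μ : Measure (ℝ × ℝ) := (volume.restrict (Icc a b)).prod volume with hμ
  obtain ⟨ε, hε, hg⟩ := exists_isSmoothDiffFamily₁_linearVariation hJ habJ hφ hα hαs hαc hβ
  set g := linearVariation φ α β with hgdef
  have hg0 : ∀ t ∈ J, g (0, t) = φ t := fun t _ => by funext x; simp [hgdef, linearVariation]
  have hends : ∀ s ∈ Ioo (-ε) ε, g (s, a) = φ a ∧ g (s, b) = φ b := fun s _ => by
    constructor <;> funext x <;> simp [hgdef, linearVariation, tsupport_endpoints hαs]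
  have hE := hgeo ε g hε hg hg0 hends
  have i1 : Integrable (fun p : ℝ × ℝ => (2 * logSpeed φ p.1 p.2 * deriv α p.1
      - logSpeed φ p.1 p.2 ^ 2 * α p.1) * β p.2) μ := by
    obtain ⟨C, hC0, hC⟩ := exists_bound_logSpeed hJ hφ habJ isCompact_Icc
    obtain ⟨Ma, hMa⟩ := hαc.exists_bound_of_continuous hα.continuous
    obtain ⟨Md, hMd⟩ := hαc.deriv.exists_bound_of_continuous (contDiff_deriv hα).continuous
    have hMa0 : 0 ≤ Ma := (norm_nonneg _).trans (hMa 0)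
    have hMd0 : 0 ≤ Md := (norm_nonneg _).trans (hMd 0)
    have hβi : ∫⁻ x, ‖β x‖ₑ ≤ ENNReal.ofReal (∫⁻ x, ‖β x‖ₑ).toReal := by
      rw [ENNReal.ofReal_toReal hβ.integrable.2.ne]
    refine integrable_prod_of_bound (g := fun t x => (2 * logSpeed φ t x * deriv α t
      - logSpeed φ t x ^ 2 * α t) * β x)
      (C := (2 * C * Md + C ^ 2 * Ma) * (∫⁻ x, ‖β x‖ₑ).toReal) ?_ fun t ht =>
        lintegral_mul_le_of_bound (by positivity) (fun x => ?_) hβi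
    · have c1 := (jointlySmooth_logSpeed hJ hφ).continuousOn.mono
        (prod_mono habJ (subset_univ univ))
      have c2 : Continuous fun p : ℝ × ℝ => deriv α p.1 :=
        (contDiff_deriv hα).continuous.comp continuous_fst
      have c3 : Continuous fun p : ℝ × ℝ => α p.1 := hα.continuous.comp continuous_fst
      have c4 : Continuous fun p : ℝ × ℝ => β p.2 := hβ.contDiff.continuous.comp continuous_snd
      exact (((continuousOn_const.mul c1).mul c2.continuousOn).sub
        ((c1.pow 2).mul c3.continuousOn)).mul c4.continuousOn
    · refine (norm_sub_le _ _).trans (add_le_add ?_ ?_)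
      · rw [norm_mul, norm_mul, Real.norm_eq_abs 2, abs_two, Real.norm_eq_abs (logSpeed φ t x)]
        have h1 := hC t ht x
        have h2 := hMd t
        gcongr
      · rw [norm_mul, norm_pow, Real.norm_eq_abs (logSpeed φ t x)]
        have h1 := hC t ht x
        have h2 := hMa t
        gcongr
  refine ⟨i1, ?_⟩
  set D := ∫ p : ℝ × ℝ, (2 * logSpeed φ p.1 p.2 * deriv α p.1
      - logSpeed φ p.1 p.2 ^ 2 * α p.1) * β p.2 ∂μ with hD
  have hE0 : energy a b (fun t => g (0, t)) = 2 * ∫ p : ℝ × ℝ,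
      rootSpeed φ p.1 p.2 * rootSpeed φ p.1 p.2 ∂μ := by
    have hsl := hg.slice isOpen_Ioo hJ (s := 0) ⟨by linarith, hε⟩
    rw [energy_eq hJ hsl hab.le habJ]
    congr 1
    rw [hμ, restrict_Icc_prod]
    refine setIntegral_congr_fun (measurableSet_Icc.prod MeasurableSet.univ) fun p hp => ?_
    have e1 : ∀ t ∈ J, deriv (g (0, t)) = deriv (φ t) := fun t ht => by rw [hg0 t ht]
    have hpJ := habJ hp.1
    simp only [rootSpeed, velocity_congr hJ e1 hpJ, e1 _ hpJ]
  -- For a linear variation, `v = φ_tx` and `w = φ_x` are affine in `s`. The tangent bound for `v² /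
  -- w` with `c = v / w` taken at `s = 0` is therefore affine in `s` and exact there, so no
  -- differentiation under the integral is needed.
  have hineq : ∀ s ∈ Ioo (-ε) ε, energy a b (fun t => g (0, t)) + s * (D / 2)
      ≤ energy a b (fun t => g (s, t)) := by
    intro s hs
    have hsl := hg.slice isOpen_Ioo hJ hs
    rw [energy_eq hJ hsl hab.le habJ, hE0]
    have hrr := integrable_rootSpeed_mul hJ hφ hφ habJ
    have hss := integrable_rootSpeed_mul hJ hsl hsl habJ
    have h1 : (∫ p : ℝ × ℝ, rootSpeed φ p.1 p.2 * rootSpeed φ p.1 p.2 ∂μ) + s / 4 * D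
        ≤ ∫ p : ℝ × ℝ, rootSpeed (fun t => g (s, t)) p.1 p.2
          * rootSpeed (fun t => g (s, t)) p.1 p.2 ∂μ := by
      rw [hD, ← integral_const_mul, ← integral_add hrr (i1.const_mul _)]
      rw [hμ] at *
      rw [restrict_Icc_prod] at *
      refine setIntegral_mono_on (hrr.add (i1.const_mul _)) hss
        (measurableSet_Icc.prod MeasurableSet.univ) ?_
      rintro ⟨t, x⟩ ⟨ht, -⟩
      have htJ : t ∈ J := habJ ht
      have hp := hφ.deriv_pos hJ htJ x
      have hps := hsl.deriv_pos hJ htJ x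
      have e1 := rootSpeed_sq (φ := φ) hp
      have e2 := rootSpeed_sq (φ := fun t => g (s, t)) hps
      have h3 := sq_div_ge (v := velocity (fun τ => deriv (g (s, τ))) t x)
        (c := logSpeed φ t x) hps
      rw [← e2, velocity_deriv_linearVariation hJ hφ hα hβ htJ,
        deriv_linearVariation hJ hφ hβ htJ] at h3
      have e3 : velocity (fun τ => deriv (φ τ)) t x ^ 2 / deriv (φ t) x
          = 2 * logSpeed φ t x * velocity (fun τ => deriv (φ τ)) t x
            - logSpeed φ t x ^ 2 * deriv (φ t) x := by
        rw [logSpeed]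
        field_simp
        ring
      rw [e3] at e1
      simp only
      linarith
    linarith
  -- The derivative at this minimum is zero, but by criticality of the energy it is also `-D / 2`.
  have hmin : IsLocalMin (fun s => energy a b (fun t => g (s, t)) - s * (D / 2)) 0 := by
    filter_upwards [Ioo_mem_nhds (show -ε < 0 by linarith) hε] with s hs
    have := hineq s hs
    simp only [zero_mul, sub_zero]
    linarith
  have hder := hE.sub ((hasDerivAt_id (0 : ℝ)).mul_const (D / 2))
  have := hmin.hasDerivAt_eq_zero hder
  linarith

/-- The density of the first variation of the energy, up to a constant factor. -/
noncomputable def variationDensity (φ : ℝ → ℝ → ℝ) (t x : ℝ) : ℝ :=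
  2 * velocity (logSpeed φ) t x + logSpeed φ t x ^ 2

theorem continuousOn_variationDensity (hJ : IsOpen J) (hφ : A.IsSmoothDiffFamily₁ J φ) :
    ContinuousOn (fun p : ℝ × ℝ => variationDensity φ p.1 p.2) (J ×ˢ univ) :=
  (continuousOn_const.mul ((jointlySmooth_logSpeed hJ hφ).velocity hJ).continuousOn).add
    ((jointlySmooth_logSpeed hJ hφ).continuousOn.pow 2)

/-- The sum of the two integrands is the time derivative of `2 α φ_tx / φ_x`, which vanishes at both
ends because `α` does. -/
theorem integral_variation_by_parts (hJ : IsOpen J) (hab : a < b) (habJ : Icc a b ⊆ J)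
    (hφ : A.IsSmoothDiffFamily₁ J φ) {α : ℝ → ℝ} (hα : ContDiff ℝ ∞ α)
    (hαs : tsupport α ⊆ Ioo a b) (x : ℝ) :
    ∫ t in Icc a b, (2 * logSpeed φ t x * deriv α t - logSpeed φ t x ^ 2 * α t)
      = -∫ t in Icc a b, α t * variationDensity φ t x := by
  have hc := jointlySmooth_logSpeed hJ hφ
  have hcv := hc.velocity hJ
  rw [integral_Icc_eq_integral_Ioc, integral_Icc_eq_integral_Ioc,
    ← intervalIntegral.integral_of_le hab.le, ← intervalIntegral.integral_of_le hab.le,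
    ← intervalIntegral.integral_neg]
  have hcr : ∀ {ρ : ℝ → ℝ → ℝ}, JointlySmooth J ρ → ContinuousOn (fun t => ρ t x) (uIcc a b) :=
    fun {ρ} hρ t ht => by
      rw [uIcc_of_le hab.le] at ht
      exact (hρ.contDiffAt_param hJ (habJ ht) x).continuousAt.continuousWithinAt
  have cα : ContinuousOn α (uIcc a b) := hα.continuous.continuousOn
  have cdα : ContinuousOn (deriv α) (uIcc a b) := (contDiff_deriv hα).continuous.continuousOn
  have cl := hcr hc
  have cv := hcr hcv
  have i1 : IntervalIntegrable
      (fun t => 2 * logSpeed φ t x * deriv α t - logSpeed φ t x ^ 2 * α t) volume a b :=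
    (((continuousOn_const.mul cl).mul cdα).sub ((cl.pow 2).mul cα)).intervalIntegrable
  have i2 : IntervalIntegrable (fun t => -(α t * variationDensity φ t x)) volume a b :=
    (cα.mul ((continuousOn_const.mul cv).add (cl.pow 2))).neg.intervalIntegrable
  rw [← sub_eq_zero, ← intervalIntegral.integral_sub i1 i2,
    intervalIntegral.integral_eq_sub_of_hasDerivAt
      (f := fun t => 2 * logSpeed φ t x * α t) (fun t ht => ?_) (i1.sub i2)]
  · simp [tsupport_endpoints hαs]
  · rw [uIcc_of_le hab.le] at ht
    have h := ((hc.hasDerivAt_param hJ (habJ ht) x).const_mul 2).mul (hasDerivAt_of hα t)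
    refine h.congr_deriv ?_
    simp only [variationDensity]
    ring

/-- The density is controlled only for `t ∈ J`, but the product is zero off the support of `α`,
which lies inside `J`. Global continuity allows the time integral to be treated as a continuous
function of `x`. -/
theorem continuous_mul_variationDensity (hJ : IsOpen J) (habJ : Icc a b ⊆ J)
    (hφ : A.IsSmoothDiffFamily₁ J φ) {α : ℝ → ℝ} (hα : ContDiff ℝ ∞ α)
    (hαs : tsupport α ⊆ Ioo a b) :
    Continuous (fun p : ℝ × ℝ => α p.2 * variationDensity φ p.2 p.1) := by
  have hRc := continuousOn_variationDensity hJ hφ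
  refine continuous_iff_continuousAt.2 ?_
  rintro ⟨x, t⟩
  by_cases ht : t ∈ tsupport α
  · have htJ : t ∈ J := habJ (Ioo_subset_Icc_self (hαs ht))
    have h1 : ContinuousAt (fun p : ℝ × ℝ => variationDensity φ p.1 p.2) (t, x) :=
      hRc.continuousAt ((hJ.prod isOpen_univ).mem_nhds ⟨htJ, mem_univ _⟩)
    have h2 : ContinuousAt (fun p : ℝ × ℝ => variationDensity φ p.2 p.1) (x, t) :=
      ContinuousAt.comp (g := fun p : ℝ × ℝ => variationDensity φ p.1 p.2) (f := Prod.swap) h1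
        continuous_swap.continuousAt
    exact (hα.continuous.continuousAt.comp continuousAt_snd).mul h2
  · have h1 : ∀ᶠ p : ℝ × ℝ in 𝓝 (x, t), p.2 ∈ (tsupport α)ᶜ :=
      continuousAt_snd.eventually ((isClosed_tsupport α).isOpen_compl.eventually_mem ht)
    have h2 : (fun p : ℝ × ℝ => α p.2 * variationDensity φ p.2 p.1) =ᶠ[𝓝 (x, t)] fun _ => 0 := by
      filter_upwards [h1] with p hp
      rw [image_eq_zero_of_notMem_tsupport hp, zero_mul]
    exact h2.continuousAt

/-- With `α` fixed, letting `β` run over all test functions in `x` makes the time integral vanish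
almost everywhere; its continuity in `x` removes the exceptional set. -/
theorem DecayClass.IsGeodesic₁.integral_mul_variationDensity (hgeo : A.IsGeodesic₁ J a b φ)
    (hJ : IsOpen J) (hab : a < b) (habJ : Icc a b ⊆ J) (hφ : A.IsSmoothDiffFamily₁ J φ)
    {α : ℝ → ℝ} (hα : ContDiff ℝ ∞ α) (hαs : tsupport α ⊆ Ioo a b) (hαc : HasCompactSupport α)
    (x : ℝ) : ∫ t in Icc a b, α t * variationDensity φ t x = 0 := by
  set q : ℝ → ℝ := fun x => ∫ t in Icc a b, α t * variationDensity φ t x with hq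
  have hcont : Continuous q :=
    continuous_parametric_integral_of_continuous
      (f := fun x t => α t * variationDensity φ t x)
      (continuous_mul_variationDensity hJ habJ hφ hα hαs) isCompact_Icc
  have hae : ∀ᵐ x, q x = 0 := by
    refine ae_eq_zero_of_integral_contDiff_smul_eq_zero hcont.locallyIntegrable ?_
    intro β hβ hβc
    obtain ⟨hi, h0⟩ := hgeo.integral_variation_eq_zero hJ hab habJ hφ hα hαs hαc
      (A.mem_of_hasCompactSupport hβ hβc)
    rw [integral_prod_symm _ hi] at h0
    simp only [integral_mul_const, integral_variation_by_parts hJ hab habJ hφ hα hαs] at h0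
    have e : ∀ x, β x • q x = -((-q x) * β x) := fun x => by rw [smul_eq_mul]; ring
    simp only [e]
    rw [integral_neg, h0, neg_zero]
  exact congrFun ((Continuous.ae_eq_iff_eq volume hcont continuous_const).1 hae) x

/-- The fundamental lemma in `t`, now for each fixed `x`, gives vanishing on the open interval.
Continuity on `J` extends it to the end points. -/
theorem DecayClass.IsGeodesic₁.variationDensity_eq_zero (hgeo : A.IsGeodesic₁ J a b φ)
    (hJ : IsOpen J) (hab : a < b) (habJ : Icc a b ⊆ J) (hφ : A.IsSmoothDiffFamily₁ J φ)
    {t : ℝ} (ht : t ∈ Icc a b) (x : ℝ) : variationDensity φ t x = 0 := by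
  have hRt : ContinuousOn (fun t => variationDensity φ t x) J :=
    ContinuousOn.comp (g := fun p : ℝ × ℝ => variationDensity φ p.1 p.2) (f := fun t => (t, x))
      (continuousOn_variationDensity hJ hφ)
      (continuousOn_id.prodMk continuousOn_const) fun t ht => ⟨ht, mem_univ _⟩
  have hIJ : Ioo a b ⊆ J := Ioo_subset_Icc_self.trans habJ
  have hae : ∀ᵐ t, t ∈ Ioo a b → variationDensity φ t x = 0 := by
    refine isOpen_Ioo.ae_eq_zero_of_integral_contDiff_smul_eq_zero
      ((hRt.mono hIJ).locallyIntegrableOn measurableSet_Ioo) ?_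
    intro α hα hαc hαs
    rw [← hgeo.integral_mul_variationDensity hJ hab habJ hφ hα hαs hαc x]
    refine (setIntegral_eq_integral_of_forall_compl_eq_zero fun t ht => ?_).symm
    rw [image_eq_zero_of_notMem_tsupport fun h => ht (Ioo_subset_Icc_self (hαs h)), zero_smul]
  have h1 : (fun t => variationDensity φ t x) =ᵐ[volume.restrict (Ioo a b)] fun _ => 0 :=
    (ae_restrict_iff' measurableSet_Ioo).2 hae
  have h2 : EqOn (fun t => variationDensity φ t x) (fun _ => 0) (Ioo a b) :=
    Measure.eqOn_open_of_ae_eq h1 isOpen_Ioo (hRt.mono hIJ) continuousOn_const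
  exact h2.of_subset_closure (hRt.mono habJ) continuousOn_const Ioo_subset_Icc_self
    (by rw [closure_Ioo hab.ne]) ht

theorem eq_of_isGeodesic₁ (hJ : IsOpen J) (hab : a < b) (habJ : Icc a b ⊆ J)
    (hφ : A.IsSmoothDiffFamily₁ J φ) (hgeo : A.IsGeodesic₁ J a b φ) :
    ∀ t ∈ Icc a b, ∀ x, velocity (velocity fun τ => deriv (φ τ)) t x
        = (velocity (fun τ => deriv (φ τ)) t x) ^ 2 / (2 * deriv (φ t) x) := by
  intro t ht x
  have h0 := hgeo.variationDensity_eq_zero hJ hab habJ hφ ht x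
  rw [variationDensity, velocity_logSpeed hJ hφ (habJ ht)] at h0
  have hp := hφ.deriv_pos hJ (habJ ht) x
  exact sub_eq_zero.1 ((mul_eq_zero.1 h0).resolve_left (div_pos two_pos hp).ne')

theorem isGeodesic₁_iff (hJ : IsOpen J) (hab : a < b) (habJ : Icc a b ⊆ J)
    (hφ : A.IsSmoothDiffFamily₁ J φ) :
    A.IsGeodesic₁ J a b φ ↔ SolvesHunterSaxton (Icc a b) (rightLogDeriv φ) := by
  rw [solvesHunterSaxton_iff hJ hφ habJ]
  exact ⟨eq_of_isGeodesic₁ hJ hab habJ hφ, isGeodesic₁_of_eq hJ hab habJ⟩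

end Necessity

/-! ### The geodesic distance -/

section Distance

variable {A : DecayClass} {J : Set ℝ} {φ₀ φ₁ : ℝ → ℝ}

/-- A smooth path from `φ₀` to `φ₁` along the segment joining them. -/
noncomputable def segmentPath (φ₀ φ₁ : ℝ → ℝ) (t x : ℝ) : ℝ :=
  φ₀ x + Real.smoothTransition t * (φ₁ x - φ₀ x)

/-- `Real.smoothTransition` takes values in `[0, 1]` at all real times, so the path derivative is
always a convex combination of positive numbers. An affine coefficient could leave the group outside
`[0, 1]`. -/
theorem isSmoothDiffFamily₁_segmentPath (h₀ : φ₀ ∈ A.diff₁) (h₁ : φ₁ ∈ A.diff₁) :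
    A.IsSmoothDiffFamily₁ univ (segmentPath φ₀ φ₁) := by
  have hsub : A.Mem₁ (fun x => φ₁ x - φ₀ x) := by
    have h := A.alg₁.carrier.sub_mem (x := fun x => φ₁ x - x) (y := fun x => φ₀ x - x) h₁.1 h₀.1
    have e : (fun x => φ₁ x - x) - (fun x => φ₀ x - x) = fun x => φ₁ x - φ₀ x := by
      funext x; simp
    rw [e] at h
    exact h
  have hfam : A.IsSmoothFamily₁ univ (fun t x => segmentPath φ₀ φ₁ t x - x) := by
    have h := (h₀.1.isSmoothFamily₁_const (univ : Set ℝ) isOpen_univ).add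
      (hsub.isSmoothFamily₁_mul (U := univ) Real.smoothTransition.contDiff.contDiffOn isOpen_univ)
      isOpen_univ
    have e : (fun t x => segmentPath φ₀ φ₁ t x - x)
        = fun t x => φ₀ x - x + Real.smoothTransition t * (φ₁ x - φ₀ x) := by
      funext t x
      rw [segmentPath]
      ring
    rw [e]
    exact h
  refine ⟨hfam, fun t ht => ⟨hfam.mem₁ isOpen_univ ht, fun x => ?_⟩⟩
  have d0 := hasDerivAt_of_mem_diff₁ h₀ x
  have d1 := hasDerivAt_of_mem_diff₁ h₁ x
  have hd : HasDerivAt (fun y => segmentPath φ₀ φ₁ t y - y)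
      (deriv φ₀ x + Real.smoothTransition t * (deriv φ₁ x - deriv φ₀ x) - 1) x :=
    (d0.add ((d1.sub d0).const_mul _)).sub (hasDerivAt_id x)
  rw [hd.deriv]
  have p0 := deriv_pos_of_mem_diff₁ h₀ x
  have p1 := deriv_pos_of_mem_diff₁ h₁ x
  have s0 := Real.smoothTransition.nonneg t
  have s1 := Real.smoothTransition.le_one t
  rcases s1.eq_or_lt with h | h
  · rw [h]; linarith
  · nlinarith [mul_nonneg s0 p1.le, mul_pos (sub_pos.2 h) p0]

theorem length_lt_top (hJ : IsOpen J) {φ : ℝ → ℝ → ℝ} (hφ : A.IsSmoothDiffFamily₁ J φ)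
    (h01 : Icc 0 1 ⊆ J) : length φ < ⊤ := by
  obtain ⟨C, -, hC⟩ := exists_bound_metric hJ hφ h01 isCompact_Icc
  calc length φ ≤ ∫⁻ _ in Icc (0 : ℝ) 1, ENNReal.ofReal √C :=
        setLIntegral_mono measurable_const fun t ht =>
          ENNReal.ofReal_le_ofReal (Real.sqrt_le_sqrt (hC t ht).2)
    _ < ⊤ := by simp

theorem geodesicDist₁_lt_top (h₀ : φ₀ ∈ A.diff₁) (h₁ : φ₁ ∈ A.diff₁) :
    A.geodesicDist₁ φ₀ φ₁ < ⊤ := by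
  have hp := isSmoothDiffFamily₁_segmentPath h₀ h₁
  refine lt_of_le_of_lt ?_ (length_lt_top isOpen_univ hp (subset_univ _))
  refine iInf_le_of_le (segmentPath φ₀ φ₁) (iInf_le_of_le univ (iInf_le_of_le isOpen_univ
    (iInf_le_of_le (subset_univ _) (iInf_le_of_le hp (iInf_le_of_le ?_ (iInf_le _ ?_))))))
  · funext x; simp [segmentPath]
  · funext x; simp [segmentPath]

/-- The condition at `-∞` excludes translations, the kernel of `φ ↦ φ_x`. -/
theorem eq_of_deriv_eq (h₀ : φ₀ ∈ A.diff₁) (h₁ : φ₁ ∈ A.diff₁)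
    (h : ∀ x, deriv φ₀ x = deriv φ₁ x) : φ₀ = φ₁ := by
  funext x
  have e0 := h₀.1.eq_integral_Iic x
  have e1 := h₁.1.eq_integral_Iic x
  have e : deriv (fun y => φ₀ y - y) = deriv (fun y => φ₁ y - y) := by
    funext y
    have := h y
    rw [deriv_eq_of_mem_diff₁ h₀, deriv_eq_of_mem_diff₁ h₁] at this
    linarith
  rw [e, ← e1] at e0
  linarith

/-- Distinct diffeomorphisms have derivatives that differ on an interval. -/
theorem exists_interval_of_ne (h₀ : φ₀ ∈ A.diff₁) (h₁ : φ₁ ∈ A.diff₁) (hne : φ₀ ≠ φ₁) :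
    ∃ c d η : ℝ, c < d ∧ 0 < η ∧ ∀ x ∈ Icc c d, η ≤ |√(deriv φ₁ x) - √(deriv φ₀ x)| := by
  obtain ⟨x₀, hx₀⟩ : ∃ x, deriv φ₀ x ≠ deriv φ₁ x := by
    by_contra! h
    exact hne (eq_of_deriv_eq h₀ h₁ h)
  have hpos : 0 < |√(deriv φ₁ x₀) - √(deriv φ₀ x₀)| := by
    rw [abs_pos, sub_ne_zero]
    intro h
    exact hx₀ ((Real.sqrt_inj (deriv_pos_of_mem_diff₁ h₁ x₀).le
      (deriv_pos_of_mem_diff₁ h₀ x₀).le).1 h).symm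
  have hc : Continuous fun x => |√(deriv φ₁ x) - √(deriv φ₀ x)| :=
    (((bddSmooth_deriv h₁).1.continuous.sqrt).sub (bddSmooth_deriv h₀).1.continuous.sqrt).abs
  have hev := hc.continuousAt.eventually_const_le (half_lt_self hpos)
  obtain ⟨r, hr, hball⟩ := Metric.nhds_basis_closedBall.mem_iff.1 hev
  refine ⟨x₀ - r, x₀ + r, _, by linarith, half_pos hpos, fun x hx => ?_⟩
  rw [← Real.closedBall_eq_Icc] at hx
  exact hball hx

/-- Cauchy–Schwarz, from the integral of the squared deviation of `f` from its mean over the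
interval. -/
theorem sq_setIntegral_le {f : ℝ → ℝ} (hf : Continuous f) {c d : ℝ} (hcd : c < d) :
    (∫ x in Icc c d, f x) ^ 2 ≤ (d - c) * ∫ x in Icc c d, f x * f x := by
  have hL : 0 < d - c := sub_pos.2 hcd
  set y := ∫ x in Icc c d, f x with hy
  have i0 : IntegrableOn f (Icc c d) := hf.continuousOn.integrableOn_Icc
  have i1 : IntegrableOn (fun x => f x * f x) (Icc c d) :=
    (hf.mul hf).continuousOn.integrableOn_Icc
  have h0 : 0 ≤ ∫ x in Icc c d, ((f x * f x - 2 * (y / (d - c)) * f x) + (y / (d - c)) ^ 2) :=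
    integral_nonneg fun x => by
      have := sq_nonneg (f x - y / (d - c))
      simp only [Pi.zero_apply]
      linarith
  have i2 : IntegrableOn (fun x => 2 * (y / (d - c)) * f x) (Icc c d) := i0.const_mul _
  have i3 : IntegrableOn (fun x => f x * f x - 2 * (y / (d - c)) * f x) (Icc c d) := i1.sub i2
  rw [integral_add i3 (integrable_const _), integral_sub i1 i2, integral_const_mul, ← hy,
    setIntegral_const, Measure.real, Real.volume_Icc, ENNReal.toReal_ofReal hL.le, smul_eq_mul] at h0
  have e : (d - c) * ((∫ x in Icc c d, f x * f x) - 2 * (y / (d - c)) * y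
      + (d - c) * (y / (d - c)) ^ 2) = (d - c) * (∫ x in Icc c d, f x * f x) - y ^ 2 := by
    field_simp
    ring
  have := mul_nonneg hL.le h0
  linarith

/-- Cauchy–Schwarz on `[c, d]`, after which the square integral is enlarged to the whole line. The
factor `4` in the metric is given away. -/
theorem lintegral_rootSpeed_le (hJ : IsOpen J) {φ : ℝ → ℝ → ℝ} (hφ : A.IsSmoothDiffFamily₁ J φ)
    {t : ℝ} (ht : t ∈ J) {c d : ℝ} (hcd : c < d) :
    ∫⁻ x in Icc c d, ‖rootSpeed φ t x‖ₑ ≤ ENNReal.ofReal √(d - c) *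
      ENNReal.ofReal √(metric (φ t) (velocity φ t) (velocity φ t)) := by
  have hc : Continuous (rootSpeed φ t) :=
    ((jointlySmooth_rootSpeed hJ hφ).contDiff_space hJ ht).continuous
  obtain ⟨C, -, hC⟩ := exists_bound_metric hJ hφ (singleton_subset_iff.2 ht) isCompact_singleton
  have hi := (hC t rfl).1
  have hL : 0 < d - c := sub_pos.2 hcd
  have i0 : IntegrableOn (rootSpeed φ t) (Icc c d) := hc.continuousOn.integrableOn_Icc
  rw [← ofReal_integral_norm_eq_lintegral_enorm i0, ← ENNReal.ofReal_mul (Real.sqrt_nonneg _),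
    ← Real.sqrt_mul hL.le]
  refine ENNReal.ofReal_le_ofReal (Real.le_sqrt_of_sq_le ?_)
  refine (sq_setIntegral_le hc.norm hcd).trans (mul_le_mul_of_nonneg_left ?_ hL.le)
  simp only [Real.norm_eq_abs, abs_mul_abs_self]
  rw [metric_velocity_eq hJ hφ ht]
  have h1 : ∫ x in Icc c d, rootSpeed φ t x * rootSpeed φ t x
      ≤ ∫ x, rootSpeed φ t x * rootSpeed φ t x :=
    setIntegral_le_integral hi (Eventually.of_forall fun x => mul_self_nonneg _)
  have h2 : 0 ≤ ∫ x, rootSpeed φ t x * rootSpeed φ t x := integral_nonneg fun x => mul_self_nonneg _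
  linarith

/-- At each `x ∈ [c, d]` the net change of `√φ_x` is at most the time integral of the absolute root
speed. Integrating over `[c, d]`, exchanging the integrals and using Cauchy–Schwarz in `x` at each
time produces the length. -/
theorem le_length (hJ : IsOpen J) {φ : ℝ → ℝ → ℝ} (hφ : A.IsSmoothDiffFamily₁ J φ)
    (h01 : Icc 0 1 ⊆ J) {c d η : ℝ} (hcd : c < d)
    (hη : ∀ x ∈ Icc c d, η ≤ |√(deriv (φ 1) x) - √(deriv (φ 0) x)|) :
    ENNReal.ofReal η * ENNReal.ofReal (d - c) ≤ ENNReal.ofReal √(d - c) * length φ := by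
  have hr := jointlySmooth_rootSpeed hJ hφ
  have hpt : ∀ x ∈ Icc c d, ENNReal.ofReal η ≤ ∫⁻ t in Icc (0 : ℝ) 1, ‖rootSpeed φ t x‖ₑ := by
    intro x hx
    have hcont : ContinuousOn (fun t => rootSpeed φ t x) (uIcc 0 1) := fun t ht => by
      rw [uIcc_of_le zero_le_one] at ht
      exact (hr.contDiffAt_param hJ (h01 ht) x).continuousAt.continuousWithinAt
    have hftc : ∫ t in (0 : ℝ)..1, rootSpeed φ t x = √(deriv (φ 1) x) - √(deriv (φ 0) x) :=
      intervalIntegral.integral_eq_sub_of_hasDerivAt (fun t ht => by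
        rw [uIcc_of_le zero_le_one] at ht
        exact hasDerivAt_sqrt_deriv hJ hφ (h01 ht) x) hcont.intervalIntegrable
    rw [intervalIntegral.integral_of_le zero_le_one, ← integral_Icc_eq_integral_Ioc] at hftc
    refine (ENNReal.ofReal_le_ofReal (hη x hx)).trans ?_
    rw [← hftc, ← Real.norm_eq_abs, ofReal_norm]
    exact enorm_integral_le_lintegral_enorm _
  have hm : AEMeasurable (fun p : ℝ × ℝ => ‖rootSpeed φ p.2 p.1‖ₑ)
      ((volume.restrict (Icc c d)).prod (volume.restrict (Icc (0 : ℝ) 1))) := by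
    rw [Measure.prod_restrict, ← Measure.volume_eq_prod]
    refine ContinuousOn.aemeasurable ?_ (measurableSet_Icc.prod measurableSet_Icc)
    refine ContinuousOn.enorm ?_
    exact hr.continuousOn.comp (f := Prod.swap) continuous_swap.continuousOn
      fun p hp => ⟨h01 hp.2, mem_univ _⟩
  calc ENNReal.ofReal η * ENNReal.ofReal (d - c)
      = ∫⁻ _ in Icc c d, ENNReal.ofReal η := by rw [setLIntegral_const, Real.volume_Icc]
    _ ≤ ∫⁻ x in Icc c d, ∫⁻ t in Icc (0 : ℝ) 1, ‖rootSpeed φ t x‖ₑ :=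
        setLIntegral_mono' measurableSet_Icc hpt
    _ = ∫⁻ t in Icc (0 : ℝ) 1, ∫⁻ x in Icc c d, ‖rootSpeed φ t x‖ₑ := lintegral_lintegral_swap hm
    _ ≤ ∫⁻ t in Icc (0 : ℝ) 1, ENNReal.ofReal √(d - c) *
          ENNReal.ofReal √(metric (φ t) (velocity φ t) (velocity φ t)) :=
        setLIntegral_mono' measurableSet_Icc fun t ht =>
          lintegral_rootSpeed_le hJ hφ (h01 ht) hcd
    _ = ENNReal.ofReal √(d - c) * length φ := by
        rw [lintegral_const_mul' _ _ ENNReal.ofReal_ne_top, length]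

/-- The interval and the gap `η` depend only on the end points, so the lower bound on the length
survives the infimum over curves. -/
theorem geodesicDist₁_pos (h₀ : φ₀ ∈ A.diff₁) (h₁ : φ₁ ∈ A.diff₁) (hne : φ₀ ≠ φ₁) :
    0 < A.geodesicDist₁ φ₀ φ₁ := by
  obtain ⟨c, d, η, hcd, hη, hle⟩ := exists_interval_of_ne h₀ h₁ hne
  have hL : 0 < d - c := sub_pos.2 hcd
  have hpos : 0 < ENNReal.ofReal η * ENNReal.ofReal (d - c) / ENNReal.ofReal √(d - c) :=
    ENNReal.div_pos (mul_ne_zero (ENNReal.ofReal_pos.2 hη).ne' (ENNReal.ofReal_pos.2 hL).ne')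
      ENNReal.ofReal_ne_top
  refine hpos.trans_le ?_
  refine le_iInf fun φ => le_iInf fun J => le_iInf fun hJ => le_iInf fun h01 =>
    le_iInf fun hφ => le_iInf fun e0 => le_iInf fun e1 => ?_
  refine ENNReal.div_le_of_le_mul' (le_length hJ hφ h01 hcd ?_)
  rw [e0, e1]
  exact hle

end Distance

end HunterSaxton

theorem mainTheorem2 (A : DecayClass) :
    -- on `Diff_{𝒜₁}(ℝ)` the geodesic equation `u_t = -Ǧ⁻¹ ad(u)* Ǧ(u)` exists
    A.alg₁.GeodesicEquationExists ∧
    -- and `Ǧ⁻¹ ad(X)* Ǧ(X) = X X' - ½ ∫_{-∞}^x (X')²`, so that it is the Hunter–Saxton equation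
    (∀ X Y : A.alg₁.carrier, A.alg₁.flat Y = A.alg₁.adStar X (A.alg₁.flat X) ↔
      ∀ x, (Y : ℝ → ℝ) x = (X : ℝ → ℝ) x * deriv (X : ℝ → ℝ) x
        - 1 / 2 * ∫ z in Iic x, (deriv (X : ℝ → ℝ) z) ^ 2) ∧
    -- the geodesics are the curves whose right logarithmic derivative solves this equation
    (∀ (J : Set ℝ) (a b : ℝ) (φ : ℝ → ℝ → ℝ), IsOpen J → a < b → Icc a b ⊆ J →
      A.IsSmoothDiffFamily₁ J φ →
        (∀ t ∈ J, rightLogDeriv φ t ∈ A.alg₁.carrier) ∧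
        (A.IsGeodesic₁ J a b φ ↔ SolvesHunterSaxton (Icc a b) (rightLogDeriv φ))) ∧
    -- the geodesic distance is positive (and finite)
    (∀ φ₀ ∈ A.diff₁, ∀ φ₁ ∈ A.diff₁, φ₀ ≠ φ₁ →
      0 < A.geodesicDist₁ φ₀ φ₁ ∧ A.geodesicDist₁ φ₀ φ₁ < ⊤) ∧
    -- on `Diff_𝒜(ℝ)` the geodesic equation does not exist
    ¬ A.alg.GeodesicEquationExists ∧
    (∀ X : A.alg.carrier, X ≠ 0 →
      A.alg.adStar X (A.alg.flat X) ∉ LinearMap.range A.alg.flat) := by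
  exact ⟨geodesicEquationExists₁ A, flat_eq_adStar_iff,
    fun J a b φ hJ hab habJ hφ =>
      ⟨fun t ht => rightLogDeriv_mem hJ hφ ht, isGeodesic₁_iff hJ hab habJ hφ⟩,
    fun φ₀ h₀ φ₁ h₁ hne => ⟨geodesicDist₁_pos h₀ h₁ hne, geodesicDist₁_lt_top h₀ h₁⟩,
    not_geodesicEquationExists A, adStar_flat_notMem_range⟩
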